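/- Let $X$ be a separated quasi-compact scheme and let $\mathcal B$ be a sheaf of (not necessarily commutative) $\mathcal O_X$-algebras that is quasi-coherent as an $\mathcal O_X$-module. For a sheaf of $\mathcal O_X$-algebras $\mathcal R$ let $\mathcal R\text{-}\mathsf{Mod}$ be the category of sheaves of left $\mathcal R$-modules that are quasi-coherent over $\mathcal O_X$. Let $\mathcal P\in\mathcal B\text{-}\mathsf{Mod}$ be locally projective and locally finitely generated: every point of $X$ has an affine open neighbourhood $U$ such that $\mathcal P(U)$ is a finitely generated projective $\mathcal B(U)$-module. Put $\mathcal A=(\mathcal{E}nd_{\mathcal B}\mathcal P)^{\mathrm{op}}$, so that $\mathcal P$ is a $\mathcal B$-$\mathcal A$-bimodule, and $\mathcal P^\vee=\mathcal{H}om_{\mathcal B}(\mathcal P,\mathcal B)$, an $\mathcal A$-$\mathcal B$-bimodule. Then $\mathcal A$ is quasi-coherent over $\mathcal O_X$, the categories $\mathcal A\text{-}\mathsf{Mod}$ and $\mathcal B\text{-}\mathsf{Mod}$ are abelian (they are closed under finite products, kernels and cokernels in the categories of all sheaves of modules), and there are functors $$\mathsf F=\mathcal P\otimes_{\mathcal A}-:\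 \mathcal A\text{-}\mathsf{Mod}\to\mathcal B\text{-}\mathsf{Mod},\qquad \mathsf G=\mathcal{H}om_{\mathcal B}(\mathcal P,-):\ \mathcal B\text{-}\mathsf{Mod}\to\mathcal A\text{-}\mathsf{Mod},\qquad \mathsf H=\mathcal{H}om_{\mathcal A}(\mathcal P^\vee,-):\ \mathcal A\text{-}\mathsf{Mod}\to\mathcal B\text{-}\mathsf{Mod},$$ where $\mathsf H(\mathcal N)$ is taken in the quasi-coherent sense: it is a quasi-coherent $\mathcal B$-module with a natural morphism $\varepsilon_{\mathcal N}:\mathsf H(\mathcal N)\to\mathcal{H}om_{\mathcal A}(\mathcal P^\vee,\mathcal N)$ through which every morphism from a quasi-coherent $\mathcal B$-module to $\mathcal{H}om_{\mathcal A}(\mathcal P^\vee,\mathcal N)$ factors uniquely. The morphism $\varepsilon_{\mathcal N}$ is an isomorphism whenever $\mathcal{H}om_{\mathcal A}(\mathcal P^\vee,\mathcal N)$ is quasi-coherent, and it is so for all $\mathcal N$ if $X$ is noetherian and $\mathcal B$ is coherent over $\mathcal O_X$. Let $\mathscr C=\operatorname{Ker}\mathsf G$ be the full subcategory of all $\mathcal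 M\in\mathcal B\text{-}\mathsf{Mod}$ with $\mathsf G\mathcal M=0$. Let ${}^\perp\mathscr C$ be the full subcategory of all $\mathcal M\in\mathcal B\text{-}\mathsf{Mod}$ with $\operatorname{Hom}(\mathcal M,\mathcal K)=\operatorname{Ext}^1(\mathcal M,\mathcal K)=0$ for all $\mathcal K\in\mathscr C$, and $\mathscr C^\perp$ that of all $\mathcal M$ with $\operatorname{Hom}(\mathcal K,\mathcal M)=\operatorname{Ext}^1(\mathcal K,\mathcal M)=0$ for all $\mathcal K\in\mathscr C$ ($\operatorname{Hom}$ and $\operatorname{Ext}$ in $\mathcal B\text{-}\mathsf{Mod}$). Then: 1. $\mathsf G$ is exact, $\mathscr C$ is a Serre subcategory of $\mathcal B\text{-}\mathsf{Mod}$, and it is bilocalizing: the quotient functor $\Pi:\mathcal B\text{-}\mathsf{Mod}\to\mathcal B\text{-}\mathsf{Mod}/\mathscr C$ has both a left and a right adjoint. There is an equivalence $\mathcal B\text{-}\mathsf{Mod}/\mathscr C\simeq\mathcal A\text{-}\mathsf{Mod}$ whose composition with $\Pi$ is isomorphic to $\mathsf G$. 2. $\mathsf F$ is left adjoint to $\mathsf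 G$, and the unit $\mathbb 1\to\mathsf G\mathsf F$ is an isomorphism. 3. $\mathsf H$ is right adjoint to $\mathsf G$, and the counit $\mathsf G\mathsf H\to\mathbb 1$ is an isomorphism. 4. $\mathsf F$ is fully faithful with essential image ${}^\perp\mathscr C$; thus $\mathsf F$ and the restriction of $\mathsf G$ are quasi-inverse equivalences between $\mathcal A\text{-}\mathsf{Mod}$ and ${}^\perp\mathscr C$. 5. $\mathsf H$ is fully faithful with essential image $\mathscr C^\perp$; thus $\mathsf H$ and the restriction of $\mathsf G$ are quasi-inverse equivalences between $\mathcal A\text{-}\mathsf{Mod}$ and $\mathscr C^\perp$. 6. A module $\mathcal M\in\mathcal B\text{-}\mathsf{Mod}$ belongs to ${}^\perp\mathscr C$ if and only if for every point $x\in X$ there is an exact sequence of $\mathcal B_x$-modules $P_1\to P_0\to\mathcal M_x\to0$ in which $P_0$ and $P_1$ are direct sums (possibly infinite) of copies of $\mathcal P_x$. 7. A module $\mathcal M\in\mathcal B\text{-}\mathsf{Mod}$ belongs to $\mathscr C^\perp$ if and only if there is an exact sequence $0\to\mathcal M\to\mathsf H(\mathcal J_0)\to\mathsf H(\mathcal J_1)$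 in $\mathcal B\text{-}\mathsf{Mod}$ with $\mathcal J_0,\mathcal J_1$ injective objects of $\mathcal A\text{-}\mathsf{Mod}$. -/

import Mathlib

open CategoryTheory Limits Opposite TopologicalSpace AlgebraicGeometry

universe u

noncomputable section

namespace NCSheaf

variable {X : TopCat.{u}} {R : Sheaf (Opens.grothendieckTopology X) RingCat.{u}}

/-- The restriction map `M(V) → M(W)` of a sheaf of `R`-modules. -/
def res (M : SheafOfModules.{u} R) {W V : Opens X} (h : W ≤ V) :
    M.val.obj (op V) →ₛₗ[(R.obj.map (homOfLE h).op).hom] M.val.obj (op W) :=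
  M.val.restrictₛₗ (homOfLE h).op

lemma res_self (M : SheafOfModules.{u} R) {V : Opens X} (h : V ≤ V) (m : M.val.obj (op V)) :
    res M h m = m := by
  have := congrArg (fun f => f m) (congrArg (fun f => (ConcreteCategory.hom f))
    (M.val.presheaf.map_id (op V)))
  exact this

lemma res_res (M : SheafOfModules.{u} R) {U V W : Opens X} (h : V ≤ U) (h' : W ≤ V)
    (m : M.val.obj (op U)) : res M h' (res M h m) = res M (h'.trans h) m :=
  (M.val.map_comp_apply (homOfLE h).op (homOfLE h').op m).symm

lemma ring_res_res {U V W : Opens X} (h : V ≤ U) (h' : W ≤ V)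
    (r : R.obj.obj (op U)) : R.obj.map (homOfLE h').op (R.obj.map (homOfLE h).op r) =
      R.obj.map (homOfLE (h'.trans h)).op r := by
  rw [← ConcreteCategory.comp_apply, ← R.obj.map_comp]
  rfl

lemma res_smul (M : SheafOfModules.{u} R) {W V : Opens X} (h : W ≤ V)
    (r : R.obj.obj (op V)) (m : M.val.obj (op V)) :
    res M h (r • m) = R.obj.map (homOfLE h).op r • res M h m :=
  M.val.map_smul _ r m

lemma eq_of_res {M : SheafOfModules.{u} R} {ι : Type u} {U : ι → Opens X} {V : Opens X}
    (hU : ∀ i, U i ≤ V) (hV : V ≤ iSup U) {s t : M.val.obj (op V)}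
    (h : ∀ i, res M (hU i) s = res M (hU i) t) : s = t :=
  TopCat.Sheaf.eq_of_locally_eq' (⟨M.val.presheaf, M.isSheaf⟩ : TopCat.Sheaf AddCommGrpCat.{u} X)
    U V (fun i => homOfLE (hU i)) hV s t h

lemma exists_glue {M : SheafOfModules.{u} R} {ι : Type u} {U : ι → Opens X} {V : Opens X}
    (hU : ∀ i, U i ≤ V) (hV : V ≤ iSup U) (s : ∀ i, M.val.obj (op (U i)))
    (h : ∀ i j, res M (inf_le_left : U i ⊓ U j ≤ U i) (s i) =
      res M (inf_le_right : U i ⊓ U j ≤ U j) (s j)) :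
    ∃ t : M.val.obj (op V), ∀ i, res M (hU i) t = s i := by
  obtain ⟨t, ht, -⟩ := (TopCat.Sheaf.existsUnique_gluing'
    (⟨M.val.presheaf, M.isSheaf⟩ : TopCat.Sheaf AddCommGrpCat.{u} X)
    U V (fun i => homOfLE (hU i)) hV s (fun i j => h i j))
  exact ⟨t, ht⟩

/-- Families of `R(V)`-linear maps `M(V) → N(V)`, one for every open `V ⊆ U`. -/
abbrev Family (M N : SheafOfModules.{u} R) (U : Opens X) : Type u :=
  ∀ V : {V : Opens X // V ≤ U}, M.val.obj (op V.1) →ₗ[R.obj.obj (op V.1)] N.val.obj (op V.1)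

/-- A family of maps commutes with all restriction maps inside `U`. -/
def Compat {M N : SheafOfModules.{u} R} {U : Opens X} (φ : Family M N U) : Prop :=
  ∀ (V W : {V : Opens X // V ≤ U}) (h : W.1 ≤ V.1) (m : M.val.obj (op V.1)),
    φ W (res M h m) = res N h (φ V m)

/-- `Hom_{R|U}(M|U, N|U)`, as a group of compatible families. -/
def localHom (M N : SheafOfModules.{u} R) (U : Opens X) : AddSubgroup (Family M N U) where
  carrier := {φ | Compat φ}
  add_mem' ha hb V W h m := by simp [ha V W h m, hb V W h m]
  zero_mem' V W h m := by simp
  neg_mem' ha V W h m := by simp [ha V W h m]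

/-- `End_{R|U}(M|U)`, as a ring of compatible families. -/
def localEnd (M : SheafOfModules.{u} R) (U : Opens X) :
    Subring (∀ V : {V : Opens X // V ≤ U}, Module.End (R.obj.obj (op V.1)) (M.val.obj (op V.1))) where
  carrier := {φ | Compat (M := M) (N := M) φ}
  add_mem' := (localHom M M U).add_mem'
  zero_mem' := (localHom M M U).zero_mem'
  neg_mem' := (localHom M M U).neg_mem'
  one_mem' V W h m := rfl
  mul_mem' {a b} ha hb V W h m := by
    change a W (b W (res M h m)) = res M h (a V (b V m))
    rw [hb V W h m, ha V W h]

lemma localHom_ext {M N : SheafOfModules.{u} R} {U : Opens X} {φ ψ : localHom M N U}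
    (h : ∀ V m, φ.1 V m = ψ.1 V m) : φ = ψ :=
  Subtype.ext (funext fun V => LinearMap.ext (h V))

/-- Restriction of local homomorphisms to a smaller open set. -/
def localHomRes (M N : SheafOfModules.{u} R) {U' U : Opens X} (h : U' ≤ U) :
    localHom M N U →+ localHom M N U' where
  toFun φ := ⟨fun V => φ.1 ⟨V.1, V.2.trans h⟩, 
    fun V W hW m => φ.2 ⟨V.1, V.2.trans h⟩ ⟨W.1, W.2.trans h⟩ hW m⟩
  map_zero' := rfl
  map_add' _ _ := rfl

def localEndRes (M : SheafOfModules.{u} R) {U' U : Opens X} (h : U' ≤ U) :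
    localEnd M U →+* localEnd M U' where
  toFun φ := ⟨fun V => φ.1 ⟨V.1, V.2.trans h⟩, 
    fun V W hW m => φ.2 ⟨V.1, V.2.trans h⟩ ⟨W.1, W.2.trans h⟩ hW m⟩
  map_zero' := rfl
  map_add' _ _ := rfl
  map_one' := rfl
  map_mul' _ _ := rfl

/-- Local homomorphisms glue. -/
lemma localHom_glue {M N : SheafOfModules.{u} R} {ι : Type u} (U : ι → Opens X)
    (φ : ∀ i, localHom M N (U i))
    (hφ : ∀ i j, localHomRes M N (inf_le_left : U i ⊓ U j ≤ U i) (φ i) =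
      localHomRes M N (inf_le_right : U i ⊓ U j ≤ U j) (φ j)) :
    ∃! ψ : localHom M N (iSup U), ∀ i, localHomRes M N (le_iSup U i) ψ = φ i := by
  have key : ∀ i j (W : Opens X) (hi : W ≤ U i) (hj : W ≤ U j),
      (φ i).1 ⟨W, hi⟩ = (φ j).1 ⟨W, hj⟩ := fun i j W hi hj =>
    congrFun (congrArg Subtype.val (hφ i j)) ⟨W, le_inf hi hj⟩
  have cov : ∀ V : {V : Opens X // V ≤ iSup U}, V.1 ≤ ⨆ i, V.1 ⊓ U i := fun V => by
    rw [← inf_iSup_eq]; exact le_inf le_rfl V.2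
  have ex : ∀ (V : {V : Opens X // V ≤ iSup U}) (m : M.val.obj (op V.1)),
      ∃ n : N.val.obj (op V.1), ∀ i, res N (inf_le_left : V.1 ⊓ U i ≤ V.1) n =
        (φ i).1 ⟨V.1 ⊓ U i, inf_le_right⟩ (res M inf_le_left m) := by
    intro V m
    refine exists_glue (fun i => inf_le_left) (cov V) _ fun i j => ?_
    have h1 : (V.1 ⊓ U i) ⊓ (V.1 ⊓ U j) ≤ U i := inf_le_left.trans inf_le_right
    have h2 : (V.1 ⊓ U i) ⊓ (V.1 ⊓ U j) ≤ U j := inf_le_right.trans inf_le_right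
    rw [← (φ i).2 ⟨_, _⟩ ⟨_, h1⟩, ← (φ j).2 ⟨_, _⟩ ⟨_, h2⟩, res_res, res_res, key i j _ h1 h2]
  choose f hf using ex
  have uniq : ∀ (V : {V : Opens X // V ≤ iSup U}) (n n' : N.val.obj (op V.1)),
      (∀ i, res N (inf_le_left : V.1 ⊓ U i ≤ V.1) n = res N inf_le_left n') → n = n' :=
    fun V n n' h => eq_of_res (fun i => inf_le_left) (cov V) h
  let ψ : localHom M N (iSup U) := ⟨fun V =>
    { toFun := f V
      map_add' := fun a b => uniq V _ _ fun i => by simp [hf]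
      map_smul' := fun r a => uniq V _ _ fun i => by
        simp only [hf, res_smul, map_smul, RingHom.id_apply] }, by
    intro V W h m
    refine uniq W _ _ fun i => ?_
    have e : W.1 ⊓ U i ≤ V.1 ⊓ U i := inf_le_inf_right _ h
    change res N _ (f W _) = res N _ (res N h (f V m))
    rw [hf, res_res, res_res, ← res_res N inf_le_left e, hf,
      ← (φ i).2 ⟨_, _⟩ ⟨W.1 ⊓ U i, inf_le_right⟩ e, res_res]⟩
  refine ⟨ψ, fun i => ?_, fun ψ' h' => ?_⟩
  · ext V m
    refine uniq ⟨V.1, V.2.trans (le_iSup U i)⟩ _ _ fun j => ?_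
    change res N _ (f ⟨V.1, V.2.trans (le_iSup U i)⟩ m) = res N _ ((φ i).1 V m)
    rw [hf, ← (φ i).2 V ⟨V.1 ⊓ U j, inf_le_left.trans V.2⟩,
      key j i _ inf_le_right (inf_le_left.trans V.2)]
  · ext V m
    refine uniq V _ _ fun i => ?_
    change res N _ (ψ'.1 V m) = res N _ (f V m)
    rw [hf, ← ψ'.2 V ⟨V.1 ⊓ U i, inf_le_left.trans V.2⟩, ← h' i]
    rfl

/-- The presheaf of groups `U ↦ Hom_{R|U}(M|U, N|U)`. -/
def homPresheaf (M N : SheafOfModules.{u} R) : (Opens X)ᵒᵖ ⥤ AddCommGrpCat.{u} where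
  obj U := AddCommGrpCat.of (localHom M N U.unop)
  map f := AddCommGrpCat.ofHom (localHomRes M N f.unop.le)
  map_id _ := rfl
  map_comp _ _ := rfl

lemma homPresheaf_isSheaf (M N : SheafOfModules.{u} R) :
    TopCat.Presheaf.IsSheaf (homPresheaf M N) := by
  rw [TopCat.Presheaf.isSheaf_iff_isSheafUniqueGluing]
  intro ι U sf hsf
  exact localHom_glue U sf hsf

/-- The presheaf of rings `U ↦ (End_{R|U}(M|U))ᵒᵖ`. -/
def endOpPresheaf (M : SheafOfModules.{u} R) : (Opens X)ᵒᵖ ⥤ RingCat.{u} where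
  obj U := RingCat.of (localEnd M U.unop)ᵐᵒᵖ
  map f := RingCat.ofHom (localEndRes M f.unop.le).op
  map_id _ := rfl
  map_comp _ _ := rfl

lemma endOpPresheaf_isSheaf (M : SheafOfModules.{u} R) :
    TopCat.Presheaf.IsSheaf (endOpPresheaf M) := by
  rw [TopCat.Presheaf.isSheaf_iff_isSheafUniqueGluing]
  intro ι U sf hsf
  obtain ⟨ψ, h1, h2⟩ := localHom_glue (M := M) (N := M) U (fun i => (sf i).unop)
    (fun i j => congrArg MulOpposite.unop (hsf i j))
  refine ⟨MulOpposite.op ψ, fun i => congrArg MulOpposite.op (h1 i), fun ψ' h' => ?_⟩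
  exact congrArg MulOpposite.op (h2 ψ'.unop fun i => congrArg MulOpposite.unop (h' i))

/-- The sheaf of rings `(End_R M)ᵒᵖ`. -/
def endOp (M : SheafOfModules.{u} R) : Sheaf (Opens.grothendieckTopology X) RingCat.{u} :=
  ⟨endOpPresheaf M, endOpPresheaf_isSheaf M⟩

/-- `(End M)ᵒᵖ` acts on the left of `Hom(M, N)` by `a • φ = φ ∘ a`. -/
instance (M N : SheafOfModules.{u} R) (U : Opens X) :
    Module (localEnd M U)ᵐᵒᵖ (localHom M N U) where
  smul a φ := ⟨fun V => (φ.1 V).comp (a.unop.1 V), fun V W h m => by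
    change φ.1 W (a.unop.1 W (res M h m)) = res N h (φ.1 V (a.unop.1 V m))
    rw [a.unop.2 V W h m, φ.2 V W h]⟩
  one_smul _ := rfl
  mul_smul _ _ _ := rfl
  smul_zero _ := rfl
  smul_add _ _ _ := rfl
  add_smul a b φ := by
    ext V m
    exact map_add (φ.1 V) _ _
  zero_smul φ := by
    ext V m
    exact map_zero (φ.1 V)

instance (M N : SheafOfModules.{u} R) (U : (Opens X)ᵒᵖ) :
    Module ((endOp M).obj.obj U) ((homPresheaf M N).obj U) :=
  inferInstanceAs (Module (localEnd M U.unop)ᵐᵒᵖ (localHom M N U.unop))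

/-- The sheaf `Hom_R(M, N)` as a sheaf of left `(End_R M)ᵒᵖ`-modules. -/
def homObj (M N : SheafOfModules.{u} R) : SheafOfModules.{u} (endOp M) where
  val := PresheafOfModules.ofPresheaf (R := (endOp M).obj) (homPresheaf M N) (fun _ _ _ _ _ => rfl)
  isSheaf := homPresheaf_isSheaf M N

/-- Postcomposition with a morphism. -/
def homMap (M : SheafOfModules.{u} R) {N N' : SheafOfModules.{u} R} (f : N ⟶ N') :
    homObj M N ⟶ homObj M N' where
  val :=
    { app U := ModuleCat.ofHom
        { toFun φ := (⟨fun V => ((f.val.app (op V.1)).hom).comp (φ.1 V), fun V W h m => by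
            change f.val.app _ (φ.1 W (res M h m)) = _
            rw [φ.2 V W h]
            exact PresheafOfModules.naturality_apply f.val _ _⟩ : localHom M N' U.unop)
          map_add' φ φ' := by
            refine localHom_ext fun V m => ?_
            exact map_add ((f.val.app (op V.1)).hom) _ _
          map_smul' _ _ := rfl }
      naturality _ := rfl }

/-- The functor `Hom_R(M, -)` from `R`-modules to `(End_R M)ᵒᵖ`-modules. -/
def homFunctor (M : SheafOfModules.{u} R) : SheafOfModules.{u} R ⥤ SheafOfModules.{u} (endOp M) where
  obj N := homObj M N
  map f := homMap M f
  map_id _ := rfl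
  map_comp _ _ := rfl

/-- The dual `M^∨ = Hom_R(M, R)`, a left module over `(End_R M)ᵒᵖ`. -/
def dual (M : SheafOfModules.{u} R) : SheafOfModules.{u} (endOp M) :=
  homObj M (SheafOfModules.unit R)

/-- Right multiplication `γ ↦ γ · b` on `Hom_R(M, R)(V)`, for `b ∈ R(V)`. -/
def rightMul (M : SheafOfModules.{u} R) (V : Opens X) (b : R.obj.obj (op V))
    (γ : localHom M (SheafOfModules.unit R) V) : localHom M (SheafOfModules.unit R) V :=
  ⟨fun W => (LinearMap.toSpanSingleton (R.obj.obj (op W.1)) (R.obj.obj (op W.1))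
      (R.obj.map (homOfLE W.2).op b)).comp (γ.1 W), fun W W' h p => by
    refine (congrArg (LinearMap.toSpanSingleton (R.obj.obj (op W'.1)) (R.obj.obj (op W'.1))
      (R.obj.map (homOfLE W'.2).op b)) (γ.2 W W' h p)).trans ?_
    rw [← ring_res_res W.2 h b]
    exact (map_mul (R.obj.map (homOfLE h).op).hom _ _).symm⟩

lemma rightMul_apply (M : SheafOfModules.{u} R) (V : Opens X) (b : R.obj.obj (op V))
    (γ : localHom M (SheafOfModules.unit R) V) (W : {W : Opens X // W ≤ V})
    (p : M.val.obj (op W.1)) :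
    (rightMul M V b γ).1 W p =
      HMul.hMul (α := R.obj.obj (op W.1)) (γ.1 W p) (R.obj.map (homOfLE W.2).op b) := rfl

lemma rightMul_res (M : SheafOfModules.{u} R) {V V' : Opens X} (h : V' ≤ V)
    (b : R.obj.obj (op V)) (γ : localHom M (SheafOfModules.unit R) V) :
    rightMul M V' (R.obj.map (homOfLE h).op b) (localHomRes M _ h γ) =
      localHomRes M _ h (rightMul M V b γ) := by
  refine localHom_ext fun W p => ?_
  refine (rightMul_apply _ _ _ _ _ _).trans ?_
  rw [ring_res_res]
  rfl

lemma rightMul_one (M : SheafOfModules.{u} R) (V : Opens X)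
    (γ : localHom M (SheafOfModules.unit R) V) : rightMul M V 1 γ = γ := by
  refine localHom_ext fun W p => ?_
  refine (rightMul_apply _ _ _ _ _ _).trans ?_
  rw [map_one]
  exact mul_one (M := R.obj.obj (op W.1)) _

lemma rightMul_zero (M : SheafOfModules.{u} R) (V : Opens X)
    (γ : localHom M (SheafOfModules.unit R) V) : rightMul M V 0 γ = 0 := by
  refine localHom_ext fun W p => ?_
  refine (rightMul_apply _ _ _ _ _ _).trans ?_
  rw [map_zero]
  exact mul_zero (M₀ := R.obj.obj (op W.1)) _

lemma rightMul_mul (M : SheafOfModules.{u} R) (V : Opens X) (b b' : R.obj.obj (op V))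
    (γ : localHom M (SheafOfModules.unit R) V) :
    rightMul M V (b * b') γ = rightMul M V b' (rightMul M V b γ) := by
  refine localHom_ext fun W p => ?_
  refine (rightMul_apply _ _ _ _ _ _).trans ?_
  rw [map_mul]
  exact (mul_assoc (G := R.obj.obj (op W.1)) _ _ _).symm

lemma rightMul_add_left (M : SheafOfModules.{u} R) (V : Opens X) (b b' : R.obj.obj (op V))
    (γ : localHom M (SheafOfModules.unit R) V) :
    rightMul M V (b + b') γ = rightMul M V b γ + rightMul M V b' γ := by
  refine localHom_ext fun W p => ?_
  refine (rightMul_apply _ _ _ _ _ _).trans ?_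
  rw [map_add]
  exact mul_add (R := R.obj.obj (op W.1)) _ _ _

lemma rightMul_add (M : SheafOfModules.{u} R) (V : Opens X) (b : R.obj.obj (op V))
    (γ γ' : localHom M (SheafOfModules.unit R) V) :
    rightMul M V b (γ + γ') = rightMul M V b γ + rightMul M V b γ' :=
  localHom_ext fun W _ => add_mul (R := R.obj.obj (op W.1)) _ _ _

/-- The ring homomorphism `R(U) → (End_A M^∨)ᵒᵖ(U)`, where `A = (End_R M)ᵒᵖ`, given by the right
action of `R` on `M^∨`. -/
def dualAction (M : SheafOfModules.{u} R) (U : Opens X) :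
    R.obj.obj (op U) →+* (localEnd (dual M) U)ᵐᵒᵖ where
  toFun b := MulOpposite.op ⟨fun V =>
    { toFun γ := rightMul M V.1 (R.obj.map (homOfLE V.2).op b) γ
      map_add' γ γ' := rightMul_add M _ _ _ _
      map_smul' a γ := rfl }, fun V V' h γ => by
    have := rightMul_res M h (R.obj.map (homOfLE V.2).op b) γ
    rw [ring_res_res] at this
    exact this⟩
  map_one' := by
    refine congrArg MulOpposite.op (Subtype.ext (funext fun V => LinearMap.ext fun γ => ?_))
    change rightMul M V.1 _ γ = γ
    exact (congrArg (fun c => rightMul M V.1 c γ) (map_one _)).trans (rightMul_one _ _ _)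
  map_mul' b b' := by
    refine congrArg MulOpposite.op (Subtype.ext (funext fun V => LinearMap.ext fun γ => ?_))
    change rightMul M V.1 _ γ = rightMul M V.1 _ (rightMul M V.1 _ γ)
    exact (congrArg (fun c => rightMul M V.1 c γ) (map_mul _ _ _)).trans (rightMul_mul _ _ _ _ _)
  map_zero' := by
    refine congrArg MulOpposite.op (Subtype.ext (funext fun V => LinearMap.ext fun γ => ?_))
    change rightMul M V.1 _ γ = (0 : localHom M (SheafOfModules.unit R) V.1)
    exact (congrArg (fun c => rightMul M V.1 c γ) (map_zero _)).trans (rightMul_zero _ _ _)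
  map_add' b b' := by
    refine congrArg MulOpposite.op (Subtype.ext (funext fun V => LinearMap.ext fun γ => ?_))
    change rightMul M V.1 _ γ = rightMul M V.1 _ γ + rightMul M V.1 _ γ
    exact (congrArg (fun c => rightMul M V.1 c γ) (map_add _ _ _)).trans (rightMul_add_left _ _ _ _ _)

/-- The morphism of sheaves of rings `R → (End_A M^∨)ᵒᵖ`, where `A = (End_R M)ᵒᵖ`, given by the
right action of `R` on `M^∨`. -/
def dualActionHom (M : SheafOfModules.{u} R) : R ⟶ endOp (dual M) where
  hom :=
    { app U := RingCat.ofHom (dualAction M U.unop)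
      naturality U V f := by
        ext b
        refine congrArg MulOpposite.op (Subtype.ext (funext fun W => LinearMap.ext fun γ =>
          localHom_ext fun W' p => ?_))
        change (rightMul M W.1 (R.obj.map (homOfLE W.2).op (R.obj.map f b)) γ).1 W' p =
          (rightMul M W.1 (R.obj.map (homOfLE (W.2.trans f.unop.le)).op b) γ).1 W' p
        rw [← ring_res_res f.unop.le W.2]
        rfl }

/-- The functor `Hom_A(M^∨, -)` from modules over `A = (End_R M)ᵒᵖ` to `R`-modules. -/
def homDualFunctor (M : SheafOfModules.{u} R) :
    SheafOfModules.{u} (endOp M) ⥤ SheafOfModules.{u} R :=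
  homFunctor (dual M) ⋙ SheafOfModules.restrictScalars (dualActionHom M)

/-- The action of a section `a` of `(End_R M)ᵒᵖ` over `U` on `M(U)`. -/
def rightAct (M : SheafOfModules.{u} R) (U : (Opens X)ᵒᵖ) (a : (endOp M).obj.obj U) :
    M.val.obj U →ₗ[R.obj.obj U] M.val.obj U :=
  (show (localEnd M U.unop)ᵐᵒᵖ from a).unop.1 ⟨U.unop, le_rfl⟩

/-- The relations `p·a ⊗ n = p ⊗ a·n` of the tensor product over `(End_R M)ᵒᵖ`, where
`p·a = a(p)`. -/
def tensorRel (M : SheafOfModules.{u} R) (N : SheafOfModules.{u} (endOp M)) (U : (Opens X)ᵒᵖ) :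
    Submodule (R.obj.obj U) (TensorProduct ℤ (M.val.obj U) (N.val.obj U)) :=
  Submodule.span _ {t | ∃ (p : M.val.obj U) (a : (endOp M).obj.obj U) (n : N.val.obj U),
    t = TensorProduct.tmul ℤ (rightAct M U a p) n - TensorProduct.tmul ℤ p (a • n)}

/-- `M(U) ⊗_{A(U)} N(U)` for `A = (End_R M)ᵒᵖ`, as an `R(U)`-module. -/
abbrev TensorSections (M : SheafOfModules.{u} R) (N : SheafOfModules.{u} (endOp M))
    (U : (Opens X)ᵒᵖ) : Type u :=
  TensorProduct ℤ (M.val.obj U) (N.val.obj U) ⧸ tensorRel M N U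

/-- The class of `p ⊗ n`. -/
def tmul (M : SheafOfModules.{u} R) (N : SheafOfModules.{u} (endOp M)) (U : (Opens X)ᵒᵖ)
    (p : M.val.obj U) (n : N.val.obj U) : TensorSections M N U :=
  Submodule.Quotient.mk (TensorProduct.tmul ℤ p n)

lemma tmul_rel (M : SheafOfModules.{u} R) (N : SheafOfModules.{u} (endOp M)) (U : (Opens X)ᵒᵖ)
    (p : M.val.obj U) (a : (endOp M).obj.obj U) (n : N.val.obj U) :
    tmul M N U (rightAct M U a p) n = tmul M N U p (a • n) :=
  (Submodule.Quotient.eq _).2 (Submodule.subset_span ⟨p, a, n, rfl⟩)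

lemma tmul_smul (M : SheafOfModules.{u} R) (N : SheafOfModules.{u} (endOp M)) (U : (Opens X)ᵒᵖ)
    (r : R.obj.obj U) (p : M.val.obj U) (n : N.val.obj U) :
    r • tmul M N U p n = tmul M N U (r • p) n := rfl

/-- Semilinear maps out of the tensor product. -/
def tensorLift (M : SheafOfModules.{u} R) (N : SheafOfModules.{u} (endOp M)) (U : (Opens X)ᵒᵖ)
    {S : Type u} [Ring S] {T : Type u} [AddCommGroup T] [Module S T] (σ : R.obj.obj U →+* S)
    (f : M.val.obj U →+ N.val.obj U →+ T)
    (hf : ∀ (r : R.obj.obj U) p n, f (r • p) n = σ r • f p n)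
    (hf' : ∀ (a : (endOp M).obj.obj U) p n, f (rightAct M U a p) n = f p (a • n)) :
    TensorSections M N U →ₛₗ[σ] T :=
  have hz : ∀ (z : ℤ) p n, f (z • p) n = f p (z • n) := fun z p n => by
    rw [map_zsmul, map_zsmul, AddMonoidHom.zsmul_apply]
  (tensorRel M N U).liftQ
    { toFun := TensorProduct.liftAddHom f hz
      map_add' := map_add _
      map_smul' r t := by
        induction t with
        | zero => simp
        | add x y hx hy => simp only [smul_add, map_add, hx, hy]
        | tmul p n => exact hf r p n }
    (Submodule.span_le.2 (by
      rintro _ ⟨p, a, n, rfl⟩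
      exact LinearMap.mem_ker.2 ((map_sub _ _ _).trans (sub_eq_zero.2 (hf' a p n)))))

lemma tensorLift_tmul (M : SheafOfModules.{u} R) (N : SheafOfModules.{u} (endOp M))
    (U : (Opens X)ᵒᵖ) {S : Type u} [Ring S] {T : Type u} [AddCommGroup T] [Module S T]
    (σ : R.obj.obj U →+* S) (f : M.val.obj U →+ N.val.obj U →+ T)
    (hf : ∀ (r : R.obj.obj U) p n, f (r • p) n = σ r • f p n)
    (hf' : ∀ (a : (endOp M).obj.obj U) p n, f (rightAct M U a p) n = f p (a • n)) (p n) :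
    tensorLift M N U σ f hf hf' (tmul M N U p n) = f p n := rfl

lemma tensor_ext {M : SheafOfModules.{u} R} {N : SheafOfModules.{u} (endOp M)} {U : (Opens X)ᵒᵖ}
    {T : Type u} [AddCommGroup T] {f g : TensorSections M N U →+ T}
    (h : ∀ p n, f (tmul M N U p n) = g (tmul M N U p n)) (t : TensorSections M N U) :
    f t = g t := by
  obtain ⟨t, rfl⟩ := Submodule.Quotient.mk_surjective _ t
  induction t with
  | zero => exact (map_zero f).trans (map_zero g).symm
  | tmul p n => exact h p n
  | add x y hx hy => exact (map_add f _ _).trans ((congrArg₂ (· + ·) hx hy).trans (map_add g _ _).symm)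

lemma tmul_add_left (M : SheafOfModules.{u} R) (N : SheafOfModules.{u} (endOp M))
    (U : (Opens X)ᵒᵖ) (p p' : M.val.obj U) (n : N.val.obj U) :
    tmul M N U (p + p') n = tmul M N U p n + tmul M N U p' n :=
  congrArg Submodule.Quotient.mk (TensorProduct.add_tmul p p' n)

lemma tmul_add_right (M : SheafOfModules.{u} R) (N : SheafOfModules.{u} (endOp M))
    (U : (Opens X)ᵒᵖ) (p : M.val.obj U) (n n' : N.val.obj U) :
    tmul M N U p (n + n') = tmul M N U p n + tmul M N U p n' :=
  congrArg Submodule.Quotient.mk (TensorProduct.tmul_add p n n')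

/-- The biadditive map `(p, n) ↦ p ⊗ n`. -/
def tmulHom (M : SheafOfModules.{u} R) (N : SheafOfModules.{u} (endOp M)) (U : (Opens X)ᵒᵖ) :
    M.val.obj U →+ N.val.obj U →+ TensorSections M N U :=
  AddMonoidHom.mk' (fun p => AddMonoidHom.mk' (tmul M N U p) (tmul_add_right M N U p))
    fun p p' => AddMonoidHom.ext fun n => tmul_add_left M N U p p' n

/-- The restriction maps `p ⊗ n ↦ p|_V ⊗ n|_V`. -/
def tensorRes (M : SheafOfModules.{u} R) (N : SheafOfModules.{u} (endOp M)) {U V : (Opens X)ᵒᵖ}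
    (h : U ⟶ V) : TensorSections M N U →ₛₗ[(R.obj.map h).hom] TensorSections M N V :=
  tensorLift M N U (R.obj.map h).hom
    (((tmulHom M N V).compl₂ (N.val.restrictₛₗ h).toAddMonoidHom).comp
      (M.val.restrictₛₗ h).toAddMonoidHom)
    (fun r p n => by
      change tmul M N V (M.val.restrictₛₗ h (r • p)) _ =
        _ • tmul M N V (M.val.restrictₛₗ h p) _
      rw [map_smulₛₗ]
      rfl)
    (fun a p n => by
      change tmul M N V (M.val.restrictₛₗ h (rightAct M U a p)) (N.val.restrictₛₗ h n) =
        tmul M N V (M.val.restrictₛₗ h p) (N.val.restrictₛₗ h (a • n))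
      rw [map_smulₛₗ, ← tmul_rel]
      refine congrArg (fun q => tmul M N V q _) ?_
      exact (((show (localEnd M U.unop)ᵐᵒᵖ from a).unop.2 ⟨U.unop, le_rfl⟩
        ⟨V.unop, h.unop.le⟩ h.unop.le p)).symm)

lemma tensorRes_tmul (M : SheafOfModules.{u} R) (N : SheafOfModules.{u} (endOp M))
    {U V : (Opens X)ᵒᵖ} (h : U ⟶ V) (p : M.val.obj U) (n : N.val.obj U) :
    tensorRes M N h (tmul M N U p n) =
      tmul M N V (M.val.restrictₛₗ h p) (N.val.restrictₛₗ h n) := rfl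

/-- The presheaf of `R`-modules `U ↦ M(U) ⊗_{A(U)} N(U)`. -/
def tensorPresheaf (M : SheafOfModules.{u} R) (N : SheafOfModules.{u} (endOp M)) :
    PresheafOfModules.{u} R.obj :=
  letI F : (Opens X)ᵒᵖ ⥤ AddCommGrpCat.{u} :=
    { obj U := AddCommGrpCat.of (TensorSections M N U)
      map h := AddCommGrpCat.ofHom (tensorRes M N h).toAddMonoidHom
      map_id U := by
        ext t
        refine tensor_ext (f := (tensorRes M N (𝟙 U)).toAddMonoidHom)
          (g := AddMonoidHom.id _) (fun p n => ?_) t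
        refine (tensorRes_tmul M N (𝟙 U) p n).trans ?_
        exact congrArg₂ (tmul M N U) (res_self M le_rfl p) (res_self N le_rfl n)
      map_comp {U V W} h h' := by
        ext t
        refine tensor_ext (f := (tensorRes M N (h ≫ h')).toAddMonoidHom)
          (g := (tensorRes M N h').toAddMonoidHom.comp (tensorRes M N h).toAddMonoidHom)
          (fun p n => ?_) t
        exact congrArg₂ (tmul M N W) (M.val.map_comp_apply h h' p) (N.val.map_comp_apply h h' n) }
  letI : ∀ U, Module (R.obj.obj U) (F.obj U) := fun U =>
    inferInstanceAs (Module (R.obj.obj U) (TensorSections M N U))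
  PresheafOfModules.ofPresheaf F fun _ _ h r t => (tensorRes M N h).map_smulₛₗ r t

/-- The map `p ⊗ n ↦ p ⊗ f(n)` on sections. -/
def tensorSectionsMap (M : SheafOfModules.{u} R) {N N' : SheafOfModules.{u} (endOp M)}
    (f : N ⟶ N') (U : (Opens X)ᵒᵖ) :
    TensorSections M N U →ₗ[R.obj.obj U] TensorSections M N' U :=
  tensorLift M N U (RingHom.id _) ((tmulHom M N' U).compl₂ (f.val.app U).hom.toAddMonoidHom)
    (fun _ _ _ => rfl)
    (fun a p n => (tmul_rel M N' U p a _).trans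
      (congrArg (tmul M N' U p) ((f.val.app U).hom.map_smul a n).symm))

/-- The morphism of presheaves of modules given by `p ⊗ n ↦ p ⊗ f(n)`. -/
def tensorPresheafMap (M : SheafOfModules.{u} R) {N N' : SheafOfModules.{u} (endOp M)}
    (f : N ⟶ N') : tensorPresheaf M N ⟶ tensorPresheaf M N' where
  app U := ModuleCat.ofHom (X := TensorSections M N U) (Y := TensorSections M N' U)
    (tensorSectionsMap M f U)
  naturality {U V} h := by
    refine ModuleCat.hom_ext (LinearMap.ext fun t => ?_)
    refine tensor_ext
      (f := (tensorSectionsMap M f V).toAddMonoidHom.comp (tensorRes M N h).toAddMonoidHom)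
      (g := (tensorRes M N' h).toAddMonoidHom.comp (tensorSectionsMap M f U).toAddMonoidHom)
      (fun p n => ?_) t
    exact congrArg (tmul M N' V (M.val.restrictₛₗ h p))
      (PresheafOfModules.naturality_apply f.val h n)

/-- The functor `N ↦ (U ↦ M(U) ⊗_{A(U)} N(U))`, where `A = (End_R M)ᵒᵖ`. -/
def tensorPresheafFunctor (M : SheafOfModules.{u} R) :
    SheafOfModules.{u} (endOp M) ⥤ PresheafOfModules.{u} R.obj where
  obj N := tensorPresheaf M N
  map f := tensorPresheafMap M f
  map_id N := PresheafOfModules.hom_ext fun U =>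
    ModuleCat.hom_ext (LinearMap.ext fun t => tensor_ext
      (f := (tensorSectionsMap M (𝟙 N) U).toAddMonoidHom) (g := AddMonoidHom.id _)
      (fun _ _ => rfl) t)
  map_comp f g := PresheafOfModules.hom_ext fun U =>
    ModuleCat.hom_ext (LinearMap.ext fun t => tensor_ext
      (f := (tensorSectionsMap M (f ≫ g) U).toAddMonoidHom)
      (g := (tensorSectionsMap M g U).toAddMonoidHom.comp (tensorSectionsMap M f U).toAddMonoidHom)
      (fun _ _ => rfl) t)

/-- The functor `M ⊗_A -` from modules over `A = (End_R M)ᵒᵖ` to `R`-modules: the sheafification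
of `U ↦ M(U) ⊗_{A(U)} N(U)`. -/
def tensorFunctor (M : SheafOfModules.{u} R) :
    SheafOfModules.{u} (endOp M) ⥤ SheafOfModules.{u} R :=
  tensorPresheafFunctor M ⋙ PresheafOfModules.sheafification (𝟙 R.obj)

/-- The stalk `R_x`. -/
abbrev ringStalk (R : Sheaf (Opens.grothendieckTopology X) RingCat.{u}) (x : X) : Type u :=
  ↥(TopCat.Presheaf.stalk (C := RingCat.{u}) (X := X) R.obj x)

/-- The stalk `M_x`, a module over `R_x`. -/
abbrev stalk (M : SheafOfModules.{u} R) (x : X) : Type u :=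
  ↥(TopCat.Presheaf.stalk (C := Ab.{u}) (X := X) M.val.presheaf x)

/-- There is an exact sequence `P₁ → P₀ → M → 0` where `P₀`, `P₁` are direct sums (possibly
infinite) of copies of `P`. -/
def IsPresentedByMultiples (S : Type u) [Ring S] (P M : Type u) [AddCommGroup P] [Module S P]
    [AddCommGroup M] [Module S M] : Prop :=
  ∃ (ι₁ ι₀ : Type u) (f : (ι₁ →₀ P) →ₗ[S] (ι₀ →₀ P)) (g : (ι₀ →₀ P) →ₗ[S] M),
    Function.Exact f g ∧ Function.Surjective g

end NCSheaf

section Orthogonal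

variable {𝒜 : Type*} [Category* 𝒜] [Abelian 𝒜]

/-- The left orthogonal subcategory of `C`: objects `A` with `Hom(A, K) = Ext¹(A, K) = 0` for all
`K` in `C`. -/
def leftOrthogonal (C : ObjectProperty 𝒜) : ObjectProperty 𝒜 := fun A =>
  ∀ K, C K → Subsingleton (A ⟶ K) ∧
    (letI := HasExt.standard 𝒜; Subsingleton (Abelian.Ext A K 1))

/-- The right orthogonal subcategory of `C`: objects `A` with `Hom(K, A) = Ext¹(K, A) = 0` for all
`K` in `C`. -/
def rightOrthogonal (C : ObjectProperty 𝒜) : ObjectProperty 𝒜 := fun A =>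
  ∀ K, C K → Subsingleton (K ⟶ A) ∧
    (letI := HasExt.standard 𝒜; Subsingleton (Abelian.Ext K A 1))

/-- A Serre subcategory `C` is bilocalizing if the quotient functor `𝒜 ⥤ 𝒜/C` has a left and a
right adjoint. The Serre quotient `𝒜/C` is the localization of `𝒜` with respect to the morphisms
whose kernel and cokernel are in `C`. -/
def IsBilocalizing (C : ObjectProperty 𝒜) [C.IsSerreClass] : Prop :=
  C.isoModSerre.Q.IsLeftAdjoint ∧ C.isoModSerre.Q.IsRightAdjoint

end Orthogonal

/-- A sheaf of (not necessarily commutative) `𝒪_X`-algebras on a scheme `X`. -/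
structure AlgebraSheaf (X : Scheme.{u}) where
  /-- the underlying sheaf of rings -/
  ring : Sheaf (Opens.grothendieckTopology X) RingCat.{u}
  /-- the structure morphism from `𝒪_X` -/
  str : X.ringCatSheaf ⟶ ring
  central : ∀ (U : X.Opens) (r : X.ringCatSheaf.obj.obj (op U)) (b : ring.obj.obj (op U)),
    str.hom.app (op U) r * b = b * str.hom.app (op U) r

namespace AlgebraSheaf

open NCSheaf

variable {X : Scheme.{u}} (B : AlgebraSheaf X)

/-- A sheaf of `B`-modules is quasi-coherent if it is so as a sheaf of `𝒪_X`-modules. -/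
def qcoh : ObjectProperty (SheafOfModules.{u} B.ring) :=
  (SheafOfModules.isQuasicoherent X.ringCatSheaf).inverseImage
    (SheafOfModules.restrictScalars B.str)

/-- The pair `(X, B)` is a non-commutative scheme: `B` is quasi-coherent as an `𝒪_X`-module. -/
def IsNCScheme : Prop := B.qcoh (SheafOfModules.unit B.ring)

/-- The category of quasi-coherent sheaves of `B`-modules. -/
abbrev Mod : Type (u + 1) := B.qcoh.FullSubcategory

/-- `(X, B)` is noetherian: `X` is noetherian and `B` is coherent as an `𝒪_X`-module. -/
def IsNoetherian : Prop :=
  AlgebraicGeometry.IsNoetherian X ∧ B.IsNCScheme ∧ ∀ U : X.Opens, IsAffineOpen U →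
    Module.Finite (X.ringCatSheaf.obj.obj (op U))
      (((SheafOfModules.restrictScalars B.str).obj (SheafOfModules.unit B.ring)).val.obj (op U))

/-- A (quasi-coherent) `B`-module is locally projective and locally finitely generated: every point
has an affine open neighbourhood `U` such that `P(U)` is a finitely generated projective
`B(U)`-module. -/
def IsLocallyFGProjective (P : SheafOfModules.{u} B.ring) : Prop :=
  ∀ x : X, ∃ U : X.Opens, x ∈ U ∧ IsAffineOpen U ∧
    Module.Finite (B.ring.obj.obj (op U)) (P.val.obj (op U)) ∧
    Module.Projective (B.ring.obj.obj (op U)) (P.val.obj (op U))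

/-- Multiplication by a section of `𝒪_X` on a sheaf of `B`-modules. -/
def scalarEnd (P : SheafOfModules.{u} B.ring) (U : X.Opens) :
    X.ringCatSheaf.obj.obj (op U) →+* (localEnd P U)ᵐᵒᵖ where
  toFun r := MulOpposite.op ⟨fun V =>
    { toFun p := B.str.hom.app (op V.1) (X.ringCatSheaf.obj.map (homOfLE V.2).op r) • p
      map_add' := smul_add _
      map_smul' b p := by rw [RingHom.id_apply, ← mul_smul, ← mul_smul, B.central] }, by
    intro V W h p
    change B.str.hom.app (op W.1) (X.ringCatSheaf.obj.map (homOfLE W.2).op r) • res P h p =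
      res P h (B.str.hom.app (op V.1) (X.ringCatSheaf.obj.map (homOfLE V.2).op r) • p)
    rw [res_smul, ← NatTrans.naturality_apply, ring_res_res]⟩
  map_one' := by
    refine congrArg MulOpposite.op (Subtype.ext (funext fun V => LinearMap.ext fun p => ?_))
    change B.str.hom.app (op V.1) (X.ringCatSheaf.obj.map (homOfLE V.2).op 1) • p = p
    rw [map_one, map_one, one_smul]
  map_mul' r r' := by
    refine congrArg MulOpposite.op (Subtype.ext (funext fun V => LinearMap.ext fun p => ?_))
    change B.str.hom.app (op V.1) (X.ringCatSheaf.obj.map (homOfLE V.2).op (r * r')) • p =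
      B.str.hom.app (op V.1) (X.ringCatSheaf.obj.map (homOfLE V.2).op r') •
        B.str.hom.app (op V.1) (X.ringCatSheaf.obj.map (homOfLE V.2).op r) • p
    rw [map_mul, map_mul, B.central, mul_smul]
  map_zero' := by
    refine congrArg MulOpposite.op (Subtype.ext (funext fun V => LinearMap.ext fun p => ?_))
    change B.str.hom.app (op V.1) (X.ringCatSheaf.obj.map (homOfLE V.2).op 0) • p = 0
    rw [map_zero, map_zero, zero_smul]
  map_add' r r' := by
    refine congrArg MulOpposite.op (Subtype.ext (funext fun V => LinearMap.ext fun p => ?_))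
    change B.str.hom.app (op V.1) (X.ringCatSheaf.obj.map (homOfLE V.2).op (r + r')) • p =
      B.str.hom.app (op V.1) (X.ringCatSheaf.obj.map (homOfLE V.2).op r) • p +
        B.str.hom.app (op V.1) (X.ringCatSheaf.obj.map (homOfLE V.2).op r') • p
    rw [map_add, map_add, add_smul]

/-- The `𝒪_X`-algebra `(End_B P)ᵒᵖ`. -/
def minor (P : SheafOfModules.{u} B.ring) : AlgebraSheaf X where
  ring := endOp P
  str :=
    { hom :=
      { app U := RingCat.ofHom (B.scalarEnd P U.unop)
        naturality U V f := by
          refine RingCat.hom_ext (RingHom.ext fun r => ?_)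
          refine congrArg MulOpposite.op (Subtype.ext (funext fun W => LinearMap.ext fun p => ?_))
          change B.str.hom.app (op W.1) (X.ringCatSheaf.obj.map (homOfLE W.2).op
            (X.ringCatSheaf.obj.map (homOfLE f.unop.le).op r)) • p =
            B.str.hom.app (op W.1) (X.ringCatSheaf.obj.map (homOfLE (W.2.trans f.unop.le)).op r) • p
          rw [ring_res_res] } }
  central U r a := by
    refine congrArg MulOpposite.op (Subtype.ext (funext fun W => LinearMap.ext fun p => ?_))
    exact (((show (localEnd P U)ᵐᵒᵖ from a).unop.1 W).map_smul
      (B.str.hom.app (op W.1) (X.ringCatSheaf.obj.map (homOfLE W.2).op r)) p)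

/-- The functor `P ⊗_A -` on sheaves of modules, where `A = (End_B P)ᵒᵖ`. -/
def tensorSheaf (P : SheafOfModules.{u} B.ring) :
    SheafOfModules.{u} (B.minor P).ring ⥤ SheafOfModules.{u} B.ring :=
  tensorFunctor P

/-- The functor `Hom_B(P, -)` on sheaves of modules, with values in modules over
`A = (End_B P)ᵒᵖ`. -/
def homSheaf (P : SheafOfModules.{u} B.ring) :
    SheafOfModules.{u} B.ring ⥤ SheafOfModules.{u} (B.minor P).ring :=
  homFunctor P

/-- The functor `Hom_A(P^∨, -)` on sheaves of modules, where `A = (End_B P)ᵒᵖ` and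
`P^∨ = Hom_B(P, B)`. -/
def homDualSheaf (P : SheafOfModules.{u} B.ring) :
    SheafOfModules.{u} (B.minor P).ring ⥤ SheafOfModules.{u} B.ring :=
  homDualFunctor P

/-- A functor `H` from quasi-coherent `A`-modules to quasi-coherent `B`-modules together with
`ε : H(N) → Hom_A(P^∨, N)`, such that `H(N)` is the quasi-coherent coreflection of
`Hom_A(P^∨, N)`: every morphism from a quasi-coherent `B`-module to `Hom_A(P^∨, N)` factors
uniquely through `ε`. If `Hom_A(P^∨, N)` is quasi-coherent, this means `H(N) = Hom_A(P^∨, N)`. -/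
def IsQuasicoherentHomDual (P : SheafOfModules.{u} B.ring) (H : (B.minor P).Mod ⥤ B.Mod)
    (ε : H ⋙ B.qcoh.ι ⟶ (B.minor P).qcoh.ι ⋙ B.homDualSheaf P) : Prop :=
  ∀ (M : B.Mod) (N : (B.minor P).Mod),
    Function.Bijective fun f : M ⟶ H.obj N => B.qcoh.ι.map f ≫ ε.app N

/-- The functor `P ⊗_A -` from quasi-coherent `A`-modules to quasi-coherent `B`-modules. -/
def tensorMod (P : SheafOfModules.{u} B.ring)
    (hF : ∀ N : (B.minor P).Mod, B.qcoh ((B.tensorSheaf P).obj N.obj)) :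
    (B.minor P).Mod ⥤ B.Mod :=
  B.qcoh.lift ((B.minor P).qcoh.ι ⋙ B.tensorSheaf P) hF

/-- The functor `Hom_B(P, -)` from quasi-coherent `B`-modules to quasi-coherent `A`-modules. -/
def homMod (P : SheafOfModules.{u} B.ring)
    (hG : ∀ M : B.Mod, (B.minor P).qcoh ((B.homSheaf P).obj M.obj)) :
    B.Mod ⥤ (B.minor P).Mod :=
  (B.minor P).qcoh.lift (B.qcoh.ι ⋙ B.homSheaf P) hG

end AlgebraSheaf

/-- A full subcategory that contains a zero object and is closed under finite products, kernels and
cokernels; it is then an abelian category, in which exactness is exactness in the ambient one. -/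
class IsAbelianSubcategory {𝒜 : Type*} [Category* 𝒜] [Abelian 𝒜] (P : ObjectProperty 𝒜) : Prop
    extends P.ContainsZero, P.IsClosedUnderFiniteProducts, P.IsClosedUnderKernels,
      P.IsClosedUnderCokernels

end

/-! Write `A` for `(End_B P)ᵒᵖ`. The theorem is Morita theory for a projective module that need not
generate, made local on `X`, followed by a formal argument about adjoint triples.

Near every point `P` has a dual basis: sections `p i` and forms `φ i` with `x = ∑ φ i(x) • p i` on
all smaller opens. Two facts follow. The unit `N ⟶ Hom_B(P, P ⊗_A N)` is an isomorphism, with local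
inverse `ψ ↦ ∑ φ i · ψ(p i)`, where `P^∨` is contracted with `P ⊗ N` (`isIso_unit`). Moreover
`Hom_B(P, M)` is locally spanned by the maps `γ(-) • m`, so a pairing of `M` with `P^∨` extends to
`Hom_B(P, M)` by a trace formula, which gives `Hom_A(Hom_B(P, M), N) ≃ Hom_B(M, Hom_A(P^∨, N))`
(`toHomDual_bijective`). Hence `F ⊣ G ⊣ H`. Since `F` is fully faithful, so is `H`; since `G` has
adjoints on both sides, it is exact.

Quasi-coherence is handled through `LocAt`: over an affine open, sections on `D(f)` are fractions of
global ones. This passes to kernels, cokernels, tensor products and associated sheaves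
(`LocSurj.locAt`). Homomorphisms over an affine open from a quasi-coherent sheaf to an arbitrary
sheaf are just linear maps of sections (`topHom_injective`, `topHom_surjective`). Separatedness and
quasi-compactness enter through coinduction, the right adjoint of `M ↦ M(U)` for affine `U`. With a
finite affine cover it yields the quasi-coherent coreflection that defines `H`
(`exists_coreflection`) and enough injectives (`enoughInjectives`).

The rest about `C = Ker G` is formal. The counit `FGM ⟶ M` becomes invertible under `G`, so its
kernel and cokernel lie in `C`; vanishing of `Hom` and `Ext¹` from `M` to `C` kills both, and dually
for `H` (`essImage_eq_leftOrthogonal`, `essImage_eq_rightOrthogonal`). The copresentation criterion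
holds because `H` is left exact and fully faithful. The stalk criterion asks when the evaluation `P
⊗_A Hom_B(P, M) ⟶ M` is invertible: `P_x` is projective, homomorphisms from `P_x` are germs of local
ones, and the stalk of the source is generated by images of `P_x` (`isIso_evalHom`,
`isPresentedByMultiples_stalk`). -/

noncomputable section

/-! ### Quasi-coherence as a localization property of sections over affine opens -/

namespace AlgebraSheaf
open NCSheaf
variable {X : Scheme.{u}} (B : AlgebraSheaf X)

/-- The image in `B(U)` of a section of the structure sheaf. -/
def sc (U : X.Opens) : Γ(X, U) →+* B.ring.obj.obj (op U) := (B.str.hom.app (op U)).hom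

/-- Restriction maps of presheaves of modules. -/
def pres {B : AlgebraSheaf X} (T : PresheafOfModules.{u} B.ring.obj) {W V : X.Opens} (h : W ≤ V) :
    T.obj (op V) →ₛₗ[(B.ring.obj.map (homOfLE h).op).hom] T.obj (op W) :=
  T.restrictₛₗ (homOfLE h).op

/-- The presheaf `T` satisfies the localization property on the open `U`: sections on `D(f)` are
fractions of sections on `U`. -/
def LocAt (T : PresheafOfModules.{u} B.ring.obj) (U : X.Opens) : Prop :=
  ∀ f : Γ(X, U), (∀ m : T.obj (op U), pres T (X.basicOpen_le f) m = 0 →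
      ∃ k : ℕ, B.sc U (f ^ k) • m = 0) ∧
    (∀ m' : T.obj (op (X.basicOpen f)), ∃ (k : ℕ) (m : T.obj (op U)),
      pres T (X.basicOpen_le f) m =
        B.sc (X.basicOpen f) (X.presheaf.map (homOfLE (X.basicOpen_le f)).op (f ^ k)) • m')

/-- underlying module -/
abbrev under (M : SheafOfModules.{u} B.ring) : X.Modules :=
  (SheafOfModules.restrictScalars B.str).obj M

lemma sc_res {V W : X.Opens} (h : W ≤ V) (f : Γ(X, V)) :
    B.ring.obj.map (homOfLE h).op (B.sc V f) = B.sc W (X.presheaf.map (homOfLE h).op f) :=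
  (NatTrans.naturality_apply B.str.hom (homOfLE h).op f).symm

end AlgebraSheaf

namespace AlgebraicGeometry.Scheme.Modules

variable {X : Scheme.{u}} (M : X.Modules)

/-- Sections of `M` over `W` are fractions of sections over `V` with denominators powers of `f`. -/
def IsFractions {U V W : X.Opens} (f : Γ(X, U)) (hV : V ≤ U) (hW : W ≤ V) : Prop :=
  (∀ m : Γ(M, V), M.presheaf.map (homOfLE hW).op m = 0 →
      ∃ k : ℕ, X.presheaf.map (homOfLE hV).op (f ^ k) • m = 0) ∧
    (∀ m' : Γ(M, W), ∃ (k : ℕ) (m : Γ(M, V)), M.presheaf.map (homOfLE hW).op m =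
        X.presheaf.map (homOfLE (hW.trans hV)).op (f ^ k) • m')

/-- The images of `⊤` and of `D(f)` under `fromSpec` are only propositionally equal to `U` and
`X.basicOpen f`; this moves the condition across such equalities. -/
lemma isFractions_congr {U V W V' W' : X.Opens} (f : Γ(X, U)) (hV : V ≤ U) (hW : W ≤ V)
    (hV' : V' ≤ U) (hW' : W' ≤ V') (h : V = V') (h' : W = W') :
    M.IsFractions f hV hW ↔ M.IsFractions f hV' hW' := by
  subst h h'; rfl

/-- A global function on `Spec` acts through its restriction, and `fromSpec` is compatible with
restrictions; so the `Γ(X, U)`-action used by `IsLocalizing` is the one coming from the structure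
sheaf of `X`. -/
lemma fromSpec_smul {U : X.Opens} (hU : IsAffineOpen U) (V : (Spec Γ(X, U)).Opens)
    (hV : hU.fromSpec ''ᵁ V ≤ U) (r : Γ(X, U)) (x : Γ(M.restrict hU.fromSpec, V)) :
    (M.restrictAppIso hU.fromSpec V).hom (r • x) =
      X.presheaf.map (homOfLE hV).op r • (M.restrictAppIso hU.fromSpec V).hom x := by
  rw [smul_Spec_def]
  change (hU.fromSpec.appIso V).inv _ • (M.restrictAppIso hU.fromSpec V).hom x = _
  congr 1
  apply (ConcreteCategory.bijective_of_isIso (hU.fromSpec.appIso V).hom).1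
  have h1 : X.presheaf.map (homOfLE hV).op ≫ (hU.fromSpec.appIso V).hom =
      (Scheme.ΓSpecIso Γ(X, U)).inv ≫ (Spec Γ(X, U)).presheaf.map V.leTop.op := by
    rw [Scheme.Hom.appIso_hom', Scheme.Hom.map_appLE]
    rw [Scheme.Hom.appLE, IsAffineOpen.fromSpec_app_self, Category.assoc, ← Functor.map_comp]
    rfl
  have h2 := congrArg (fun φ => φ.hom r) h1
  refine Eq.trans ?_ h2.symm
  exact congrArg (fun φ => φ.hom ((Spec Γ(X, U)).presheaf.map V.leTop.op
    ((Scheme.ΓSpecIso Γ(X, U)).inv r))) (Iso.inv_hom_id (hU.fromSpec.appIso V))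

lemma isLocalizing_restrict_iff {U : X.Opens} (hU : IsAffineOpen U) :
    IsLocalizing (modulesSpecToSheaf.obj (M.restrict hU.fromSpec)) ↔
      ∀ f : Γ(X, U), M.IsFractions f le_rfl (X.basicOpen_le f) := by
  refine forall_congr' fun f => ?_
  have h0 : hU.fromSpec ''ᵁ ⊤ = U := by simp
  have h1 : hU.fromSpec ''ᵁ (PrimeSpectrum.basicOpen f) = X.basicOpen f :=
    hU.fromSpec_image_basicOpen f
  rw [← M.isFractions_congr f h0.le (Scheme.Hom.image_mono _ le_top) le_rfl (X.basicOpen_le f) h0 h1]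
  constructor
  · intro h
    refine ⟨fun m hm => ?_, fun m' => ?_⟩
    · obtain ⟨⟨_, k, rfl⟩, hc⟩ := h.exists_of_eq (x₁ := (M.restrictAppIso hU.fromSpec ⊤).inv m)
        (x₂ := 0) ((show _ = _ from hm).trans (map_zero _).symm)
      refine ⟨k, ?_⟩
      rw [smul_zero] at hc
      have := M.fromSpec_smul hU ⊤ h0.le (f ^ k) ((M.restrictAppIso hU.fromSpec ⊤).inv m)
      exact this.symm.trans hc
    · obtain ⟨⟨m, ⟨_, k, rfl⟩⟩, hm⟩ := h.surj m'
      refine ⟨k, m, ?_⟩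
      refine hm.symm.trans ?_
      exact M.fromSpec_smul hU _ (h1.le.trans (X.basicOpen_le f)) (f ^ k) m'
  · intro h
    refine ⟨?_, fun m' => ?_, fun {x₁ x₂} hx => ?_⟩
    -- Powers of `f` act invertibly on sections over `D(f)` in any case, so `IsFractions` only has
    -- to record the other two axioms of a localized module.
    · rintro ⟨_, k, rfl⟩
      rw [map_pow]
      exact (isUnit_algebraMap_end_of_le_basicOpen f le_rfl).pow k
    · obtain ⟨k, m, hm⟩ := h.2 m'
      refine ⟨⟨m, ⟨_, k, rfl⟩⟩, ?_⟩
      exact (M.fromSpec_smul hU _ (h1.le.trans (X.basicOpen_le f)) (f ^ k) m').trans hm.symm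
    · obtain ⟨k, hk⟩ := h.1 (x₁ - x₂) ((map_sub _ _ _).trans (sub_eq_zero.2 hx))
      refine ⟨⟨_, k, rfl⟩, ?_⟩
      rw [← sub_eq_zero]
      refine (smul_sub _ _ _).symm.trans ?_
      exact (M.fromSpec_smul hU ⊤ h0.le (f ^ k) (x₁ - x₂)).trans hk

lemma isFractions_of_isQuasicoherent [h : M.IsQuasicoherent] {U : X.Opens} (hU : IsAffineOpen U)
    (f : Γ(X, U)) : M.IsFractions f le_rfl (X.basicOpen_le f) :=
  (M.isLocalizing_restrict_iff hU).1 ((isIso_fromTildeΓ_iff_isLocalizing _).1 inferInstance) f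

/-- Transport of presentations along isomorphisms. -/
def presentationOfIso {M N : X.Modules} (e : M ≅ N) (p : SheafOfModules.Presentation M) :
    SheafOfModules.Presentation N :=
  let e' : @Iso (SheafOfModules X.ringCatSheaf) _ M N := ⟨e.hom, e.inv, e.hom_inv_id, e.inv_hom_id⟩
  @SheafOfModules.Presentation.ofIsIso _ _ _ _ _ _ _ _ e'.hom e'.isIso_hom p

/-- Sections of `M` over affine opens being fractions gives a presentation. -/
def overPresentation {U : X.Opens} (hU : IsAffineOpen U)
    (h : ∀ f : Γ(X, U), M.IsFractions f le_rfl (X.basicOpen_le f)) :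
    SheafOfModules.Presentation (SheafOfModules.over (R := X.ringCatSheaf) M U) :=
  let N := M.restrict hU.fromSpec
  have hN : IsIso N.fromTildeΓ :=
    (isIso_fromTildeΓ_iff_isLocalizing _).2 ((M.isLocalizing_restrict_iff hU).2 h)
  -- On `Spec` the module is the tilde of its global sections, presented by all elements as
  -- generators and all linear relations among them.
  have pN : SheafOfModules.Presentation N := presentationOfIso (asIso N.fromTildeΓ)
    (presentationTilde.{u} _ .univ (by simp) _ (Submodule.span_eq _))
  -- The presentation is carried from `Spec` to the open subscheme `U`, and then to the slice site
  -- over `U`, where the definition of quasi-coherence asks for it.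
  have p1 : SheafOfModules.Presentation (M.restrict U.ι) := presentationOfIso
    (((restrictFunctorComp _ _).symm ≪≫
      restrictFunctorCongr (by simp)).app M : (N.restrict hU.isoSpec.hom) ≅ M.restrict U.ι)
    (presentationRestrict hU.isoSpec.hom pN)
  have p2 : SheafOfModules.Presentation ((overEquiv U).functor.obj
      ((SheafOfModules.overFunctor X.ringCatSheaf U).obj M)) :=
    presentationOfIso ((overFunctorEquiv U).symm.app M) p1
  let F := (U.sheafOfModulesEquivOver X.ringCatSheaf).inverse
  let e := (U.sheafOfModulesEquivOver X.ringCatSheaf).unitIso.symm.app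
    ((SheafOfModules.overFunctor X.ringCatSheaf U).obj M)
  have p3 : SheafOfModules.Presentation (F.obj ((U.sheafOfModulesEquivOver X.ringCatSheaf).functor.obj
      ((SheafOfModules.overFunctor X.ringCatSheaf U).obj M))) :=
    haveI : PreservesColimitsOfSize.{u, u} F :=
      (U.sheafOfModulesEquivOver X.ringCatSheaf).symm.toAdjunction.leftAdjoint_preservesColimits
    SheafOfModules.Presentation.map.{u} (R := U.sheafRestrict.obj X.ringCatSheaf) p2 F
      (U.sheafOfModulesEquivOverInverseUnit X.ringCatSheaf).symm
  SheafOfModules.Presentation.ofIsIso.{u, u, u} e.hom p3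

lemma isQuasicoherent_of_isFractions (h : ∀ x : X, ∃ U : X.Opens, x ∈ U ∧ IsAffineOpen U ∧
    ∀ f : Γ(X, U), M.IsFractions f le_rfl (X.basicOpen_le f)) : M.IsQuasicoherent := by
  choose U hx hU hf using h
  have hc : (Opens.grothendieckTopology X).CoversTop U := ?_
  · exact SheafOfModules.QuasicoherentData.isQuasicoherent (R := X.ringCatSheaf) (M := M)
      { I := X, X := U, coversTop := hc, presentation := fun x => M.overPresentation (hU x) (hf x) }
  rw [Opens.coversTop_iff, IsOpenCover, eq_top_iff]
  exact fun x _ => Opens.mem_iSup.2 ⟨x, hx x⟩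

end AlgebraicGeometry.Scheme.Modules

namespace AlgebraSheaf
open NCSheaf
variable {X : Scheme.{u}} {B : AlgebraSheaf X}

lemma isFractions_under_iff (M : SheafOfModules.{u} B.ring) (U : X.Opens) :
    (∀ f : Γ(X, U), (B.under M).IsFractions f le_rfl (X.basicOpen_le f)) ↔ B.LocAt M.val U := by
  refine forall_congr' fun f => and_congr (forall_congr' fun m => imp_congr Iff.rfl
    (exists_congr fun k => ?_)) Iff.rfl
  have : X.presheaf.map (homOfLE (le_refl U)).op (f ^ k) = f ^ k :=
    congrArg (fun φ => φ.hom (f ^ k)) (X.presheaf.map_id (op U))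
  rw [this]
  rfl

lemma qcoh.locAt {M : SheafOfModules.{u} B.ring} (hM : B.qcoh M) {U : X.Opens}
    (hU : IsAffineOpen U) : B.LocAt M.val U :=
  (isFractions_under_iff M U).1 fun f =>
    Scheme.Modules.isFractions_of_isQuasicoherent (h := hM) _ hU f

lemma qcoh_of_locAt {M : SheafOfModules.{u} B.ring}
    (h : ∀ x : X, ∃ U : X.Opens, x ∈ U ∧ IsAffineOpen U ∧ B.LocAt M.val U) : B.qcoh M := by
  refine Scheme.Modules.isQuasicoherent_of_isFractions (B.under M) fun x => ?_
  obtain ⟨U, hx, hU, hl⟩ := h x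
  exact ⟨U, hx, hU, (isFractions_under_iff M U).2 hl⟩

end AlgebraSheaf

/-! ### Gluing fractions over affine opens; passage to the associated sheaf -/

namespace AlgebraSheaf
open NCSheaf
variable {X : Scheme.{u}} {B : AlgebraSheaf X}

/-- Restriction of sections of the structure sheaf. -/
def rs {X : Scheme.{u}} {W V : X.Opens} (h : W ≤ V) : Γ(X, V) →+* Γ(X, W) :=
  (X.presheaf.map (homOfLE h).op).hom

lemma rs_rs {U V W : X.Opens} (h : V ≤ U) (h' : W ≤ V) (r : Γ(X, U)) :
    rs h' (rs h r) = rs (h'.trans h) r := by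
  change (X.presheaf.map (homOfLE h).op ≫ X.presheaf.map (homOfLE h').op).hom r = _
  rw [← X.presheaf.map_comp]
  rfl

lemma basicOpen_rs {V W : X.Opens} (h : W ≤ V) (f : Γ(X, V)) :
    X.basicOpen (rs h f) = W ⊓ X.basicOpen f :=
  X.basicOpen_res f (homOfLE h).op

lemma basicOpen_rs_le {V W : X.Opens} (h : W ≤ V) (f : Γ(X, V)) :
    X.basicOpen (rs h f) ≤ X.basicOpen f :=
  (basicOpen_rs h f).le.trans inf_le_right

lemma isUnit_rs {V W : X.Opens} {f : Γ(X, V)} (h : W ≤ X.basicOpen f) :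
    IsUnit (rs (h.trans (X.basicOpen_le f)) f) := by
  rw [← rs_rs (X.basicOpen_le f) h]
  exact (RingedSpace.isUnit_res_basicOpen _ f).map (rs h)

section

variable (T : PresheafOfModules.{u} B.ring.obj)

lemma pres_pres {U V W : X.Opens} (h : V ≤ U) (h' : W ≤ V) (m : T.obj (op U)) :
    pres T h' (pres T h m) = pres T (h'.trans h) m :=
  (T.map_comp_apply (homOfLE h).op (homOfLE h').op m).symm

lemma pres_smul {W V : X.Opens} (h : W ≤ V) (b : B.ring.obj.obj (op V)) (m : T.obj (op V)) :
    pres T h (b • m) = B.ring.obj.map (homOfLE h).op b • pres T h m :=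
  T.map_smul _ b m

lemma pres_sc {W V : X.Opens} (h : W ≤ V) (f : Γ(X, V)) (m : T.obj (op V)) :
    pres T h (B.sc V f • m) = B.sc W (rs h f) • pres T h m := by
  rw [pres_smul, sc_res]; rfl

lemma sc_smul_comm {V : X.Opens} (f : Γ(X, V)) (b : B.ring.obj.obj (op V)) (m : T.obj (op V)) :
    B.sc V f • b • m = b • B.sc V f • m := by
  rw [← mul_smul, ← mul_smul]
  exact congrArg (· • m) (B.central V f b)

lemma sc_mul_smul {V : X.Opens} (f g : Γ(X, V)) (m : T.obj (op V)) :
    B.sc V (f * g) • m = B.sc V f • B.sc V g • m := by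
  rw [map_mul, mul_smul]

lemma sc_smul_injective {V : X.Opens} {f : Γ(X, V)} (hf : IsUnit f) {m m' : T.obj (op V)}
    (h : B.sc V f • m = B.sc V f • m') : m = m' := by
  obtain ⟨g, hg⟩ := hf.exists_left_inv
  rw [← one_smul (B.ring.obj.obj (op V)) m, ← one_smul (B.ring.obj.obj (op V)) m',
    ← map_one (B.sc V), ← hg, sc_mul_smul, h, sc_mul_smul]

lemma exists_sc_smul_eq {V : X.Opens} {f : Γ(X, V)} (hf : IsUnit f) (m : T.obj (op V)) :
    ∃ m' : T.obj (op V), B.sc V f • m' = m := by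
  obtain ⟨g, hg⟩ := hf.exists_right_inv
  exact ⟨B.sc V g • m, by rw [← sc_mul_smul, hg, map_one, one_smul]⟩

variable {T} in
/-- A section lies in a submodule if it does so after multiplication by functions whose
non-vanishing loci cover the affine open `U`. -/
lemma mem_of_local {U : X.Opens} (hU : IsAffineOpen U)
    (S : Submodule (B.ring.obj.obj (op U)) (T.obj (op U))) (q : T.obj (op U))
    (h : ∀ x ∈ U, ∃ r : Γ(X, U), x ∈ X.basicOpen r ∧ ∃ k : ℕ, B.sc U (r ^ k) • q ∈ S) : q ∈ S := by
  -- The functions that multiply `q` into `S` form an ideal. It contains `1` as soon as the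
  -- non-vanishing loci of its elements cover `U`.
  let I : Ideal Γ(X, U) :=
    { carrier := {r | B.sc U r • q ∈ S}
      add_mem' := fun {a b} ha hb => by
        change B.sc U (a + b) • q ∈ S
        rw [map_add, add_smul]
        exact S.add_mem ha hb
      zero_mem' := by
        change B.sc U 0 • q ∈ S
        rw [map_zero, zero_smul]
        exact S.zero_mem
      smul_mem' := fun c a ha => by
        change B.sc U (c * a) • q ∈ S
        rw [sc_mul_smul]
        exact S.smul_mem _ ha }
  have hI : Ideal.span (I : Set Γ(X, U)) = ⊤ := by
    rw [← IsAffineOpen.iSup_basicOpen_eq_self_iff hU]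
    refine le_antisymm (iSup_le fun f => X.basicOpen_le _) fun x hx => ?_
    obtain ⟨r, hr, k, hk⟩ := h x hx
    -- The exponent is `k + 1` because `D(r ^ n) = D(r)` needs `n > 0`.
    refine Opens.mem_iSup.2 ⟨⟨r ^ (k + 1), ?_⟩, ?_⟩
    · change B.sc U (r ^ (k + 1)) • q ∈ S
      rw [pow_succ', sc_mul_smul]
      exact S.smul_mem _ hk
    · rwa [X.basicOpen_pow _ k.succ_pos]
  rw [Ideal.span_eq] at hI
  have h1 : B.sc U 1 • q ∈ S := (hI ▸ Submodule.mem_top : (1 : Γ(X, U)) ∈ I)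
  rwa [map_one, one_smul] at h1

end

/-- A monotone local condition that depends on an exponent holds locally on an affine open with a
uniform exponent. -/
lemma exists_uniform {U : X.Opens} (hU : IsAffineOpen U) (p : ℕ → X.Opens → Prop)
    (h : ∀ x ∈ U, ∃ W : X.Opens, x ∈ W ∧ ∃ k, ∀ k' ≥ k, p k' W) :
    ∃ K, ∀ x ∈ U, ∃ W : X.Opens, x ∈ W ∧ p K W := by
  choose! W hW k hk using h
  obtain ⟨t, ht, hc⟩ := hU.isCompact.elim_nhds_subcover (fun x => (W x : Set X))
    fun x hx => (W x).2.mem_nhds (hW x hx)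
  refine ⟨t.sup k, fun x hx => ?_⟩
  obtain ⟨y, hy, hxy⟩ := Set.mem_iUnion₂.1 (hc hx)
  exact ⟨W y, hxy, hk y (ht y hy) _ (Finset.le_sup hy)⟩

lemma eq_of_forall_mem {M : SheafOfModules.{u} B.ring} {V : X.Opens} {s t : M.val.obj (op V)}
    (h : ∀ x ∈ V, ∃ (W : X.Opens) (hW : W ≤ V), x ∈ W ∧ res M hW s = res M hW t) : s = t := by
  choose W hW hx he using h
  exact eq_of_res (ι := V) (U := fun x => W x.1 x.2) (fun x => hW _ _)
    (fun x hxV => Opens.mem_iSup.2 ⟨⟨x, hxV⟩, hx x hxV⟩) fun x => he _ _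

/-- Sections on a basic open set can be refined. -/
lemma exists_basicOpen_le {U W : X.Opens} (hU : IsAffineOpen U) {x : X} (hxU : x ∈ U)
    (hxW : x ∈ W) : ∃ f : Γ(X, U), X.basicOpen f ≤ W ∧ x ∈ X.basicOpen f :=
  hU.exists_basicOpen_le ⟨x, hxW⟩ hxU

section Sheafify

variable {T Q : PresheafOfModules.{u} B.ring.obj} (θ : T ⟶ Q)

/-- Elementwise local injectivity. -/
def LocInj : Prop := ∀ (V : X.Opens) (t : T.obj (op V)), θ.app (op V) t = 0 →
  ∀ x ∈ V, ∃ (W : X.Opens) (h : W ≤ V), x ∈ W ∧ pres T h t = 0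

/-- Elementwise local surjectivity. -/
def LocSurj : Prop := ∀ (V : X.Opens) (q : Q.obj (op V)),
  ∀ x ∈ V, ∃ (W : X.Opens) (h : W ≤ V) (t : T.obj (op W)), x ∈ W ∧ θ.app (op W) t = pres Q h q

lemma app_pres {V W : X.Opens} (h : W ≤ V) (t : T.obj (op V)) :
    θ.app (op W) (pres T h t) = pres Q h (θ.app (op V) t) :=
  PresheafOfModules.naturality_apply θ _ t

lemma app_smul {V : X.Opens} (b : B.ring.obj.obj (op V)) (t : T.obj (op V)) :
    θ.app (op V) (b • t) = b • θ.app (op V) t := (θ.app (op V)).hom.map_smul b t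

variable {θ}

/-- Near each point `t` vanishes on some `D(r)`, so a power of `r` kills `t`; then `mem_of_local`
applies to the zero submodule. -/
lemma LocInj.eq_zero (hθ : LocInj θ) {V : X.Opens} (hV : IsAffineOpen V) (hT : B.LocAt T V)
    {t : T.obj (op V)} (ht : θ.app (op V) t = 0) : t = 0 := by
  refine (Submodule.mem_bot (B.ring.obj.obj (op V))).1 (mem_of_local hV ⊥ t fun x hx => ?_)
  obtain ⟨W, hW, hxW, h0⟩ := hθ V t ht x hx
  obtain ⟨r, hr, hxr⟩ := exists_basicOpen_le hV hx hxW
  refine ⟨r, hxr, ?_⟩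
  simp only [Submodule.mem_bot]
  refine (hT r).1 t ?_
  rw [← pres_pres T hW hr, h0, map_zero]

lemma LocSurj.exists_basicOpen (hθ : LocSurj θ) {V : X.Opens} (hV : IsAffineOpen V)
    (q : Q.obj (op V)) {x : X} (hx : x ∈ V) : ∃ (r : Γ(X, V)) (t : T.obj (op (X.basicOpen r))),
      x ∈ X.basicOpen r ∧ θ.app _ t = pres Q (X.basicOpen_le r) q := by
  obtain ⟨W, hW, t, hxW, h⟩ := hθ V q x hx
  obtain ⟨r, hr, hxr⟩ := exists_basicOpen_le hV hx hxW
  refine ⟨r, pres T hr t, hxr, ?_⟩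
  rw [app_pres, h, pres_pres]

variable {M : SheafOfModules.{u} B.ring} {η : T ⟶ M.val} {U : X.Opens}

/-- Over small `D(r)` the section `q` lifts to `t`. On `D(r) ∩ D(g)` the lift vanishes by
injectivity over affine opens, so a power of `g` kills it on `D(r)`. Compactness of `U` makes the
exponent uniform. -/
lemma LocSurj.torsion (hs : LocSurj η) (hi : LocInj η)
    (hT : ∀ V ≤ U, IsAffineOpen V → B.LocAt T V) (hU : IsAffineOpen U) (g : Γ(X, U))
    (q : M.val.obj (op U)) (hq : pres M.val (X.basicOpen_le g) q = 0) :
    ∃ k : ℕ, B.sc U (g ^ k) • q = 0 := by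
  obtain ⟨K, hK⟩ := exists_uniform hU
    (fun k W => ∃ h : W ≤ U, pres M.val h (B.sc U (g ^ k) • q) = 0) (fun x hx => by
      obtain ⟨r, t, hxr, ht⟩ := hs.exists_basicOpen hU q hx
      have hle := X.basicOpen_le r
      have h0 : pres T (X.basicOpen_le (rs hle g)) t = 0 := by
        refine hi.eq_zero ((hU.basicOpen r).basicOpen _) (hT _ ((X.basicOpen_le _).trans hle)
          ((hU.basicOpen r).basicOpen _)) ?_
        rw [app_pres, ht, pres_pres, ← pres_pres M.val (X.basicOpen_le g) (basicOpen_rs_le hle g),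
          hq, map_zero]
      obtain ⟨k, hk⟩ := (hT _ hle (hU.basicOpen r) (rs hle g)).1 t h0
      refine ⟨X.basicOpen r, hxr, k, fun k' hk' => ⟨hle, ?_⟩⟩
      rw [pres_sc, ← ht, ← app_smul, map_pow, ← Nat.sub_add_cancel hk', pow_add, sc_mul_smul, hk,
        smul_zero, map_zero])
  refine ⟨K, eq_of_forall_mem fun x hx => ?_⟩
  obtain ⟨W, hxW, hWU, h⟩ := hK x hx
  exact ⟨W, hWU, hxW, h.trans (map_zero (res M hWU)).symm⟩

/-- A locally bijective map from a presheaf with the localization property to a sheaf is bijective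
on affine opens. -/
lemma LocSurj.bijective (hs : LocSurj η) (hi : LocInj η)
    (hT : ∀ V ≤ U, IsAffineOpen V → B.LocAt T V) (hU : IsAffineOpen U) :
    Function.Bijective (η.app (op U)) := by
  refine ⟨(injective_iff_map_eq_zero _).2 fun t ht => hi.eq_zero hU (hT U le_rfl hU) ht,
    fun q => ?_⟩
  refine LinearMap.mem_range.1 (mem_of_local hU (LinearMap.range (η.app (op U)).hom) q
    fun x hx => ?_)
  obtain ⟨r, t, hxr, ht⟩ := hs.exists_basicOpen hU q hx
  obtain ⟨k, t', ht'⟩ := (hT U le_rfl hU r).2 t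
  -- Here `t'` extends `r ^ k` times a lift of `q` over `D(r)`. Its image and `r ^ k • q` agree on
  -- `D(r)`, hence agree on `U` after multiplication by a further power of `r`.
  obtain ⟨l, hl⟩ := hs.torsion hi hT hU r (B.sc U (r ^ k) • q - η.app (op U) t') (by
    rw [map_sub, ← app_pres, ht', pres_sc, app_smul, ht]
    exact sub_self _)
  refine ⟨r, hxr, l + k, B.sc U (r ^ l) • t', ?_⟩
  rw [smul_sub, sub_eq_zero] at hl
  rw [pow_add, sc_mul_smul, hl]
  exact app_smul η _ _

/-- Torsion is the previous lemma but one; fractions are taken in `T`, since bijectivity over the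
affine open `D(f)` identifies the sections of `T` and of the sheaf there. -/
lemma LocSurj.locAt (hs : LocSurj η) (hi : LocInj η)
    (hT : ∀ V ≤ U, IsAffineOpen V → B.LocAt T V) (hU : IsAffineOpen U) : B.LocAt M.val U := by
  refine fun f => ⟨fun q => hs.torsion hi hT hU f q, fun q => ?_⟩
  obtain ⟨t, rfl⟩ := (hs.bijective hi (fun V hV => hT V (hV.trans (X.basicOpen_le f)))
    (hU.basicOpen f)).2 q
  obtain ⟨k, t', ht'⟩ := (hT U le_rfl hU f).2 t
  refine ⟨k, η.app (op U) t', ?_⟩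
  rw [← app_pres, ht', app_smul]

end Sheafify

end AlgebraSheaf

/-! ### Local exactness; quasi-coherent modules form an abelian subcategory -/

namespace AlgebraSheaf
open NCSheaf
variable {X : Scheme.{u}} {B : AlgebraSheaf X}

section Sheafification

variable (T : PresheafOfModules.{u} B.ring.obj)

/-- The sheaf associated with a presheaf of modules. -/
abbrev sheafif : SheafOfModules.{u} B.ring := (PresheafOfModules.sheafification (𝟙 B.ring.obj)).obj T

/-- The canonical map to the associated sheaf. -/
def toSheafif : T ⟶ (sheafif T).val :=
  PresheafOfModules.homMk (CategoryTheory.toSheafify (Opens.grothendieckTopology X) T.presheaf)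
    fun U r t => (((PresheafOfModules.sheafificationAdjunction (𝟙 B.ring.obj)).unit.app T).app
      U).hom.map_smul r t

lemma locInj_toSheafif : LocInj (toSheafif T) := by
  intro V t ht x hx
  have h := Presheaf.equalizerSieve_mem (Opens.grothendieckTopology X)
    (CategoryTheory.toSheafify (Opens.grothendieckTopology X) T.presheaf) (X := op V)
    (x := t) (y := 0) (ht.trans (map_zero (toSheafif T |>.app (op V)).hom).symm)
  obtain ⟨W, f, hf, hxW⟩ := h x hx
  exact ⟨W, f.le, hxW, (show T.presheaf.map f.op t = T.presheaf.map f.op 0 from hf).trans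
    (map_zero _)⟩

lemma locSurj_toSheafif : LocSurj (toSheafif T) := by
  intro V q x hx
  have h := Presheaf.imageSieve_mem (Opens.grothendieckTopology X)
    (CategoryTheory.toSheafify (Opens.grothendieckTopology X) T.presheaf) (U := op V) q
  obtain ⟨W, f, ⟨t, ht⟩, hxW⟩ := h x hx
  exact ⟨W, f.le, t, hxW, ht⟩

lemma sheafif_hom_ext {T : PresheafOfModules.{u} B.ring.obj} {M : SheafOfModules.{u} B.ring}
    {f g : sheafif T ⟶ M} (h : toSheafif T ≫ f.val = toSheafif T ≫ g.val) : f = g := by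
  refine SheafOfModules.hom_ext (PresheafOfModules.hom_ext fun V => ModuleCat.hom_ext
    (LinearMap.ext fun q => eq_of_forall_mem (V := V.unop) fun x hx => ?_))
  obtain ⟨W, hW, t, hxW, ht⟩ := locSurj_toSheafif T V.unop q x hx
  refine ⟨W, hW, hxW, ?_⟩
  refine (app_pres f.val hW q).symm.trans (Eq.trans ?_ (app_pres g.val hW q))
  rw [← ht]
  exact congrArg (fun φ => φ.app (op W) t) h

end Sheafification

section Exactness

variable {M N : SheafOfModules.{u} B.ring} (f : M ⟶ N)

lemma epi_of_locSurj (h : LocSurj f.val) : Epi f where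
  left_cancellation {K} a b hab := by
    refine SheafOfModules.hom_ext (PresheafOfModules.hom_ext fun V => ModuleCat.hom_ext
      (LinearMap.ext fun q => eq_of_forall_mem (V := V.unop) fun x hx => ?_))
    obtain ⟨W, hW, t, hxW, ht⟩ := h V.unop q x hx
    refine ⟨W, hW, hxW, ?_⟩
    refine (app_pres a.val hW q).symm.trans (Eq.trans ?_ (app_pres b.val hW q))
    rw [← ht]
    exact congrArg (fun φ => φ.val.app (op W) t) hab

lemma mono_of_injective (h : ∀ V : X.Opens, Function.Injective (f.val.app (op V))) : Mono f where
  right_cancellation {K} a b hab := by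
    refine SheafOfModules.hom_ext (PresheafOfModules.hom_ext fun V => ModuleCat.hom_ext
      (LinearMap.ext fun q => h V.unop ?_))
    exact congrArg (fun φ => φ.val.app V q) hab

lemma injective_of_mono [Mono f] (V : X.Opens) : Function.Injective (f.val.app (op V)) :=
  (ModuleCat.mono_iff_injective ((SheafOfModules.evaluation B.ring (op V)).map f)).1 inferInstance

lemma presheaf_cokernel_exact {S T : PresheafOfModules.{u} B.ring.obj} (g : S ⟶ T) (V : X.Opens)
    (t : T.obj (op V)) : (cokernel.π g).app (op V) t = 0 ↔ ∃ s, g.app (op V) s = t := by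
  have h := (ShortComplex.exact_cokernel g).map (PresheafOfModules.evaluation B.ring.obj (op V))
  rw [ShortComplex.moduleCat_exact_iff] at h
  refine ⟨fun ht => h t ht, ?_⟩
  rintro ⟨s, rfl⟩
  exact congrArg (fun φ => φ.app (op V) s) (cokernel.condition g)

lemma presheaf_cokernel_surjective {S T : PresheafOfModules.{u} B.ring.obj} (g : S ⟶ T)
    (V : X.Opens) : Function.Surjective ((cokernel.π g).app (op V)) :=
  (ModuleCat.epi_iff_surjective
    ((PresheafOfModules.evaluation B.ring.obj (op V)).map (cokernel.π g))).1 inferInstance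

/-- The map from `N` to the sheaf associated with the presheaf cokernel kills the image of `f`, so
it is zero when `f` is epi. Every section of `N` therefore dies locally in the presheaf cokernel,
which means that it lifts locally. -/
lemma locSurj_of_epi [Epi f] : LocSurj f.val := by
  let π : N ⟶ sheafif (cokernel f.val) := ⟨cokernel.π f.val ≫ toSheafif _⟩
  have h0 : f ≫ π = 0 := SheafOfModules.hom_ext (by
    change f.val ≫ cokernel.π f.val ≫ toSheafif _ = 0
    rw [cokernel.condition_assoc, zero_comp])
  have hπ : π = 0 := by rw [← cancel_epi f, h0, comp_zero]
  intro V q x hx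
  have h1 : (toSheafif (cokernel f.val)).app (op V) ((cokernel.π f.val).app (op V) q) = 0 :=
    congrArg (fun φ => φ.val.app (op V) q) hπ
  obtain ⟨W, hW, hxW, h2⟩ := locInj_toSheafif _ V _ h1 x hx
  rw [← app_pres] at h2
  obtain ⟨m, hm⟩ := (presheaf_cokernel_exact _ _ _).1 h2
  exact ⟨W, hW, m, hxW, hm⟩

lemma exists_of_exact_mono (S : ShortComplex (SheafOfModules.{u} B.ring)) (hS : S.Exact)
    [Mono S.f] (V : X.Opens) (n : S.X₂.val.obj (op V)) (hn : S.g.val.app (op V) n = 0) :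
    ∃ m, S.f.val.app (op V) m = n := by
  have : (SheafOfModules.evaluation.{u} B.ring (op V)).PreservesZeroMorphisms := ⟨fun _ _ => rfl⟩
  have h := hS.map_of_mono_of_preservesKernel (SheafOfModules.evaluation B.ring (op V))
    inferInstance inferInstance
  rw [ShortComplex.moduleCat_exact_iff] at h
  exact h n hn

/-- Exactness makes `X₁ ⟶ ker g` epi, hence locally surjective, and sections of the sheaf kernel are
the kernel on sections. -/
lemma exists_of_exact (S : ShortComplex (SheafOfModules.{u} B.ring)) (hS : S.Exact)
    (V : X.Opens) (n : S.X₂.val.obj (op V)) (hn : S.g.val.app (op V) n = 0) (x : X) (hx : x ∈ V) :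
    ∃ (W : X.Opens) (hW : W ≤ V) (m : S.X₁.val.obj (op W)), x ∈ W ∧
      S.f.val.app (op W) m = pres S.X₂.val hW n := by
  have := hS.epi_kernelLift
  obtain ⟨k, hk⟩ := exists_of_exact_mono (.mk (kernel.ι S.g) S.g (kernel.condition _))
    (ShortComplex.exact_kernel S.g) V n hn
  obtain ⟨W, hW, m, hxW, hm⟩ := locSurj_of_epi (kernel.lift S.g S.f S.zero) V k x hx
  refine ⟨W, hW, m, hxW, ?_⟩
  have h1 := congrArg (fun φ => φ.val.app (op W) m) (kernel.lift_ι S.g S.f S.zero)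
  refine h1.symm.trans ?_
  refine (congrArg ((kernel.ι S.g).val.app (op W)) hm).trans ?_
  refine (app_pres (kernel.ι S.g).val hW k).trans ?_
  exact congrArg _ hk

end Exactness

section Closure

lemma qcoh_iff {M : SheafOfModules.{u} B.ring} :
    B.qcoh M ↔ ∀ U : X.Opens, IsAffineOpen U → B.LocAt M.val U :=
  ⟨fun h _ hU => h.locAt hU, fun h => qcoh_of_locAt fun x => by
    obtain ⟨U, hU, hx, -⟩ := exists_isAffineOpen_mem_and_subset (x := x) (U := ⊤) trivial
    exact ⟨U, hx, hU, h U hU⟩⟩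

/-- A section of `X₁` over `D(f)` becomes a fraction in `X₂`. The numerator maps to a section of
`X₃` that vanishes on `D(f)`, so a further power of `f` moves it into `X₁`. -/
lemma qcoh_kernel (S : ShortComplex (SheafOfModules.{u} B.ring)) (hS : S.Exact) [Mono S.f]
    (h₂ : B.qcoh S.X₂) (h₃ : B.qcoh S.X₃) : B.qcoh S.X₁ := by
  refine qcoh_iff.2 fun U hU f => ⟨fun m hm => ?_, fun m' => ?_⟩
  · obtain ⟨k, hk⟩ := (h₂.locAt hU f).1 (S.f.val.app _ m) (by rw [← app_pres, hm, map_zero])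
    refine ⟨k, injective_of_mono S.f U ?_⟩
    rw [map_zero, app_smul, hk]
  · obtain ⟨k, n, hn⟩ := (h₂.locAt hU f).2 (S.f.val.app _ m')
    obtain ⟨l, hl⟩ := (h₃.locAt hU f).1 (S.g.val.app _ n) (by
      rw [← app_pres, hn, app_smul]
      have : S.g.val.app _ (S.f.val.app _ m') = 0 :=
        congrArg (fun φ => φ.val.app (op (X.basicOpen f)) m') S.zero
      rw [this, smul_zero])
    rw [← app_smul] at hl
    obtain ⟨m, hm⟩ := exists_of_exact_mono S hS U _ hl
    refine ⟨l + k, m, injective_of_mono S.f _ ?_⟩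
    change _ = S.f.val.app _ (B.sc _ (rs (X.basicOpen_le f) (f ^ (l + k))) • m')
    rw [app_pres, hm, pres_sc, hn]
    change B.sc _ (rs (X.basicOpen_le f) (f ^ l)) • B.sc _ (rs (X.basicOpen_le f) (f ^ k)) • _ = _
    rw [← sc_mul_smul, ← map_mul, ← pow_add, app_smul]

/-- Presheaf cokernels are computed on sections, so this is the right exactness of localization,
written with explicit denominators. -/
lemma locAt_cokernel {S T : PresheafOfModules.{u} B.ring.obj} (g : S ⟶ T) {U : X.Opens}
    (hS : B.LocAt S U) (hT : B.LocAt T U) : B.LocAt (cokernel g) U := by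
  refine fun f => ⟨fun q hq => ?_, fun q => ?_⟩
  · obtain ⟨t, rfl⟩ := presheaf_cokernel_surjective g _ q
    rw [← app_pres, presheaf_cokernel_exact] at hq
    obtain ⟨s, hs⟩ := hq
    obtain ⟨k, s', hs'⟩ := (hS f).2 s
    obtain ⟨l, hl⟩ := (hT f).1 (B.sc U (f ^ k) • t - g.app (op U) s') (by
      rw [map_sub, ← app_pres, hs', app_smul, hs, pres_sc]
      exact sub_self _)
    refine ⟨l + k, ?_⟩
    rw [← app_smul, presheaf_cokernel_exact]
    rw [smul_sub, sub_eq_zero] at hl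
    exact ⟨B.sc U (f ^ l) • s', by rw [app_smul, ← hl, pow_add, sc_mul_smul]⟩
  · obtain ⟨t, rfl⟩ := presheaf_cokernel_surjective g _ q
    obtain ⟨k, t', ht'⟩ := (hT f).2 t
    exact ⟨k, (cokernel.π g).app _ t', (app_pres (cokernel.π g) (X.basicOpen_le f) t').symm.trans
      ((congrArg _ ht').trans (app_smul (cokernel.π g) _ t))⟩

/-- The presheaf cokernel has the localization property and maps to `X₃` by a locally bijective
morphism, so `LocSurj.locAt` applies. -/
lemma qcoh_cokernel (S : ShortComplex (SheafOfModules.{u} B.ring)) (hS : S.Exact) [Epi S.g]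
    (h₁ : B.qcoh S.X₁) (h₂ : B.qcoh S.X₂) : B.qcoh S.X₃ := by
  let η : cokernel S.f.val ⟶ S.X₃.val := cokernel.desc S.f.val S.g.val
    (congrArg SheafOfModules.Hom.val S.zero)
  have hη : ∀ (V : X.Opens) (t), η.app (op V) ((cokernel.π S.f.val).app (op V) t) =
      S.g.val.app (op V) t := fun V t =>
    congrArg (fun φ => φ.app (op V) t) (cokernel.π_desc S.f.val S.g.val _)
  have hs : LocSurj η := fun V q x hx => by
    obtain ⟨W, hW, t, hxW, ht⟩ := locSurj_of_epi S.g V q x hx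
    exact ⟨W, hW, _, hxW, (hη W t).trans ht⟩
  have hi : LocInj η := fun V q hq x hx => by
    obtain ⟨t, rfl⟩ := presheaf_cokernel_surjective S.f.val _ q
    rw [hη] at hq
    obtain ⟨W, hW, m, hxW, hm⟩ := exists_of_exact S hS V t hq x hx
    refine ⟨W, hW, hxW, ?_⟩
    rw [← app_pres, presheaf_cokernel_exact]
    exact ⟨m, hm⟩
  exact qcoh_iff.2 fun U hU => hs.locAt hi
    (fun V _ hV => locAt_cokernel _ (h₁.locAt hV) (h₂.locAt hV)) hU

/-- The hypothesis makes `K` a retract of `M ⊕ N` without forming the sum. This serves for binary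
products and, with `b = 0`, for closure under isomorphisms. -/
lemma qcoh_of_add_eq_id {M N K : SheafOfModules.{u} B.ring} (hM : B.qcoh M) (hN : B.qcoh N)
    (a : K ⟶ M) (a' : M ⟶ K) (b : K ⟶ N) (b' : N ⟶ K) (h : a ≫ a' + b ≫ b' = 𝟙 K) :
    B.qcoh K := by
  have hx : ∀ (V : X.Opens) (x : K.val.obj (op V)),
      a'.val.app _ (a.val.app _ x) + b'.val.app _ (b.val.app _ x) = x := fun V x =>
    congrArg (fun φ => φ.val.app (op V) x) h
  refine qcoh_iff.2 fun U hU f => ⟨fun m hm => ?_, fun m' => ?_⟩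
  · obtain ⟨k, hk⟩ := (hM.locAt hU f).1 (a.val.app _ m) (by rw [← app_pres, hm, map_zero])
    obtain ⟨l, hl⟩ := (hN.locAt hU f).1 (b.val.app _ m) (by rw [← app_pres, hm, map_zero])
    refine ⟨k + l, ?_⟩
    rw [← hx U (_ • m)]
    simp only [app_smul]
    rw [pow_add, sc_mul_smul, sc_mul_smul, ← app_smul b'.val, hl, map_zero, smul_zero, add_zero,
      ← sc_mul_smul, mul_comm, sc_mul_smul, ← app_smul a'.val, hk, map_zero, smul_zero]
  · obtain ⟨k, m, hm⟩ := (hM.locAt hU f).2 (a.val.app _ m')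
    obtain ⟨l, n, hn⟩ := (hN.locAt hU f).2 (b.val.app _ m')
    refine ⟨k + l, B.sc U (f ^ l) • a'.val.app _ m + B.sc U (f ^ k) • b'.val.app _ n, ?_⟩
    change _ = B.sc _ (rs (X.basicOpen_le f) (f ^ (k + l))) • m'
    rw [map_add, pres_sc, pres_sc, ← app_pres, ← app_pres, hm, hn]
    change B.sc _ (rs (X.basicOpen_le f) (f ^ l)) •
        a'.val.app _ (B.sc _ (rs (X.basicOpen_le f) (f ^ k)) • a.val.app _ m') +
      B.sc _ (rs (X.basicOpen_le f) (f ^ k)) •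
        b'.val.app _ (B.sc _ (rs (X.basicOpen_le f) (f ^ l)) • b.val.app _ m') = _
    rw [app_smul, app_smul, ← sc_mul_smul, ← sc_mul_smul, ← map_mul, ← map_mul, ← pow_add,
      ← pow_add, add_comm l k, ← smul_add, hx]

instance isAbelianSubcategory_qcoh : IsAbelianSubcategory B.qcoh := by
  have h0 : B.qcoh.ContainsZero := by
    obtain ⟨Z, hZ⟩ := HasZeroObject.zero (C := SheafOfModules.{u} B.ring)
    have hs : ∀ (V : X.Opens) (m : Z.val.obj (op V)), m = 0 := fun V m =>
      congrArg (fun φ : Z ⟶ Z => φ.val.app (op V) m) (IsZero.eq_of_src ⟨hZ.1, hZ.2⟩ (𝟙 Z) 0)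
    exact ⟨⟨Z, ⟨hZ.1, hZ.2⟩, qcoh_iff.2 fun U hU f =>
      ⟨fun m _ => ⟨0, hs _ _⟩, fun m' => ⟨0, 0, (hs _ _).trans (hs _ _).symm⟩⟩⟩⟩
  have h1 : B.qcoh.IsClosedUnderKernels := by
    refine ⟨?_⟩
    rintro K ⟨f, k, hk, hM, hN⟩
    have := mono_of_isLimit_fork hk
    exact qcoh_kernel (.mk k.ι f k.condition)
      (ShortComplex.exact_of_f_is_kernel _ (IsLimit.ofIsoLimit hk (Fork.ext (Iso.refl _)))) hM hN
  have h2 : B.qcoh.IsClosedUnderCokernels := by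
    refine ⟨?_⟩
    rintro K ⟨f, k, hk, hM, hN⟩
    have := epi_of_isColimit_cofork hk
    exact qcoh_cokernel (.mk f k.π k.condition)
      (ShortComplex.exact_of_g_is_cokernel _ (IsColimit.ofIsoColimit hk (Cofork.ext (Iso.refl _))))
      hM hN
  have h3 : B.qcoh.IsClosedUnderBinaryProducts := by
    refine ⟨?_⟩
    rintro K ⟨p, hp⟩
    -- The cones `l` and `r` define the inclusions of the two factors into the product.
    let l : (Functor.const _).obj (p.diag.obj ⟨.left⟩) ⟶ p.diag := mapPair (𝟙 _) 0
    let r : (Functor.const _).obj (p.diag.obj ⟨.right⟩) ⟶ p.diag := mapPair 0 (𝟙 _)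
    refine qcoh_of_add_eq_id (hp ⟨.left⟩) (hp ⟨.right⟩) (p.π.app ⟨.left⟩)
      (p.isLimit.lift (Cone.mk _ l)) (p.π.app ⟨.right⟩) (p.isLimit.lift (Cone.mk _ r)) ?_
    refine p.isLimit.hom_ext ?_
    have hl := p.isLimit.fac (Cone.mk _ l)
    have hr := p.isLimit.fac (Cone.mk _ r)
    rintro ⟨_ | _⟩
    · rw [Preadditive.add_comp, Category.assoc, Category.assoc, hl, hr]
      exact (congrArg₂ (· + ·) (Category.comp_id _) comp_zero).trans
        ((add_zero _).trans (Category.id_comp _).symm)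
    · rw [Preadditive.add_comp, Category.assoc, Category.assoc, hl, hr]
      exact (congrArg₂ (· + ·) comp_zero (Category.comp_id _)).trans
        ((zero_add _).trans (Category.id_comp _).symm)
  have : B.qcoh.IsClosedUnderIsomorphisms := ⟨fun {M N} e hM =>
    qcoh_of_add_eq_id hM hM e.inv e.hom 0 0 (by simp)⟩
  have := ObjectProperty.IsClosedUnderFiniteProducts.mk' (P := B.qcoh)
  exact {}

end Closure

end AlgebraSheaf

/-! ### Homomorphisms from a quasi-coherent module over an affine open -/

namespace AlgebraSheaf
open NCSheaf
variable {X : Scheme.{u}} {B : AlgebraSheaf X}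

section LocalHom

variable {M N : SheafOfModules.{u} B.ring}

/-- A local, functional, additive and linear relation between sections that is locally defined
everywhere gives a local homomorphism. -/
lemma exists_localHom_of_rel (U : X.Opens)
    (r : ∀ V : X.Opens, M.val.obj (op V) → N.val.obj (op V) → Prop)
    (hres : ∀ (V W : X.Opens) (_ : V ≤ U) (hW : W ≤ V) (m) (n), r V m n →
      r W (res M hW m) (res N hW n))
    (huniq : ∀ (V : X.Opens) (_ : V ≤ U) (m) (n n'), r V m n → r V m n' → n = n')
    (hex : ∀ (V : X.Opens) (_ : V ≤ U) (m : M.val.obj (op V)), ∀ x ∈ V,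
      ∃ (W : X.Opens) (hW : W ≤ V) (n : N.val.obj (op W)), x ∈ W ∧ r W (res M hW m) n)
    (hadd : ∀ (V : X.Opens) (_ : V ≤ U) (m m') (n n'), r V m n → r V m' n' →
      r V (m + m') (n + n'))
    (hsmul : ∀ (V : X.Opens) (_ : V ≤ U) (b : B.ring.obj.obj (op V)) (m) (n), r V m n → ∀ x ∈ V,
      ∃ (W : X.Opens) (hW : W ≤ V), x ∈ W ∧ r W (res M hW (b • m)) (res N hW (b • n))) :
    ∃ φ : localHom M N U, ∀ (V : {V : X.Opens // V ≤ U}) (m) (n), r V.1 m n → φ.1 V m = n := by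
  -- `r'` is the relation "locally `r`". Uniqueness for `r` lets the local values agree on overlaps,
  -- so they glue and `r'` becomes the graph of a map.
  let r' : ∀ V : X.Opens, M.val.obj (op V) → N.val.obj (op V) → Prop := fun V m n =>
    ∀ x ∈ V, ∃ (W : X.Opens) (hW : W ≤ V), x ∈ W ∧ r W (res M hW m) (res N hW n)
  have of_r : ∀ V m n, r V m n → r' V m n := fun V m n h x hx =>
    ⟨V, le_rfl, hx, by rwa [res_self, res_self]⟩
  have hres' : ∀ (V W : X.Opens) (_ : V ≤ U) (hW : W ≤ V) m n, r' V m n →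
      r' W (res M hW m) (res N hW n) := by
    intro V W hV hW m n h x hx
    obtain ⟨W', hW', hxW', h'⟩ := h x (hW hx)
    refine ⟨W ⊓ W', inf_le_left, ⟨hx, hxW'⟩, ?_⟩
    have := hres _ (W ⊓ W') (hW'.trans hV) inf_le_right _ _ h'
    rwa [res_res, res_res] at this ⊢
  have huniq' : ∀ (V : X.Opens) (_ : V ≤ U) m n n', r' V m n → r' V m n' → n = n' := by
    intro V hV m n n' h h'
    refine eq_of_forall_mem fun x hx => ?_
    obtain ⟨W, hW, hxW, h1⟩ := h x hx
    obtain ⟨W', hW', hxW', h2⟩ := h' x hx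
    refine ⟨W ⊓ W', inf_le_left.trans hW, ⟨hxW, hxW'⟩, ?_⟩
    have e1 := hres _ (W ⊓ W') (hW.trans hV) inf_le_left _ _ h1
    have e2 := hres _ (W ⊓ W') (hW'.trans hV) inf_le_right _ _ h2
    rw [res_res, res_res] at e1 e2
    exact huniq _ (inf_le_left.trans (hW.trans hV)) _ _ _ e1 e2
  have hex' : ∀ (V : {V : X.Opens // V ≤ U}) (m : M.val.obj (op V.1)), ∃ n, r' V.1 m n := by
    rintro ⟨V, hV⟩ m
    choose W hW n hxW hr using fun x : V => hex V hV m x.1 x.2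
    obtain ⟨t, ht⟩ := exists_glue (M := N) hW (fun x hx => Opens.mem_iSup.2 ⟨⟨x, hx⟩, hxW _⟩) n
      (fun i j => by
        have e1 := hres _ (W i ⊓ W j) ((hW i).trans hV) inf_le_left _ _ (hr i)
        have e2 := hres _ (W i ⊓ W j) ((hW j).trans hV) inf_le_right _ _ (hr j)
        rw [res_res] at e1 e2
        exact huniq _ (inf_le_left.trans ((hW i).trans hV)) _ _ _ e1 e2)
    exact ⟨t, fun x hx => ⟨W ⟨x, hx⟩, hW _, hxW _, by rw [ht]; exact hr _⟩⟩
  choose φ hφ using hex'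
  refine ⟨⟨fun V =>
    { toFun := φ V
      map_add' := fun m m' => huniq' V.1 V.2 _ _ _ (hφ V _) fun x hx => ?_
      map_smul' := fun b m => huniq' V.1 V.2 _ _ _ (hφ V _) fun x hx => ?_ },
    fun V W h m => huniq' W.1 W.2 _ _ _ (hφ W _) (hres' _ _ V.2 h _ _ (hφ V m))⟩,
    fun V m n h => huniq' V.1 V.2 _ _ _ (hφ V m) (of_r _ _ _ h)⟩
  · obtain ⟨W, hW, hxW, h1⟩ := hφ V m x hx
    obtain ⟨W', hW', hxW', h2⟩ := hφ V m' x hx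
    refine ⟨W ⊓ W', inf_le_left.trans hW, ⟨hxW, hxW'⟩, ?_⟩
    have e1 := hres _ (W ⊓ W') (hW.trans V.2) inf_le_left _ _ h1
    have e2 := hres _ (W ⊓ W') (hW'.trans V.2) inf_le_right _ _ h2
    rw [res_res, res_res] at e1 e2
    have := hadd _ (inf_le_left.trans (hW.trans V.2)) _ _ _ _ e1 e2
    rwa [← map_add, ← map_add] at this
  · obtain ⟨W, hW, hxW, h1⟩ := hφ V m x hx
    obtain ⟨W', hW', hxW', h2⟩ := hsmul W (hW.trans V.2) (B.ring.obj.map (homOfLE hW).op b) _ _ h1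
      x hxW
    refine ⟨W', hW'.trans hW, hxW', ?_⟩
    rwa [← res_smul, ← res_smul, res_res, res_res] at h2

/-- The value on the largest open of a local homomorphism. -/
def topHom (U : X.Opens) (φ : localHom M N U) :
    M.val.obj (op U) →ₗ[B.ring.obj.obj (op U)] N.val.obj (op U) := φ.1 ⟨U, le_rfl⟩

lemma localHom_res (φ : localHom M N U) {V W : X.Opens} (hV : V ≤ U) (hW : W ≤ V)
    (m : M.val.obj (op V)) :
    φ.1 ⟨W, hW.trans hV⟩ (res M hW m) = res N hW (φ.1 ⟨V, hV⟩ m) :=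
  φ.2 ⟨V, hV⟩ ⟨W, hW.trans hV⟩ hW m

lemma res_sc (M : SheafOfModules.{u} B.ring) {W V : X.Opens} (h : W ≤ V) (f : Γ(X, V))
    (m : M.val.obj (op V)) : res M h (B.sc V f • m) = B.sc W (rs h f) • res M h m :=
  pres_sc M.val h f m

/-- On small basic opens every section of `M` is a fraction of a section over `U`, and its
denominator acts invertibly on `N`. No quasi-coherence of `N` is needed, which later allows
arbitrary target sheaves. -/
lemma topHom_injective {U : X.Opens} (hU : IsAffineOpen U) (hM : B.LocAt M.val U) :
    Function.Injective (topHom (M := M) (N := N) U) := by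
  intro φ ψ h
  refine localHom_ext fun V m => eq_of_forall_mem fun x hx => ?_
  obtain ⟨f, hf, hxf⟩ := exists_basicOpen_le hU (V.2 hx) hx
  refine ⟨X.basicOpen f, hf, hxf, ?_⟩
  obtain ⟨k, m', hm'⟩ := (hM f).2 (res M hf m)
  have key : ∀ φ : localHom M N U, B.sc _ (rs (X.basicOpen_le f) (f ^ k)) • res N hf (φ.1 V m) =
      res N (X.basicOpen_le f) (topHom U φ m') := fun φ => by
    rw [← localHom_res φ V.2 hf, ← map_smul]
    exact (congrArg _ hm'.symm).trans (localHom_res φ le_rfl _ _)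
  refine sc_smul_injective N.val ((isUnit_rs (le_refl (X.basicOpen f))).pow k) ?_
  rw [← map_pow]
  exact (key φ).trans ((congrArg (fun g => res N (X.basicOpen_le f) (g m')) h).trans (key ψ).symm)

/-- The extension of `h` to smaller opens sends a fraction `m' / s` to `h(m') / s`; `N` is again an
arbitrary sheaf. -/
lemma topHom_surjective {U : X.Opens} (hB : B.IsNCScheme) (hU : IsAffineOpen U)
    (hM : B.LocAt M.val U) : Function.Surjective (topHom (M := M) (N := N) U) := by
  intro h
  have hB' : B.LocAt (SheafOfModules.unit B.ring).val U := hB.locAt hU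
  -- This makes the value at a fraction independent of the chosen numerator and denominator.
  have h0 : ∀ (V : X.Opens) (hV : V ≤ U) (m : M.val.obj (op U)), res M hV m = 0 →
      res N hV (h m) = 0 := fun V hV m hm => by
    refine eq_of_forall_mem fun x hx => ?_
    obtain ⟨f, hf, hxf⟩ := exists_basicOpen_le hU (hV hx) hx
    refine ⟨X.basicOpen f, hf, hxf, ?_⟩
    obtain ⟨k, hk⟩ := (hM f).1 m (by
      change res M (X.basicOpen_le f) m = 0
      rw [← res_res M hV hf, hm, map_zero])
    rw [res_res, map_zero]
    refine sc_smul_injective N.val ((isUnit_rs (le_refl (X.basicOpen f))).pow k) ?_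
    rw [smul_zero, ← map_pow, ← res_sc, ← map_smul, hk, map_zero, map_zero]
  -- The graph on `V`: `m = m' / s` and `n = h(m') / s`, with a denominator `s` on `U` that is
  -- invertible on `V`.
  let r : ∀ V : X.Opens, M.val.obj (op V) → N.val.obj (op V) → Prop := fun V m n =>
    ∃ (hV : V ≤ U) (s : Γ(X, U)) (m' : M.val.obj (op U)), IsUnit (rs hV s) ∧
      res M hV m' = B.sc V (rs hV s) • m ∧ res N hV (h m') = B.sc V (rs hV s) • n
  suffices hr : ∃ φ : localHom M N U, ∀ (V : {V : X.Opens // V ≤ U}) (m) (n), r V.1 m n →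
      φ.1 V m = n by
    obtain ⟨φ, hφ⟩ := hr
    refine ⟨φ, LinearMap.ext fun m => hφ ⟨U, le_rfl⟩ m (h m) ⟨le_rfl, 1, m, ?_, ?_, ?_⟩⟩
    · rw [map_one]; exact isUnit_one
    · rw [map_one, map_one, one_smul, res_self]
    · rw [map_one, map_one, one_smul, res_self]
  refine exists_localHom_of_rel U r ?_ ?_ ?_ ?_ ?_
  · rintro V W hV hW m n ⟨_, s, m', hs, hm, hn⟩
    refine ⟨hW.trans hV, s, m', ?_, ?_, ?_⟩
    · rw [← rs_rs hV hW]; exact hs.map _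
    · rw [← res_res M hV hW, hm, ← rs_rs hV hW]
      exact pres_sc M.val hW _ _
    · rw [← res_res N hV hW, hn, ← rs_rs hV hW]
      exact pres_sc N.val hW _ _
  · rintro V hV m n n' ⟨_, s, m₁, hs, hm, hn⟩ ⟨_, t, m₂, ht, hm', hn'⟩
    have h1 := h0 V hV (B.sc U t • m₁ - B.sc U s • m₂) (by
      rw [map_sub, sub_eq_zero, res_sc, res_sc, hm, hm', ← sc_mul_smul, ← sc_mul_smul, mul_comm])
    rw [map_sub, map_smul, map_smul, map_sub, sub_eq_zero, res_sc, res_sc, hn, hn', ← sc_mul_smul,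
      ← sc_mul_smul, mul_comm] at h1
    exact sc_smul_injective N.val (hs.mul ht) h1
  · intro V hV m x hx
    obtain ⟨f, hf, hxf⟩ := exists_basicOpen_le hU (hV hx) hx
    obtain ⟨k, m', hm'⟩ := (hM f).2 (res M hf m)
    have hu : IsUnit (rs (X.basicOpen_le f) (f ^ k)) := by
      rw [map_pow]; exact (isUnit_rs (le_refl (X.basicOpen f))).pow k
    obtain ⟨n, hn⟩ := exists_sc_smul_eq N.val hu (res N (X.basicOpen_le f) (h m'))
    exact ⟨X.basicOpen f, hf, n, hxf, X.basicOpen_le f, f ^ k, m', hu, hm', hn.symm⟩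
  · rintro V hV m m' n n' ⟨_, s, m₁, hs, hm, hn⟩ ⟨_, t, m₂, ht, hm', hn'⟩
    have hst : IsUnit (rs hV (s * t)) := by rw [map_mul]; exact hs.mul ht
    refine ⟨hV, s * t, B.sc U t • m₁ + B.sc U s • m₂, hst, ?_, ?_⟩
    · rw [map_add, res_sc, res_sc, hm, hm', smul_add, map_mul, sc_mul_smul, sc_mul_smul]
      exact congrArg (· + _) (sc_smul_comm M.val _ _ _)
    · rw [map_add h, map_smul h, map_smul h, map_add, res_sc, res_sc, hn, hn', smul_add, map_mul,
        sc_mul_smul, sc_mul_smul]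
      exact congrArg (· + _) (sc_smul_comm N.val _ _ _)
  -- A scalar in `B(V)` need not come from `U`, but locally it is a fraction `b' / f ^ k`; this is
  -- where the quasi-coherence of `B` enters.
  · rintro V hV b m n ⟨_, s, m₁, hs, hm, hn⟩ x hx
    obtain ⟨f, hf, hxf⟩ := exists_basicOpen_le hU (hV hx) hx
    obtain ⟨k, b', hb'⟩ := (hB' f).2 (B.ring.obj.map (homOfLE hf).op b)
    have hu : IsUnit (rs (X.basicOpen_le f) (f ^ k)) := by
      rw [map_pow]; exact (isUnit_rs (le_refl (X.basicOpen f))).pow k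
    have hsf : IsUnit (rs (X.basicOpen_le f) s) := by rw [← rs_rs hV hf]; exact hs.map _
    have hb2 : B.ring.obj.map (homOfLE (X.basicOpen_le f)).op b' =
        B.sc _ (rs (X.basicOpen_le f) (f ^ k)) * B.ring.obj.map (homOfLE hf).op b := hb'
    have aux : ∀ (K : SheafOfModules.{u} B.ring) (y : K.val.obj (op V)) (y' : K.val.obj (op U)),
        res K hV y' = B.sc V (rs hV s) • y →
        res K (X.basicOpen_le f) ((show B.ring.obj.obj (op U) from b') • y') =
          B.sc _ (rs (X.basicOpen_le f) (f ^ k * s)) • res K hf (b • y) := fun K y y' hy => by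
      rw [res_smul K (X.basicOpen_le f), hb2, ← res_res K hV hf, hy, res_sc, map_mul, sc_mul_smul,
        mul_smul, rs_rs, res_smul K hf b y]
      exact congrArg _ (sc_smul_comm K.val _ _ _).symm
    refine ⟨X.basicOpen f, hf, hxf, X.basicOpen_le f, f ^ k * s, _, ?_, aux M _ _ hm, ?_⟩
    · rw [map_mul]; exact hu.mul hsf
    · rw [map_smul]; exact aux N _ _ hn

end LocalHom

end AlgebraSheaf

/-! ### Dual bases; quasi-coherence of `Hom_B(P, N)` and of `(End_B P)ᵒᵖ` -/

namespace AlgebraSheaf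
open NCSheaf
variable {X : Scheme.{u}} {B : AlgebraSheaf X}

section LocAt

variable {T : PresheafOfModules.{u} B.ring.obj} {U : X.Opens} {ι : Type*} [Finite ι]

lemma LocAt.exists_forall_smul_eq_zero (h : B.LocAt T U) (f : Γ(X, U)) (m : ι → T.obj (op U))
    (hm : ∀ i, pres T (X.basicOpen_le f) (m i) = 0) : ∃ k : ℕ, ∀ i, B.sc U (f ^ k) • m i = 0 := by
  cases nonempty_fintype ι
  choose k hk using fun i => (h f).1 (m i) (hm i)
  refine ⟨Finset.univ.sup k, fun i => ?_⟩
  rw [← Nat.sub_add_cancel (Finset.le_sup (f := k) (Finset.mem_univ i)), pow_add, sc_mul_smul, hk,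
    smul_zero]

lemma LocAt.exists_forall_pres_eq (h : B.LocAt T U) (f : Γ(X, U))
    (m' : ι → T.obj (op (X.basicOpen f))) : ∃ (k : ℕ) (m : ι → T.obj (op U)),
      ∀ i, pres T (X.basicOpen_le f) (m i) = B.sc _ (rs (X.basicOpen_le f) (f ^ k)) • m' i := by
  cases nonempty_fintype ι
  choose k m hm using fun i => (h f).2 (m' i)
  refine ⟨Finset.univ.sup k, fun i => B.sc U (f ^ (Finset.univ.sup k - k i)) • m i, fun i => ?_⟩
  have hi := Nat.sub_add_cancel (Finset.le_sup (f := k) (Finset.mem_univ i))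
  nth_rewrite 2 [← hi]
  rw [pres_sc, hm, pow_add, map_mul, sc_mul_smul]
  rfl

end LocAt

lemma rs_self {U : X.Opens} (h : U ≤ U) (f : Γ(X, U)) : rs h f = f :=
  congrArg (fun φ => φ.hom f) (X.presheaf.map_id (op U))

section DualBasis

variable {P N : SheafOfModules.{u} B.ring}

/-- Evaluation of a section of the dual module. -/
def ev {U : X.Opens} (γ : localHom P (SheafOfModules.unit B.ring) U) {V : X.Opens} (h : V ≤ U)
    (x : P.val.obj (op V)) : B.ring.obj.obj (op V) := γ.1 ⟨V, h⟩ x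

lemma ev_add {U : X.Opens} (γ : localHom P (SheafOfModules.unit B.ring) U) {V : X.Opens}
    (h : V ≤ U) (x y : P.val.obj (op V)) : ev γ h (x + y) = ev γ h x + ev γ h y :=
  map_add (γ.1 ⟨V, h⟩) x y

lemma ev_smul {U : X.Opens} (γ : localHom P (SheafOfModules.unit B.ring) U) {V : X.Opens}
    (h : V ≤ U) (b : B.ring.obj.obj (op V)) (x : P.val.obj (op V)) :
    ev γ h (b • x) = b * ev γ h x :=
  map_smul (γ.1 ⟨V, h⟩) b x

lemma ev_res {U : X.Opens} (γ : localHom P (SheafOfModules.unit B.ring) U) {V W : X.Opens}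
    (h : V ≤ U) (h' : W ≤ V) (x : P.val.obj (op V)) :
    ev γ (h'.trans h) (res P h' x) = B.ring.obj.map (homOfLE h').op (ev γ h x) :=
  localHom_res γ h h' x

/-- Sections `p i` of `P` and `φ i` of its dual over `U` with `∑ φ i(x) • p i = x`. -/
structure DualBasis (P : SheafOfModules.{u} B.ring) (U : X.Opens) where
  /-- the number of sections -/
  n : ℕ
  /-- generators -/
  p : Fin n → P.val.obj (op U)
  /-- coordinates -/
  φ : Fin n → localHom P (SheafOfModules.unit B.ring) U
  sum_eq : ∀ (V : X.Opens) (h : V ≤ U) (x : P.val.obj (op V)),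
    ∑ i, ev (φ i) h x • res P h (p i) = x

/-- The restriction of a dual basis. -/
def DualBasis.restrict {U W : X.Opens} (d : DualBasis P U) (hW : W ≤ U) : DualBasis P W where
  n := d.n
  p i := res P hW (d.p i)
  φ i := localHomRes _ _ hW (d.φ i)
  sum_eq V h x := by
    simp only [res_res]
    exact d.sum_eq V (h.trans hW) x

lemma DualBasis.apply_eq {U : X.Opens} (d : DualBasis P U) (ψ : localHom P N U) {V : X.Opens}
    (h : V ≤ U) (x : P.val.obj (op V)) :
    ψ.1 ⟨V, h⟩ x = ∑ i, ev (d.φ i) h x • res N h (ψ.1 ⟨U, le_rfl⟩ (d.p i)) := by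
  conv_lhs => rw [← d.sum_eq V h x]
  rw [map_sum]
  refine Finset.sum_congr rfl fun i _ => ?_
  rw [map_smul, ← localHom_res]

lemma DualBasis.hom_ext {U : X.Opens} (d : DualBasis P U) {ψ ψ' : localHom P N U}
    (h : ∀ i, ψ.1 ⟨U, le_rfl⟩ (d.p i) = ψ'.1 ⟨U, le_rfl⟩ (d.p i)) : ψ = ψ' := by
  refine localHom_ext fun V m => ?_
  rw [d.apply_eq ψ V.2, d.apply_eq ψ' V.2]
  simp only [h]

/-- The local homomorphism with matrix entries `m i`. -/
def DualBasis.mkHom {U : X.Opens} (d : DualBasis P U) (m : Fin d.n → N.val.obj (op U)) :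
    localHom P N U :=
  ⟨fun V =>
    { toFun x := ∑ i, ev (d.φ i) V.2 x • res N V.2 (m i)
      map_add' x y := by simp only [ev_add, add_smul, Finset.sum_add_distrib]
      map_smul' b x := by
        simp only [ev_smul, mul_smul, RingHom.id_apply, Finset.smul_sum] },
    fun V W h x => by
      change ∑ i, ev (d.φ i) W.2 (res P h x) • res N W.2 (m i) =
        res N h (∑ i, ev (d.φ i) V.2 x • res N V.2 (m i))
      rw [map_sum]
      refine Finset.sum_congr rfl fun i _ => ?_
      rw [res_smul, res_res, ← ev_res]⟩

lemma DualBasis.mkHom_apply {U : X.Opens} (d : DualBasis P U) (m : Fin d.n → N.val.obj (op U))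
    {V : X.Opens} (h : V ≤ U) (x : P.val.obj (op V)) :
    (d.mkHom m).1 ⟨V, h⟩ x = ∑ i, ev (d.φ i) h x • res N h (m i) := rfl

/-- `P(U)` is a direct summand of some `B(U)^n`. The coordinate forms on `P(U)` extend to local
homomorphisms by `topHom_surjective`. -/
lemma exists_dualBasis (hB : B.IsNCScheme) (hP : B.qcoh P) {U : X.Opens} (hU : IsAffineOpen U)
    [Module.Finite (B.ring.obj.obj (op U)) (P.val.obj (op U))]
    [Module.Projective (B.ring.obj.obj (op U)) (P.val.obj (op U))] :
    Nonempty (DualBasis P U) := by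
  obtain ⟨n, f, g, hf, hg, hfg⟩ := Module.Finite.exists_comp_eq_id_of_projective
    (B.ring.obj.obj (op U)) (P.val.obj (op U))
  have hs := topHom_surjective (N := SheafOfModules.unit B.ring) hB hU (hP.locAt hU)
  choose φ hφ using fun i => hs ((LinearMap.proj i).comp g)
  let p : Fin n → P.val.obj (op U) := fun i => f (Pi.single i 1)
  have hsum : ∀ x, ∑ i, ev (φ i) le_rfl x • p i = x := fun x => by
    have h1 : f (g x) = x := LinearMap.congr_fun hfg x
    conv_rhs => rw [← h1, pi_eq_sum_univ (g x), map_sum]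
    refine Finset.sum_congr rfl fun i _ => ?_
    rw [map_smul]
    congr 1
    · exact LinearMap.congr_fun (hφ i) x
    · exact congrArg f (funext fun j => by simp [Pi.single_apply, eq_comm])
  let ψ : localHom P P U := ⟨fun V =>
    { toFun x := ∑ i, ev (φ i) V.2 x • res P V.2 (p i)
      map_add' x y := by simp only [ev_add, add_smul, Finset.sum_add_distrib]
      map_smul' b x := by
        simp only [ev_smul, mul_smul, RingHom.id_apply, Finset.smul_sum] },
    fun V W h x => by
      change ∑ i, ev (φ i) W.2 (res P h x) • res P W.2 (p i) =
        res P h (∑ i, ev (φ i) V.2 x • res P V.2 (p i))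
      rw [map_sum]
      refine Finset.sum_congr rfl fun i _ => ?_
      rw [res_smul, res_res, ← ev_res]⟩
  let ψ' : localHom P P U := ⟨fun V => LinearMap.id, fun V W h x => rfl⟩
  -- The expansion `x = ∑ φ i(x) • p i` says that two local endomorphisms are equal, so it spreads
  -- from `U` to all smaller opens.
  have h : ψ = ψ' := topHom_injective hU (hP.locAt hU) (LinearMap.ext fun x => by
    change ∑ i, ev (φ i) le_rfl x • res P le_rfl (p i) = x
    simp only [res_self]
    exact hsum x)
  exact ⟨⟨n, p, φ, fun V hV x => congrArg (fun ψ : localHom P P U => ψ.1 ⟨V, hV⟩ x) h⟩⟩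

lemma IsLocallyFGProjective.exists_dualBasis (h : B.IsLocallyFGProjective P) (hB : B.IsNCScheme)
    (hP : B.qcoh P) {V : X.Opens} {x : X} (hx : x ∈ V) :
    ∃ (W : X.Opens) (_ : W ≤ V), x ∈ W ∧ IsAffineOpen W ∧ Nonempty (DualBasis P W) := by
  obtain ⟨U, hxU, hU, h1, h2⟩ := h x
  obtain ⟨d⟩ := AlgebraSheaf.exists_dualBasis hB hP hU
  obtain ⟨f, hf, hxf⟩ := exists_basicOpen_le hU hxU hx
  exact ⟨X.basicOpen f, hf, hxf, hU.basicOpen f, ⟨d.restrict (X.basicOpen_le f)⟩⟩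

end DualBasis

section Hom

variable (P N : SheafOfModules.{u} B.ring)

lemma hom_sc_apply {U : X.Opens} (f : Γ(X, U)) (ψ : localHom P N U) {V : X.Opens} (h : V ≤ U)
    (x : P.val.obj (op V)) :
    (show localHom P N U from (B.minor P).sc U f •
      (show ((B.homSheaf P).obj N).val.obj (op U) from ψ)).1 ⟨V, h⟩ x =
        B.sc V (rs h f) • ψ.1 ⟨V, h⟩ x :=
  map_smul (ψ.1 ⟨V, h⟩) (B.sc V (rs h f)) x

variable {P N}

/-- A homomorphism from `P` is determined by its values on the finitely many `p i`, and any values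
over `D(f)` that extend to `U` are interpolated by `mkHom`. So fractions and torsion are those of
`N`, with a common exponent. -/
lemma DualBasis.locAt_hom {U : X.Opens} (d : DualBasis P U) (hN : B.LocAt N.val U) :
    (B.minor P).LocAt ((B.homSheaf P).obj N).val U := by
  refine fun f => ⟨fun (ψ : localHom P N U) hψ => ?_,
    fun (ψ' : localHom P N (X.basicOpen f)) => ?_⟩
  · have hψ' : localHomRes P N (X.basicOpen_le f) ψ = 0 := hψ
    obtain ⟨k, hk⟩ := hN.exists_forall_smul_eq_zero f (fun i => ψ.1 ⟨U, le_rfl⟩ (d.p i)) (fun i => by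
      refine (localHom_res ψ le_rfl (X.basicOpen_le f) _).symm.trans ?_
      exact congrArg (fun ψ : localHom P N (X.basicOpen f) => ψ.1 ⟨_, le_rfl⟩
        (res P (X.basicOpen_le f) (d.p i))) hψ')
    refine ⟨k, d.hom_ext fun i => ?_⟩
    rw [hom_sc_apply]
    refine Eq.trans ?_ (hk i)
    rw [rs_self]
  · obtain ⟨k, m, hm⟩ := hN.exists_forall_pres_eq f
      (fun i => ψ'.1 ⟨_, le_rfl⟩ (res P (X.basicOpen_le f) (d.p i)))
    refine ⟨k, d.mkHom m, localHom_ext fun V x => ?_⟩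
    refine Eq.trans ?_ (hom_sc_apply P N _ ψ' V.2 x).symm
    refine (d.mkHom_apply m (V.2.trans (X.basicOpen_le f)) x).trans ?_
    rw [(d.restrict (X.basicOpen_le f)).apply_eq ψ' V.2 x, Finset.smul_sum]
    refine Finset.sum_congr rfl fun i _ => ?_
    rw [sc_smul_comm]
    congr 1
    refine (res_res N (X.basicOpen_le f) V.2 _).symm.trans ?_
    exact (congrArg (res N V.2) (hm i)).trans (res_sc N V.2 _ _)

/-- `(End P)ᵒᵖ` and `Hom(P, P)` have the same sections and the same action of functions; only the
wrapping in the opposite ring differs. -/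
lemma locAt_minor {U : X.Opens} (h : (B.minor P).LocAt ((B.homSheaf P).obj P).val U) :
    (B.minor P).LocAt (SheafOfModules.unit (B.minor P).ring).val U := by
  refine fun f => ⟨fun (a : (localEnd P U)ᵐᵒᵖ) ha => ?_,
    fun (a' : (localEnd P (X.basicOpen f))ᵐᵒᵖ) => ?_⟩
  · obtain ⟨k, hk⟩ := (h f).1 (show localHom P P U from a.unop)
      (Subtype.ext (congrArg (fun b : (localEnd P (X.basicOpen f))ᵐᵒᵖ => b.unop.1) ha))
    exact ⟨k, MulOpposite.unop_injective (Subtype.ext (congrArg Subtype.val hk))⟩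
  · obtain ⟨k, m, hm⟩ := (h f).2 (show localHom P P (X.basicOpen f) from a'.unop)
    exact ⟨k, MulOpposite.op (show localEnd P U from m),
      MulOpposite.unop_injective (Subtype.ext (congrArg Subtype.val hm))⟩

lemma qcoh_hom (hB : B.IsNCScheme) (hP : B.qcoh P) (h : B.IsLocallyFGProjective P) (hN : B.qcoh N) : (B.minor P).qcoh ((B.homSheaf P).obj N) := by
  refine qcoh_of_locAt fun x => ?_
  obtain ⟨W, -, hx, hW, ⟨d⟩⟩ := h.exists_dualBasis hB hP (V := ⊤) (x := x) trivial
  exact ⟨W, hx, hW, d.locAt_hom (hN.locAt hW)⟩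

lemma isNCScheme_minor (hB : B.IsNCScheme) (hP : B.qcoh P) (h : B.IsLocallyFGProjective P) : (B.minor P).IsNCScheme :=
  qcoh_iff.2 fun _ hU => locAt_minor ((qcoh_hom hB hP h hP).locAt hU)

end Hom

end AlgebraSheaf

/-! ### Quasi-coherence of `P ⊗_A N` -/

/-- Bilinear maps that are balanced over a set of operators extend to localizations. -/
lemma IsLocalizedModule.exists_balanced_lift {O : Type*} [CommRing O] (f : O)
    {M N M' N' L A A' : Type u} [AddCommGroup M] [AddCommGroup N] [AddCommGroup M'] [AddCommGroup N']
    [AddCommGroup L] [Module O M] [Module O N] [Module O M'] [Module O N'] [Module O L]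
    (ρM : M →ₗ[O] M') [IsLocalizedModule (Submonoid.powers f) ρM]
    (ρN : N →ₗ[O] N') [IsLocalizedModule (Submonoid.powers f) ρN]
    (aM : A → M →ₗ[O] M) (aN : A → N →ₗ[O] N) (aM' : A' → M' →ₗ[O] M') (aN' : A' → N' →ₗ[O] N')
    (hA : ∀ a', ∃ (k : ℕ) (a : A), (∀ m, f ^ k • aM' a' (ρM m) = ρM (aM a m)) ∧
      ∀ n, f ^ k • aN' a' (ρN n) = ρN (aN a n))
    (hL : IsUnit (algebraMap O (Module.End O L) f)) (β : M →ₗ[O] N →ₗ[O] L)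
    (hβ : ∀ a m n, β (aM a m) n = β m (aN a n)) :
    ∃ β' : M' →ₗ[O] N' →ₗ[O] L, (∀ m n, β' (ρM m) (ρN n) = β m n) ∧
      ∀ a m n, β' (aM' a m) n = β' m (aN' a n) := by
  -- Since `f` is invertible on `L`, it is invertible on homomorphisms into `L`; so `β` can be
  -- extended in one variable at a time.
  have hu : ∀ (Q : Type u) [AddCommGroup Q] [Module O Q],
      ∀ x : Submonoid.powers f, IsUnit (algebraMap O (Module.End O (Q →ₗ[O] L)) x) := by
    rintro Q _ _ ⟨_, k, rfl⟩
    obtain ⟨g, hg⟩ := hL.pow k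
    rw [← map_pow] at hg
    refine (Module.End.isUnit_iff _).2 ⟨fun φ ψ h => LinearMap.ext fun q => ?_, fun φ => ?_⟩
    · have h1 : f ^ k • φ q = f ^ k • ψ q := LinearMap.congr_fun h q
      exact ((Module.End.isUnit_iff _).1 (hg ▸ g.isUnit)).1 h1
    · refine ⟨(g⁻¹).1.comp φ, LinearMap.ext fun q => ?_⟩
      change (algebraMap O (Module.End O L) (f ^ k)) ((g⁻¹).1 (φ q)) = φ q
      rw [← hg]
      exact LinearMap.congr_fun g.mul_inv (φ q)
  let β₁ : M' →ₗ[O] N →ₗ[O] L := IsLocalizedModule.lift (Submonoid.powers f) ρM β (hu N)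
  have h₁ : ∀ m, β₁ (ρM m) = β m := IsLocalizedModule.lift_apply (Submonoid.powers f) ρM β (hu N)
  let β₂ : N' →ₗ[O] M' →ₗ[O] L := IsLocalizedModule.lift (Submonoid.powers f) ρN β₁.flip (hu M')
  have h₂ : ∀ n, β₂ (ρN n) = β₁.flip n :=
    IsLocalizedModule.lift_apply (Submonoid.powers f) ρN β₁.flip (hu M')
  have h₃ : ∀ m n, β₂ (ρN n) (ρM m) = β m n := fun m n => by
    rw [h₂, LinearMap.flip_apply, h₁]
  refine ⟨β₂.flip, fun m n => h₃ m n, fun a' m' n' => ?_⟩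
  obtain ⟨k, a, ha, hb⟩ := hA a'
  obtain ⟨⟨m, ⟨_, i, rfl⟩⟩, hm⟩ := IsLocalizedModule.surj (Submonoid.powers f) ρM m'
  obtain ⟨⟨n, ⟨_, j, rfl⟩⟩, hn⟩ := IsLocalizedModule.surj (Submonoid.powers f) ρN n'
  change f ^ i • m' = ρM m at hm
  change f ^ j • n' = ρN n at hn
  -- Balancedness is checked after multiplication by `f ^ (k + i + j)`, which is invertible on `L`
  -- and clears the denominators of `a'`, `m'` and `n'` at once.
  refine ((Module.End.isUnit_iff _).1 ((hL.pow k).mul ((hL.pow i).mul (hL.pow j)))).1 ?_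
  rw [← map_pow, ← map_pow, ← map_pow, ← map_mul, ← map_mul]
  change (f ^ k * (f ^ i * f ^ j)) • β₂ n' (aM' a' m') = (f ^ k * (f ^ i * f ^ j)) • β₂ (aN' a' n') m'
  have e1 : (f ^ k * (f ^ i * f ^ j)) • β₂ n' (aM' a' m') =
      β₂ (f ^ j • n') (f ^ k • aM' a' (f ^ i • m')) := by
    simp only [map_smul, LinearMap.smul_apply, smul_smul]
    congr 1; ring
  have e2 : (f ^ k * (f ^ i * f ^ j)) • β₂ (aN' a' n') m' =
      β₂ (f ^ k • aN' a' (f ^ j • n')) (f ^ i • m') := by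
    simp only [map_smul, LinearMap.smul_apply, smul_smul]
    congr 1; ring
  rw [e1, e2, hm, hn, ha, hb, h₃, h₃, hβ]

lemma exists_localizedModule {O : Type u} [CommRing O] (f : O) (T : Type u) [AddCommGroup T]
    [Module O T] : ∃ (L : Type u) (_ : AddCommGroup L) (_ : Module O L) (mk : T →ₗ[O] L),
      IsUnit (algebraMap O (Module.End O L) f) ∧ ∀ t, mk t = 0 → ∃ k : ℕ, f ^ k • t = 0 := by
  refine ⟨LocalizedModule (Submonoid.powers f) T, inferInstance, inferInstance,
    LocalizedModule.mkLinearMap (Submonoid.powers f) T, IsLocalizedModule.map_units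
    (LocalizedModule.mkLinearMap (Submonoid.powers f) T) ⟨f, Submonoid.mem_powers f⟩,
    fun t ht => ?_⟩
  obtain ⟨⟨_, k, rfl⟩, hk⟩ := (IsLocalizedModule.eq_zero_iff (Submonoid.powers f) _).1 ht
  exact ⟨k, hk⟩

namespace NCSheaf

variable {X : TopCat.{u}} {R : Sheaf (Opens.grothendieckTopology X) RingCat.{u}}

/-- Additive maps out of the tensor product. -/
lemma exists_tensorLift (M : SheafOfModules.{u} R) (N : SheafOfModules.{u} (endOp M))
    (U : (Opens X)ᵒᵖ) {T : Type u} [AddCommGroup T] (f : M.val.obj U →+ N.val.obj U →+ T)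
    (hf' : ∀ (a : (endOp M).obj.obj U) p n, f (rightAct M U a p) n = f p (a • n)) :
    ∃ g : TensorSections M N U →+ T, ∀ p n, g (tmul M N U p n) = f p n := by
  have hz : ∀ (z : ℤ) p n, f (z • p) n = f p (z • n) := fun z p n => by
    rw [map_zsmul, map_zsmul, AddMonoidHom.zsmul_apply]
  let g := TensorProduct.liftAddHom f hz
  -- The relations are spanned over `R(U)` while `g` is only additive; the induction therefore
  -- proves vanishing on all multiples `r • t`, using that `A` acts `R`-linearly on `M`.
  have h0 : ∀ t ∈ tensorRel M N U, ∀ r : R.obj.obj U, g (r • t) = 0 := by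
    intro t ht
    induction ht using Submodule.span_induction with
    | zero => intro r; rw [smul_zero, map_zero]
    | add x y _ _ hx hy => intro r; rw [smul_add, map_add, hx, hy, add_zero]
    | smul s x _ hx => intro r; rw [smul_smul]; exact hx _
    | mem x hx =>
      obtain ⟨p, a, n, rfl⟩ := hx
      intro r
      rw [smul_sub, map_sub, sub_eq_zero]
      change f (r • rightAct M U a p) n = f (r • p) (a • n)
      rw [← map_smul, hf']
  exact ⟨QuotientAddGroup.lift (tensorRel M N U).toAddSubgroup g fun t ht => by
    simpa using h0 t ht 1, fun p n => rfl⟩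

lemma tensor_induction {M : SheafOfModules.{u} R} {N : SheafOfModules.{u} (endOp M)}
    {U : (Opens X)ᵒᵖ} {p : TensorSections M N U → Prop} (t : TensorSections M N U) (h0 : p 0)
    (h1 : ∀ m n, p (tmul M N U m n)) (h2 : ∀ x y, p x → p y → p (x + y)) : p t := by
  obtain ⟨t, rfl⟩ := Submodule.Quotient.mk_surjective _ t
  induction t with
  | zero => exact h0
  | tmul m n => exact h1 m n
  | add x y hx hy => exact h2 _ _ hx hy

end NCSheaf

namespace AlgebraSheaf
open NCSheaf
variable {X : Scheme.{u}} {B : AlgebraSheaf X}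

lemma LocAt.isLocalizedModule {T : PresheafOfModules.{u} B.ring.obj} {U : X.Opens}
    (h : B.LocAt T U) (f : Γ(X, U)) :
    letI : Module Γ(X, U) (T.obj (op U)) := Module.compHom _ (B.sc U)
    letI : Module Γ(X, U) (T.obj (op (X.basicOpen f))) :=
      Module.compHom _ ((B.sc _).comp (rs (X.basicOpen_le f)))
    ∃ ρ : T.obj (op U) →ₗ[Γ(X, U)] T.obj (op (X.basicOpen f)),
      (∀ t, ρ t = pres T (X.basicOpen_le f) t) ∧
        IsLocalizedModule (Submonoid.powers f) ρ := by
  let : Module Γ(X, U) (T.obj (op U)) := Module.compHom _ (B.sc U)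
  let : Module Γ(X, U) (T.obj (op (X.basicOpen f))) :=
    Module.compHom _ ((B.sc _).comp (rs (X.basicOpen_le f)))
  refine ⟨⟨⟨pres T (X.basicOpen_le f), map_add _⟩, fun r t => pres_sc T _ r t⟩, fun _ => rfl, ?_⟩
  refine ⟨?_, fun m' => ?_, fun {x y} hxy => ?_⟩
  · rintro ⟨_, k, rfl⟩
    have hu : IsUnit (rs (X.basicOpen_le f) (f ^ k)) := by
      rw [map_pow]; exact (isUnit_rs (le_refl (X.basicOpen f))).pow k
    exact (Module.End.isUnit_iff _).2 ⟨fun x y hxy => sc_smul_injective T hu hxy,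
      exists_sc_smul_eq T hu⟩
  · obtain ⟨k, m, hm⟩ := (h f).2 m'
    exact ⟨⟨m, ⟨_, k, rfl⟩⟩, hm.symm⟩
  · obtain ⟨k, hk⟩ := (h f).1 (x - y) ((map_sub _ _ _).trans (sub_eq_zero.2 hxy))
    exact ⟨⟨_, k, rfl⟩, sub_eq_zero.1 ((smul_sub _ _ _).symm.trans hk)⟩

section Tensor

variable {P : SheafOfModules.{u} B.ring} {N : SheafOfModules.{u} (B.minor P).ring} {U : X.Opens}

/-- A function acts on `P` by the same operator whether it is read in `B` or in `A`, so it crosses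
the tensor sign. -/
lemma tmul_sc (f : Γ(X, U)) (p : P.val.obj (op U)) (n : N.val.obj (op U)) :
    tmul P N (op U) p ((B.minor P).sc U f • n) = B.sc U f • tmul P N (op U) p n := by
  refine (tmul_rel P N (op U) p ((B.minor P).sc U f) n).symm.trans ?_
  refine congrArg (fun q => tmul P N (op U) q n) ?_
  change B.sc U (rs le_rfl f) • p = _
  rw [rs_self]

lemma tensorRes_sc (f : Γ(X, U)) {V : X.Opens} (h : V ≤ U) (t : TensorSections P N (op U)) :
    tensorRes P N (homOfLE h).op (B.sc U f • t) = B.sc V (rs h f) • tensorRes P N (homOfLE h).op t :=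
  pres_sc (tensorPresheaf P N) h f t

lemma rightAct_sc_mul (f : Γ(X, U)) (a : (B.minor P).ring.obj.obj (op U)) (p : P.val.obj (op U)) :
    rightAct P (op U) ((B.minor P).sc U f * a) p = B.sc U f • rightAct P (op U) a p := by
  refine (map_smul (rightAct P (op U) a) (B.sc U (rs le_rfl f)) p).trans ?_
  rw [rs_self]

lemma rightAct_res {V : X.Opens} (h : V ≤ U) (a : (B.minor P).ring.obj.obj (op U))
    (p : P.val.obj (op U)) :
    rightAct P (op V) ((B.minor P).ring.obj.map (homOfLE h).op a) (res P h p) =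
      res P h (rightAct P (op U) a p) :=
  localHom_res (show localHom P P U from (show (localEnd P U)ᵐᵒᵖ from a).unop) le_rfl h p

/-- `L` is the localization of the sections over `U` at `f`. The modules `P(D(f))`, `N(D(f))` and
the ring `A(D(f))` are localizations as well, so the balanced pairing into `L` extends to sections
over `D(f)`. A tensor that vanishes on `D(f)` then vanishes in `L`, so a power of `f` kills it. -/
lemma exists_tensor_localization (hP : B.LocAt P.val U) (hN : (B.minor P).LocAt N.val U)
    (hA : (B.minor P).LocAt (SheafOfModules.unit (B.minor P).ring).val U) (f : Γ(X, U)) :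
    ∃ (L : Type u) (_ : AddCommGroup L) (mk : TensorSections P N (op U) →+ L)
      (g : TensorSections P N (op (X.basicOpen f)) →+ L),
      (∀ t, g (tensorRes P N (homOfLE (X.basicOpen_le f)).op t) = mk t) ∧
        ∀ t, mk t = 0 → ∃ k : ℕ, B.sc U (f ^ k) • t = 0 := by
  let m1 : Module Γ(X, U) (P.val.obj (op U)) := Module.compHom _ (B.sc U)
  let m2 : Module Γ(X, U) (P.val.obj (op (X.basicOpen f))) :=
    Module.compHom _ ((B.sc _).comp (rs (X.basicOpen_le f)))
  let m3 : Module Γ(X, U) (N.val.obj (op U)) := Module.compHom _ ((B.minor P).sc U)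
  let m4 : Module Γ(X, U) (N.val.obj (op (X.basicOpen f))) :=
    Module.compHom _ (((B.minor P).sc _).comp (rs (X.basicOpen_le f)))
  let m5 : Module Γ(X, U) (TensorSections P N (op U)) := Module.compHom _ (B.sc U)
  obtain ⟨ρP, hρP, iP⟩ := hP.isLocalizedModule f
  obtain ⟨ρN, hρN, iN⟩ := hN.isLocalizedModule f
  obtain ⟨L, _, _, mk, hL, hmk⟩ := exists_localizedModule f (TensorSections P N (op U))
  let β : P.val.obj (op U) →ₗ[Γ(X, U)] N.val.obj (op U) →ₗ[Γ(X, U)] L :=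
    LinearMap.mk₂ Γ(X, U) (fun p n => mk (tmul P N (op U) p n))
      (fun p p' n => (congrArg mk (tmul_add_left P N (op U) p p' n)).trans (map_add mk _ _))
      (fun r p n => map_smul mk r (tmul P N (op U) p n))
      (fun p n n' => (congrArg mk (tmul_add_right P N (op U) p n n')).trans (map_add mk _ _))
      (fun r p n => (congrArg mk (tmul_sc r p n)).trans (map_smul mk r _))
  obtain ⟨β', hβ₁, hβ₂⟩ := IsLocalizedModule.exists_balanced_lift f ρP ρN
    (A := (B.minor P).ring.obj.obj (op U)) (A' := (B.minor P).ring.obj.obj (op (X.basicOpen f)))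
    (fun a => ⟨⟨rightAct P _ a, map_add _⟩, fun r p => map_smul (rightAct P _ a) (B.sc U r) p⟩)
    (fun a => ⟨⟨fun n => a • n, smul_add a⟩, fun r n => (sc_smul_comm N.val r a n).symm⟩)
    (fun a => ⟨⟨rightAct P _ a, map_add _⟩,
      fun r p => map_smul (rightAct P _ a) (B.sc _ (rs (X.basicOpen_le f) r)) p⟩)
    (fun a => ⟨⟨fun n => a • n, smul_add a⟩,
      fun r n => (sc_smul_comm N.val (rs (X.basicOpen_le f) r) a n).symm⟩)
    (fun a' => by
      obtain ⟨k, (a : (B.minor P).ring.obj.obj (op U)), ha⟩ := (hA f).2 a'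
      have ha' : (B.minor P).ring.obj.map (homOfLE (X.basicOpen_le f)).op a =
        (B.minor P).sc _ (rs (X.basicOpen_le f) (f ^ k)) * a' := ha
      refine ⟨k, a, fun m => ?_, fun (n : N.val.obj (op U)) => ?_⟩
      · change B.sc _ (rs (X.basicOpen_le f) (f ^ k)) • rightAct P _ a' (ρP m) =
          ρP (rightAct P _ a m)
        rw [hρP, hρP]
        refine (rightAct_sc_mul _ _ _).symm.trans ?_
        exact (congrArg (fun b => rightAct P _ b _) ha'.symm).trans (rightAct_res _ _ _)
      · change (B.minor P).sc _ (rs (X.basicOpen_le f) (f ^ k)) • a' • ρN n = ρN (a • n)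
        rw [hρN, hρN, ← mul_smul, pres_smul, ha'])
    hL β
    (fun a p n => congrArg mk (tmul_rel P N (op U) p a n))
  obtain ⟨g, hg⟩ := exists_tensorLift P N (op (X.basicOpen f))
    (AddMonoidHom.mk' (fun p => (β' p).toAddMonoidHom)
      (fun p p' => AddMonoidHom.ext fun n => LinearMap.congr_fun (map_add β' p p') n)) hβ₂
  refine ⟨L, inferInstance, mk.toAddMonoidHom, g, fun t => ?_, hmk⟩
  induction t using tensor_induction with
  | h0 => rw [map_zero, map_zero, map_zero]
  | h1 p n =>
    refine (congrArg g (tensorRes_tmul P N _ p n)).trans ((hg _ _).trans ?_)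
    refine Eq.trans ?_ (hβ₁ p n)
    rw [hρP, hρN]
    rfl
  | h2 x y hx hy => rw [map_add, map_add, map_add, hx, hy]

/-- The torsion half is `exists_tensor_localization`; for the fraction half, denominators of the two
factors multiply, and those of a sum are made common. -/
lemma locAt_tensorPresheaf (hP : B.LocAt P.val U) (hN : (B.minor P).LocAt N.val U)
    (hA : (B.minor P).LocAt (SheafOfModules.unit (B.minor P).ring).val U) :
    B.LocAt (tensorPresheaf P N) U := by
  refine fun f => ⟨fun (t : TensorSections P N (op U)) ht => ?_,
    fun (t' : TensorSections P N (op (X.basicOpen f))) => ?_⟩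
  · obtain ⟨L, _, mk, g, h1, h2⟩ := exists_tensor_localization hP hN hA f
    exact h2 t (by rw [← h1]; exact (congrArg g ht).trans (map_zero g))
  · suffices h : ∃ (k : ℕ) (t : TensorSections P N (op U)),
        tensorRes P N (homOfLE (X.basicOpen_le f)).op t =
          B.sc _ (rs (X.basicOpen_le f) (f ^ k)) • t' from h
    induction t' using tensor_induction with
    | h0 => exact ⟨0, 0, by rw [map_zero, smul_zero]⟩
    | h1 p' n' =>
      obtain ⟨k, p, hp⟩ := (hP f).2 p'
      obtain ⟨l, n, hn⟩ := (hN f).2 n'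
      refine ⟨k + l, tmul P N (op U) p n, ?_⟩
      refine (tensorRes_tmul P N _ p n).trans ?_
      refine (congrArg₂ (tmul P N _) hp hn).trans ?_
      refine (tmul_sc _ _ _).trans ?_
      rw [add_comm, pow_add, map_mul]
      exact (sc_mul_smul (tensorPresheaf P N) _ _ (tmul P N (op (X.basicOpen f)) p' n')).symm
    | h2 x y hx hy =>
      obtain ⟨k, t, ht⟩ := hx
      obtain ⟨l, t', ht'⟩ := hy
      refine ⟨k + l, B.sc U (f ^ l) • t + B.sc U (f ^ k) • t', ?_⟩
      rw [map_add, tensorRes_sc, tensorRes_sc, ht, ht', smul_add]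
      congr 1
      · rw [add_comm, pow_add, map_mul]
        exact (sc_mul_smul (tensorPresheaf P N) _ _ x).symm
      · rw [pow_add, map_mul]
        exact (sc_mul_smul (tensorPresheaf P N) _ _ y).symm

lemma qcoh_tensor (hP : B.qcoh P) (hA : (B.minor P).IsNCScheme) (hN : (B.minor P).qcoh N) :
    B.qcoh ((B.tensorSheaf P).obj N) :=
  qcoh_iff.2 fun _ hU => (locSurj_toSheafif (tensorPresheaf P N)).locAt (locInj_toSheafif _)
    (fun _ _ hV => locAt_tensorPresheaf (hP.locAt hV) (hN.locAt hV) (hA.locAt hV)) hU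

end Tensor

end AlgebraSheaf

/-! ### The adjunction `P ⊗_A - ⊣ Hom_B(P, -)` and its unit -/

namespace AlgebraSheaf
open NCSheaf
variable {X : Scheme.{u}} {B : AlgebraSheaf X}

lemma toSheafif_bijective (T : PresheafOfModules.{u} B.ring.obj) (M : SheafOfModules.{u} B.ring) :
    Function.Bijective fun f : sheafif T ⟶ M => toSheafif T ≫ f.val := by
  refine ⟨fun f g h => sheafif_hom_ext h, fun θ => ?_⟩
  let adj := PresheafOfModules.sheafificationAdjunction (𝟙 B.ring.obj)
  -- The sheafification adjunction has targets with scalars restricted along the identity; `θ'` is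
  -- `θ` read with such a target.
  let θ' : T ⟶ ((SheafOfModules.forget B.ring) ⋙
      PresheafOfModules.restrictScalars (𝟙 B.ring.obj)).obj M :=
    PresheafOfModules.homMk ((PresheafOfModules.toPresheaf _).map θ)
      fun U r t => (θ.app U).hom.map_smul r t
  refine ⟨(adj.homEquiv T M).symm θ', PresheafOfModules.hom_ext fun U => ModuleCat.hom_ext
    (LinearMap.ext fun t => ?_)⟩
  exact congrArg (fun φ => φ.app U t) ((adj.homEquiv T M).apply_symm_apply θ')

/-- Maps out of the associated sheaf. -/
def sheafifEquiv (T : PresheafOfModules.{u} B.ring.obj) (M : SheafOfModules.{u} B.ring) :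
    (sheafif T ⟶ M) ≃ (T ⟶ M.val) := Equiv.ofBijective _ (toSheafif_bijective T M)

lemma toSheafif_naturality {T T' : PresheafOfModules.{u} B.ring.obj} (f : T ⟶ T') :
    toSheafif T ≫ ((PresheafOfModules.sheafification (𝟙 B.ring.obj)).map f).val =
      f ≫ toSheafif T' := by
  refine PresheafOfModules.hom_ext fun U => ModuleCat.hom_ext (LinearMap.ext fun t => ?_)
  exact (congrArg (fun φ => φ.app U t)
    ((PresheafOfModules.sheafificationAdjunction (𝟙 B.ring.obj)).unit.naturality f)).symm

section

variable (P : SheafOfModules.{u} B.ring) (N : SheafOfModules.{u} (B.minor P).ring)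
  (M : SheafOfModules.{u} B.ring)

/-- The morphism `N ⟶ Hom(P, M)` corresponding to a balanced pairing. -/
def curry (θ : tensorPresheaf P N ⟶ M.val) : N ⟶ (B.homSheaf P).obj M where
  val := PresheafOfModules.homMk
    { app U := AddCommGrpCat.ofHom
        { toFun n := (⟨fun V =>
            { toFun p := θ.app (op V.1) (tmul P N (op V.1) p (res N V.2 n))
              map_add' p p' := (congrArg (θ.app (op V.1)) (tmul_add_left P N _ p p' _)).trans
                (map_add (θ.app (op V.1)).hom _ _)
              map_smul' b p := (θ.app (op V.1)).hom.map_smul b (tmul P N (op V.1) p (res N V.2 n)) },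
            fun V W h p => by
              refine Eq.trans ?_ (app_pres θ h (tmul P N (op V.1) p (res N V.2 n)))
              refine congrArg (θ.app (op W.1)) ?_
              refine Eq.trans ?_ (tensorRes_tmul P N (homOfLE h).op p (res N V.2 n)).symm
              exact congrArg (tmul P N (op W.1) _) (res_res N V.2 h n).symm⟩ : localHom P M U.unop)
          map_zero' := localHom_ext fun V p => by
            change θ.app (op V.1) (tmul P N (op V.1) p (res N V.2 0)) = 0
            rw [map_zero]
            exact (congrArg (θ.app (op V.1)) (map_zero (tmulHom P N (op V.1) p))).trans (map_zero _)
          map_add' n n' := localHom_ext fun V p => by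
            change θ.app (op V.1) (tmul P N (op V.1) p (res N V.2 (n + n'))) =
              θ.app (op V.1) (tmul P N (op V.1) p (res N V.2 n)) +
                θ.app (op V.1) (tmul P N (op V.1) p (res N V.2 n'))
            rw [map_add]
            exact (congrArg (θ.app (op V.1)) (tmul_add_right P N (op V.1) p _ _)).trans
              (map_add (θ.app (op V.1)).hom _ _) }
      naturality U U' h := by
        ext n
        refine localHom_ext fun V p => congrArg (fun n' => θ.app (op V.1) (tmul P N (op V.1) p n')) ?_
        exact res_res N h.unop.le V.2 n }
    (fun U a n => localHom_ext fun V p => by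
      refine congrArg (θ.app (op V.1)) ?_
      change tmul P N (op V.1) p (res N V.2 (a • n)) =
        tmul P N (op V.1) (rightAct P (op V.1) ((B.minor P).ring.obj.map (homOfLE V.2).op a) p)
          (res N V.2 n)
      refine Eq.trans ?_ (tmul_rel P N (op V.1) p _ _).symm
      exact congrArg (tmul P N (op V.1) p) (res_smul N V.2 a n))

lemma curry_apply (θ : tensorPresheaf P N ⟶ M.val) (U : X.Opens) (n : N.val.obj (op U))
    (V : {V : X.Opens // V ≤ U}) (p : P.val.obj (op V.1)) :
    (show localHom P M U from (curry P N M θ).val.app (op U) n).1 V p =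
      θ.app (op V.1) (tmul P N (op V.1) p (res N V.2 n)) := rfl

/-- The local homomorphism attached to a section by a morphism to `Hom(P, M)`. -/
def homApp {P : SheafOfModules.{u} B.ring} {N : SheafOfModules.{u} (B.minor P).ring}
    {M : SheafOfModules.{u} B.ring} (h : N ⟶ (B.homSheaf P).obj M) (U : X.Opens)
    (n : N.val.obj (op U)) : localHom P M U :=
  show localHom P M U from h.val.app (op U) n

variable {P N M}

lemma homApp_add (h : N ⟶ (B.homSheaf P).obj M) (U : X.Opens) (n n' : N.val.obj (op U)) :
    homApp h U (n + n') = homApp h U n + homApp h U n' := map_add (h.val.app (op U)).hom n n'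

lemma homApp_smul (h : N ⟶ (B.homSheaf P).obj M) (U : X.Opens)
    (a : (B.minor P).ring.obj.obj (op U)) (n : N.val.obj (op U)) (p : P.val.obj (op U)) :
    (homApp h U (a • n)).1 ⟨U, le_rfl⟩ p =
      (homApp h U n).1 ⟨U, le_rfl⟩ (rightAct P (op U) a p) :=
  congrArg (fun φ : localHom P M U => φ.1 ⟨U, le_rfl⟩ p) ((h.val.app (op U)).hom.map_smul a n)

lemma homApp_res (h : N ⟶ (B.homSheaf P).obj M) {U V : X.Opens} (hV : V ≤ U)
    (n : N.val.obj (op U)) (p : P.val.obj (op V)) :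
    (homApp h V (res N hV n)).1 ⟨V, le_rfl⟩ p = (homApp h U n).1 ⟨V, hV⟩ p :=
  congrArg (fun φ : localHom P M V => φ.1 ⟨V, le_rfl⟩ p) (app_pres h.val hV n)

variable (P N M)

/-- The balanced pairing on sections corresponding to a morphism `N ⟶ Hom(P, M)`. -/
def uncurryApp (h : N ⟶ (B.homSheaf P).obj M) (U : X.Opens) :
    TensorSections P N (op U) →ₗ[B.ring.obj.obj (op U)] M.val.obj (op U) :=
  tensorLift P N (op U) (RingHom.id _)
    (AddMonoidHom.mk' (fun p => AddMonoidHom.mk' (fun n => (homApp h U n).1 ⟨U, le_rfl⟩ p)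
        (fun n n' => congrArg (fun φ : localHom P M U => φ.1 ⟨U, le_rfl⟩ p) (homApp_add h U n n')))
      (fun p p' => AddMonoidHom.ext fun n => map_add ((homApp h U n).1 ⟨U, le_rfl⟩) p p'))
    (fun b p n => map_smul ((homApp h U n).1 ⟨U, le_rfl⟩) b p)
    (fun a p n => (homApp_smul h U a n p).symm)

/-- The balanced pairing corresponding to a morphism `N ⟶ Hom(P, M)`. -/
def uncurry (h : N ⟶ (B.homSheaf P).obj M) : tensorPresheaf P N ⟶ M.val where
  app U := ModuleCat.ofHom (X := TensorSections P N U) (uncurryApp P N M h U.unop)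
  naturality {U V} k := by
    refine ModuleCat.hom_ext (LinearMap.ext fun (t : TensorSections P N U) => ?_)
    change uncurryApp P N M h V.unop (tensorRes P N k t) =
      res M k.unop.le (uncurryApp P N M h U.unop t)
    induction t using tensor_induction with
    | h0 => simp only [map_zero]
    | h1 p n =>
      refine (homApp_res h k.unop.le n _).trans ?_
      exact localHom_res (homApp h U.unop n) le_rfl k.unop.le p
    | h2 x y hx hy => simp only [map_add, hx, hy]

lemma uncurry_app (h : N ⟶ (B.homSheaf P).obj M) (U : X.Opens) (p : P.val.obj (op U))
    (n : N.val.obj (op U)) : (uncurry P N M h).app (op U) (tmul P N (op U) p n) =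
      (homApp h U n).1 ⟨U, le_rfl⟩ p := rfl

variable {P N} in
lemma tensorPresheaf_hom_ext {T : PresheafOfModules.{u} B.ring.obj} {f g : tensorPresheaf P N ⟶ T}
    (h : ∀ (U : X.Opens) (p : P.val.obj (op U)) (n : N.val.obj (op U)),
      f.app (op U) (tmul P N (op U) p n) = g.app (op U) (tmul P N (op U) p n)) : f = g := by
  refine PresheafOfModules.hom_ext fun U => ModuleCat.hom_ext
    (LinearMap.ext fun (t : TensorSections P N U) => ?_)
  induction t using tensor_induction with
  | h0 => exact (map_zero (f.app U).hom).trans (map_zero (g.app U).hom).symm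
  | h1 p n => exact h U.unop p n
  | h2 x y hx hy =>
    exact (map_add (f.app U).hom x y).trans
      ((congrArg₂ (· + ·) hx hy).trans (map_add (g.app U).hom x y).symm)

/-- The adjunction between tensor product and `Hom` on presheaf level. -/
def curryEquiv : (tensorPresheaf P N ⟶ M.val) ≃ (N ⟶ (B.homSheaf P).obj M) where
  toFun := curry P N M
  invFun := uncurry P N M
  left_inv θ := tensorPresheaf_hom_ext fun U p n => by
    refine (uncurry_app P N M _ U p n).trans ?_
    refine (curry_apply P N M θ U n ⟨U, le_rfl⟩ p).trans ?_
    rw [res_self]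
  right_inv h := SheafOfModules.hom_ext (PresheafOfModules.hom_ext fun U => ModuleCat.hom_ext
    (LinearMap.ext fun n => localHom_ext fun V p => homApp_res h V.2 n p))

/-- The adjunction `P ⊗_A - ⊣ Hom_B(P, -)` on sheaves of modules. -/
def tensorHomAdjunction : B.tensorSheaf P ⊣ B.homSheaf P :=
  Adjunction.mkOfHomEquiv
    { homEquiv N M := (sheafifEquiv (tensorPresheaf P N) M).trans (curryEquiv P N M)
      homEquiv_naturality_left_symm {N N' M} f h := by
        refine (Equiv.symm_apply_eq _).2 ?_
        obtain ⟨k, rfl⟩ := ((sheafifEquiv (tensorPresheaf P N') M).trans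
          (curryEquiv P N' M)).surjective h
        refine Eq.trans ?_ (congrArg (fun φ => ((sheafifEquiv (tensorPresheaf P N) M).trans
          (curryEquiv P N M)) ((B.tensorSheaf P).map f ≫ φ)) (Equiv.symm_apply_apply _ k).symm)
        refine SheafOfModules.hom_ext (PresheafOfModules.hom_ext fun U => ModuleCat.hom_ext
          (LinearMap.ext fun n => localHom_ext fun V p => ?_))
        have h1 := congrArg (fun φ => k.val.app (op V.1) (φ.app (op V.1)
          (tmul P N (op V.1) p (res N V.2 n)))) (toSheafif_naturality (tensorPresheafMap P f))
        refine Eq.trans ?_ (h1.symm.trans ?_)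
        · refine congrArg (fun n' => k.val.app (op V.1) ((toSheafif (tensorPresheaf P N')).app
            (op V.1) (tmul P N' (op V.1) p n'))) ?_
          exact (app_pres f.val V.2 n).symm
        · rfl
      homEquiv_naturality_right {N M M'} f g := by
        refine SheafOfModules.hom_ext (PresheafOfModules.hom_ext fun U => ModuleCat.hom_ext
          (LinearMap.ext fun n => localHom_ext fun V p => ?_))
        rfl }

lemma tensorHomAdjunction_unit (U : X.Opens) (n : N.val.obj (op U)) {V : X.Opens} (h : V ≤ U)
    (p : P.val.obj (op V)) :
    (homApp ((B.tensorHomAdjunction P).unit.app N) U n).1 ⟨V, h⟩ p =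
      (toSheafif (tensorPresheaf P N)).app (op V) (tmul P N (op V) p (res N h n)) := by
  have h1 : (B.tensorHomAdjunction P).unit.app N =
      curry P N _ (toSheafif (tensorPresheaf P N)) :=
    (Adjunction.mkOfHomEquiv_unit_app _ _).trans
      (congrArg (curry P N _) (Category.comp_id (toSheafif (tensorPresheaf P N))))
  rw [h1]
  rfl

end

section Unit

variable {P : SheafOfModules.{u} B.ring} {N : SheafOfModules.{u} (B.minor P).ring} {U : X.Opens}

/-- The homomorphism `x ↦ γ(x) • p`. -/
def dualMul {M : SheafOfModules.{u} B.ring} (γ : localHom P (SheafOfModules.unit B.ring) U)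
    (p : M.val.obj (op U)) : localHom P M U :=
  ⟨fun V =>
    { toFun x := ev γ V.2 x • res M V.2 p
      map_add' x y := by rw [ev_add, add_smul]
      map_smul' b x := by rw [ev_smul, mul_smul, RingHom.id_apply] },
    fun V W h x => by
      change ev γ W.2 (res P h x) • res M W.2 p = res M h (ev γ V.2 x • res M V.2 p)
      rw [res_smul, res_res, ← ev_res]⟩

/-- The section `x ↦ γ(x) • p` of `(End P)ᵒᵖ`. -/
def dualMulOp (γ : localHom P (SheafOfModules.unit B.ring) U) (p : P.val.obj (op U)) :
    (B.minor P).ring.obj.obj (op U) := MulOpposite.op (show localEnd P U from dualMul γ p)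

lemma rightAct_dualMulOp (γ : localHom P (SheafOfModules.unit B.ring) U) (p q : P.val.obj (op U)) :
    rightAct P (op U) (dualMulOp γ p) q = ev γ le_rfl q • p := by
  change ev γ le_rfl q • res P le_rfl p = _
  rw [res_self]

lemma dualMulOp_add (γ : localHom P (SheafOfModules.unit B.ring) U) (p q : P.val.obj (op U)) :
    dualMulOp γ (p + q) = dualMulOp γ p + dualMulOp γ q :=
  congrArg MulOpposite.op (Subtype.ext (funext fun V => LinearMap.ext fun x => by
    change ev γ V.2 x • res P V.2 (p + q) = ev γ V.2 x • res P V.2 p + ev γ V.2 x • res P V.2 q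
    rw [map_add, smul_add]))

lemma dualMulOp_rightAct (γ : localHom P (SheafOfModules.unit B.ring) U) (p : P.val.obj (op U))
    (a : (B.minor P).ring.obj.obj (op U)) :
    dualMulOp γ (rightAct P (op U) a p) = dualMulOp γ p * a :=
  congrArg MulOpposite.op (Subtype.ext (funext fun V => LinearMap.ext fun x => by
    change ev γ V.2 x • res P V.2 (rightAct P (op U) a p) =
      (show localHom P P U from (show (localEnd P U)ᵐᵒᵖ from a).unop).1 V
        (ev γ V.2 x • res P V.2 p)
    rw [map_smul]
    exact congrArg _ (localHom_res (show localHom P P U from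
      (show (localEnd P U)ᵐᵒᵖ from a).unop) le_rfl V.2 p).symm))

/-- The dual basis identity, read in `(End P)ᵒᵖ`: the identity is a sum of operators of the form
`γ(-) • p`. This is the surjective half of the Morita context. -/
lemma DualBasis.sum_dualMulOp (d : DualBasis P U) : ∑ i, dualMulOp (d.φ i) (d.p i) = 1 := by
  have h : ∑ i, (show localEnd P U from dualMul (d.φ i) (d.p i)) = 1 := by
    refine Subtype.ext (funext fun V => LinearMap.ext fun x => ?_)
    rw [AddSubmonoidClass.coe_finsetSum, Finset.sum_apply, LinearMap.sum_apply]
    exact d.sum_eq V.1 V.2 x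
  refine MulOpposite.unop_injective ?_
  exact (map_sum (MulOpposite.opAddEquiv (α := localEnd P U)).symm _ _).trans h

/-- Contraction sends `p ⊗ n` to `(γ · p) n` with `γ · p` in `A`; it is balanced because `γ · (p a)
= (γ · p) a`. -/
lemma exists_contraction (γ : localHom P (SheafOfModules.unit B.ring) U) :
    ∃ μ : TensorSections P N (op U) →+ N.val.obj (op U),
      ∀ (p) (n : N.val.obj (op U)), μ (tmul P N (op U) p n) = dualMulOp γ p • n :=
  exists_tensorLift P N (op U)
    (AddMonoidHom.mk' (fun p => AddMonoidHom.mk' (fun n : N.val.obj (op U) => dualMulOp γ p • n)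
        (fun n n' => smul_add (A := N.val.obj (op U)) (dualMulOp γ p) n n'))
      (fun p p' => AddMonoidHom.ext fun (n : N.val.obj (op U)) =>
        (congrArg (· • n) (dualMulOp_add γ p p')).trans (add_smul _ _ n)))
    (fun a p (n : N.val.obj (op U)) =>
      (congrArg (· • n) (dualMulOp_rightAct γ p a)).trans (mul_smul (dualMulOp γ p) a n))

/-- The contraction `P ⊗ N → N` with a section of the dual module. -/
def contraction (γ : localHom P (SheafOfModules.unit B.ring) U) :
    TensorSections P N (op U) →+ N.val.obj (op U) := (exists_contraction γ).choose

lemma contraction_tmul (γ : localHom P (SheafOfModules.unit B.ring) U) (p : P.val.obj (op U))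
    (n : N.val.obj (op U)) : contraction γ (tmul P N (op U) p n) = dualMulOp γ p • n :=
  (exists_contraction γ).choose_spec p n

/-- Together with `DualBasis.sum_contraction` this shows that `n ↦ (p ↦ p ⊗ n)` and `ψ ↦ ∑ φ i · ψ(p
i)` are inverse to each other. -/
lemma tmul_contraction (γ : localHom P (SheafOfModules.unit B.ring) U) (p : P.val.obj (op U))
    (t : TensorSections P N (op U)) :
    tmul P N (op U) p (contraction γ t) = ev γ le_rfl p • t := by
  induction t using tensor_induction with
  | h0 => rw [map_zero, smul_zero]; exact map_zero (tmulHom P N (op U) p)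
  | h1 q n =>
    rw [contraction_tmul]
    refine (tmul_rel P N (op U) p _ n).symm.trans ?_
    exact congrArg (fun q => tmul P N (op U) q n) (rightAct_dualMulOp γ q p)
  | h2 x y hx hy =>
    rw [map_add, smul_add, ← hx, ← hy]
    exact tmul_add_right P N (op U) p _ _

lemma DualBasis.sum_contraction (d : DualBasis P U) (n : N.val.obj (op U)) :
    ∑ i, contraction (d.φ i) (tmul P N (op U) (d.p i) n) = n := by
  simp only [contraction_tmul]
  rw [← Finset.sum_smul, d.sum_dualMulOp, one_smul]

lemma isIso_of_locInj_of_locSurj {M N : SheafOfModules.{u} B.ring} (f : M ⟶ N)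
    (hi : LocInj f.val) (hs : LocSurj f.val) : IsIso f := by
  have := epi_of_locSurj f hs
  have : Mono f := mono_of_injective f fun V => (injective_iff_map_eq_zero _).2 fun m hm =>
    eq_of_forall_mem fun x hx => by
      obtain ⟨W, hW, hxW, h⟩ := hi V m hm x hx
      exact ⟨W, hW, hxW, h.trans (map_zero (res M hW)).symm⟩
  exact isIso_of_mono_of_epi f

/-- The local inverse is `ψ ↦ ∑ φ i · ψ(p i)`. Since `P ⊗ N` is an associated sheaf, the finitely
many sections involved are first represented by, or compared as, presheaf tensors on a smaller
neighbourhood. `N` is arbitrary. -/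
lemma isIso_unit (h : ∀ (V : X.Opens), ∀ x ∈ V, ∃ (W : X.Opens) (_ : W ≤ V), x ∈ W ∧
    Nonempty (DualBasis P W)) : IsIso ((B.tensorHomAdjunction P).unit.app N) := by
  -- A common neighbourhood for the finitely many members of a dual basis.
  have res_finset : ∀ {V : X.Opens} {x : X} (hx : x ∈ V) {n : ℕ}
      (W : Fin n → X.Opens) (hW : ∀ i, x ∈ W i), ∃ W' ≤ V, x ∈ W' ∧ ∀ i, W' ≤ W i := by
    intro V x hx n W hW
    refine ⟨V ⊓ ⟨⋂ i, W i, isOpen_iInter_of_finite fun i => (W i).2⟩, inf_le_left,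
      ⟨hx, Set.mem_iInter.2 hW⟩, fun i => inf_le_right.trans ?_⟩
    exact Set.iInter_subset _ i
  refine isIso_of_locInj_of_locSurj (B := B.minor P) _ (fun V n hn x hx => ?_)
    fun V (ψ : localHom P _ V) x hx => ?_
  · obtain ⟨W, hW, hxW, ⟨d⟩⟩ := h V x hx
    have h1 : ∀ i, ∃ (W' : X.Opens) (_ : W' ≤ W), x ∈ W' ∧
        pres (tensorPresheaf P N) ‹W' ≤ W› (tmul P N (op W) (d.p i) (res N hW n)) = 0 := by
      intro i
      obtain ⟨W', hW', hxW', h'⟩ := locInj_toSheafif (tensorPresheaf P N) W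
        (tmul P N (op W) (d.p i) (res N hW n)) (by
          refine (tensorHomAdjunction_unit P N V n hW (d.p i)).symm.trans ?_
          exact congrArg (fun ψ : localHom P _ V => ψ.1 ⟨W, hW⟩ (d.p i)) hn) x hxW
      exact ⟨W', hW', hxW', h'⟩
    choose W' hW' hxW' h' using h1
    obtain ⟨W₁, hW₁, hxW₁, h₁⟩ := res_finset hxW W' hxW'
    refine ⟨W₁, hW₁.trans hW, hxW₁, ?_⟩
    change res N _ n = 0
    -- The section `n` is recovered from the tensors `p i ⊗ n`, which all vanish on `W₁`.
    rw [← (d.restrict hW₁).sum_contraction (res N _ n)]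
    refine Finset.sum_eq_zero fun i _ => ?_
    refine (congrArg _ ?_).trans (map_zero (contraction ((d.restrict hW₁).φ i)))
    refine Eq.trans ?_ ((congrArg (pres (tensorPresheaf P N) (h₁ i)) (h' i)).trans (map_zero _))
    refine Eq.trans ?_ (pres_pres (tensorPresheaf P N) _ _ _).symm
    refine Eq.trans ?_ (tensorRes_tmul P N _ _ _).symm
    exact congrArg (tmul P N (op W₁) _) (res_res N hW hW₁ n).symm
  · obtain ⟨W, hW, hxW, ⟨d⟩⟩ := h V x hx
    have h1 := fun i => locSurj_toSheafif (tensorPresheaf P N) W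
      (ψ.1 ⟨W, hW⟩ (d.p i)) x hxW
    choose W' hW' t hxW' ht using h1
    obtain ⟨W₁, hW₁, hxW₁, h₁⟩ := res_finset hxW W' hxW'
    let d₁ := d.restrict hW₁
    let t₁ : Fin d.n → TensorSections P N (op W₁) := fun i => pres (tensorPresheaf P N) (h₁ i) (t i)
    have ht₁ : ∀ i, (toSheafif (tensorPresheaf P N)).app (op W₁) (t₁ i) =
        ψ.1 ⟨W₁, hW₁.trans hW⟩ (d₁.p i) := fun i => by
      refine (app_pres (toSheafif (tensorPresheaf P N)) (h₁ i) (t i)).trans ?_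
      rw [ht i]
      refine (pres_pres (sheafif (tensorPresheaf P N)).val _ _ _).trans ?_
      exact (localHom_res ψ hW hW₁ (d.p i)).symm
    -- `t₁ i` is a presheaf tensor representing `ψ(p i)`, so the witness is `∑ φ i · ψ(p i)`.
    refine ⟨W₁, hW₁.trans hW, ∑ i, contraction (d₁.φ i) (t₁ i), hxW₁, ?_⟩
    refine d₁.hom_ext (ψ := homApp ((B.tensorHomAdjunction P).unit.app N) W₁ _)
      (ψ' := localHomRes _ _ (hW₁.trans hW) ψ) fun j => ?_
    refine (tensorHomAdjunction_unit P N W₁ _ le_rfl (d₁.p j)).trans ?_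
    rw [res_self]
    refine (congrArg ((toSheafif (tensorPresheaf P N)).app (op W₁))
      ((map_sum (tmulHom P N (op W₁) (d₁.p j)) _ _).trans
        (Finset.sum_congr rfl fun i _ => tmul_contraction (d₁.φ i) (d₁.p j) (t₁ i)))).trans ?_
    refine (map_sum ((toSheafif (tensorPresheaf P N)).app (op W₁)).hom _ _).trans ?_
    refine Eq.trans (Finset.sum_congr rfl fun i _ => ?_)
      (d₁.apply_eq (localHomRes _ _ (hW₁.trans hW) ψ) le_rfl (d₁.p j)).symm
    refine (app_smul (toSheafif (tensorPresheaf P N)) _ (t₁ i)).trans ?_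
    exact congrArg (ev (d₁.φ i) le_rfl (d₁.p j) • ·) ((ht₁ i).trans
      (res_self ((B.tensorSheaf P).obj N) le_rfl _).symm)

end Unit

end AlgebraSheaf

/-! ### Coinduction of a `B(U)`-module from an affine open -/

/-- Applying a ring homomorphism to coordinates. -/
def Finsupp.mapRingHom {I S S' : Type*} [Ring S] [Ring S'] (σ : S →+* S') :
    (I →₀ S) →ₛₗ[σ] (I →₀ S') where
  toFun := Finsupp.mapRange σ (map_zero σ)
  map_add' := Finsupp.mapRange_add (map_add σ)
  map_smul' r c := Finsupp.ext fun i => by simp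

lemma Finsupp.mapRingHom_single {I S S' : Type*} [Ring S] [Ring S'] (σ : S →+* S') (i : I) (s : S) :
    Finsupp.mapRingHom σ (Finsupp.single i s) = Finsupp.single i (σ s) :=
  Finsupp.mapRange_single (hf := map_zero σ)

lemma Finsupp.mapRingHom_linearCombination {I J S S' : Type*} [Ring S] [Ring S'] (σ : S →+* S')
    (k : J → I →₀ S) (c : J →₀ S) :
    Finsupp.mapRingHom σ (Finsupp.linearCombination S k c) =
      Finsupp.linearCombination S' (fun j => Finsupp.mapRingHom σ (k j))
        (Finsupp.mapRingHom σ c) := by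
  induction c using Finsupp.induction_linear with
  | zero => simp only [map_zero]
  | add x y hx hy => simp only [map_add, hx, hy]
  | single j s =>
    rw [mapRingHom_single, linearCombination_single, linearCombination_single, map_smulₛₗ]

namespace AlgebraSheaf
open NCSheaf
variable {X : Scheme.{u}} {B : AlgebraSheaf X}

/-- Restriction of sections of `B`. -/
def br (B : AlgebraSheaf X) {W V : X.Opens} (h : W ≤ V) :
    B.ring.obj.obj (op V) →+* B.ring.obj.obj (op W) := (B.ring.obj.map (homOfLE h).op).hom

lemma br_br {U V W : X.Opens} (h : V ≤ U) (h' : W ≤ V) (r : B.ring.obj.obj (op U)) :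
    B.br h' (B.br h r) = B.br (h'.trans h) r := ring_res_res h h' r

lemma br_self {V : X.Opens} (h : V ≤ V) (r : B.ring.obj.obj (op V)) : B.br h r = r :=
  congrArg (fun φ => φ.hom r) (B.ring.obj.map_id (op V))

lemma br_sc {V W : X.Opens} (h : W ≤ V) (f : Γ(X, V)) : B.br h (B.sc V f) = B.sc W (rs h f) :=
  sc_res B h f

lemma mapRingHom_br {I : Type*} {U V W : X.Opens} (h : V ≤ U) (h' : W ≤ V)
    (c : I →₀ B.ring.obj.obj (op U)) :
    Finsupp.mapRingHom (B.br h') (Finsupp.mapRingHom (B.br h) c) =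
      Finsupp.mapRingHom (B.br (h'.trans h)) c :=
  Finsupp.ext fun i => br_br h h' (c i)

/-- The presheaf of groups `V ↦ B(V ⊓ U)^(I)`. -/
def freeInfAb (B : AlgebraSheaf X) (U : X.Opens) (I : Type u) : (Opens X)ᵒᵖ ⥤ AddCommGrpCat.{u} where
  obj V := AddCommGrpCat.of (I →₀ B.ring.obj.obj (op (V.unop ⊓ U)))
  map h := AddCommGrpCat.ofHom
    (Finsupp.mapRingHom (B.br (inf_le_inf_right U h.unop.le))).toAddMonoidHom
  map_id V := by
    refine AddCommGrpCat.hom_ext (AddMonoidHom.ext fun c => ?_)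
    exact Finsupp.ext fun i => br_self _ (c i)
  map_comp {V W W'} h h' := by
    refine AddCommGrpCat.hom_ext (AddMonoidHom.ext fun c => ?_)
    exact (mapRingHom_br (inf_le_inf_right U h.unop.le) (inf_le_inf_right U h'.unop.le) c).symm

instance (U : X.Opens) (I : Type u) (V : (Opens X)ᵒᵖ) :
    Module (B.ring.obj.obj V) ((B.freeInfAb U I).obj V) :=
  Module.compHom (I →₀ B.ring.obj.obj (op (V.unop ⊓ U)))
    (B.br (V := V.unop) (W := V.unop ⊓ U) inf_le_left)

/-- The presheaf `V ↦ B(V ⊓ U)^(I)`. -/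
def freeInf (B : AlgebraSheaf X) (U : X.Opens) (I : Type u) : PresheafOfModules.{u} B.ring.obj :=
  PresheafOfModules.ofPresheaf (B.freeInfAb U I) fun V W h r c => by
    refine (map_smulₛₗ (Finsupp.mapRingHom (B.br (inf_le_inf_right U h.unop.le)))
      (B.br (V := V.unop) inf_le_left r) c).trans ?_
    refine congrArg (· • Finsupp.mapRingHom (B.br (inf_le_inf_right U h.unop.le)) c) ?_
    rw [br_br]
    exact (br_br h.unop.le inf_le_left r).symm

lemma freeInf_smul {U : X.Opens} {I : Type u} {V : X.Opens} (r : B.ring.obj.obj (op V))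
    (c : (B.freeInf U I).obj (op V)) :
    r • c = (show (B.freeInf U I).obj (op V) from
      B.br (W := V ⊓ U) inf_le_left r • (show I →₀ B.ring.obj.obj (op (V ⊓ U)) from c)) := rfl

lemma pres_freeInf {U : X.Opens} {I : Type u} {V W : X.Opens} (h : W ≤ V)
    (c : (B.freeInf U I).obj (op V)) :
    pres (B.freeInf U I) h c = (show (B.freeInf U I).obj (op W) from
      Finsupp.mapRingHom (B.br (inf_le_inf_right U h))
        (show I →₀ B.ring.obj.obj (op (V ⊓ U)) from c)) := rfl

/-- The morphism given by a matrix of sections of `B` over `U`. -/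
def freeInfMap {U : X.Opens} {I J : Type u} (k : J → I →₀ B.ring.obj.obj (op U)) :
    B.freeInf U J ⟶ B.freeInf U I where
  app V := ModuleCat.ofHom
    { toFun c := show I →₀ B.ring.obj.obj (op (V.unop ⊓ U)) from
        Finsupp.linearCombination (B.ring.obj.obj (op (V.unop ⊓ U))) (fun j => Finsupp.mapRingHom (B.br inf_le_right) (k j))
          (show J →₀ B.ring.obj.obj (op (V.unop ⊓ U)) from c)
      map_add' c c' := map_add (Finsupp.linearCombination (B.ring.obj.obj (op (V.unop ⊓ U)))
        (fun j => Finsupp.mapRingHom (B.br inf_le_right) (k j))) c c'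
      map_smul' r (c : J →₀ B.ring.obj.obj (op (V.unop ⊓ U))) := map_smul (Finsupp.linearCombination (B.ring.obj.obj (op (V.unop ⊓ U)))
        (fun j => Finsupp.mapRingHom (B.br inf_le_right) (k j))) (B.br inf_le_left r) c }
  naturality {V W} h := by
    refine ModuleCat.hom_ext (LinearMap.ext fun c => ?_)
    refine Eq.trans ?_ (Finsupp.mapRingHom_linearCombination
      (B.br (inf_le_inf_right U h.unop.le)) _ _).symm
    simp only [mapRingHom_br]
    rfl

lemma LocAt.fractions {T : PresheafOfModules.{u} B.ring.obj} {V : X.Opens} (h : B.LocAt T V)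
    (f : Γ(X, V)) {W : X.Opens} (hW : W = X.basicOpen f) (hle : W ≤ V) :
    (∀ m : T.obj (op V), pres T hle m = 0 → ∃ k : ℕ, B.sc V (f ^ k) • m = 0) ∧
    (∀ m' : T.obj (op W), ∃ (k : ℕ) (m : T.obj (op V)),
      pres T hle m = B.sc W (rs hle (f ^ k)) • m') := by
  subst hW
  exact h f

/-- `D(f) ⊓ U` is the basic open of `f` restricted to the affine `V ⊓ U`, so each coordinate is
governed by the localization property of `B` there. Finite support gives a common exponent. -/
lemma locAt_freeInf (hB : B.IsNCScheme) {U V : X.Opens} (hVU : IsAffineOpen (V ⊓ U)) (I : Type u) :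
    B.LocAt (B.freeInf U I) V := by
  have hB' : B.LocAt (SheafOfModules.unit B.ring).val (V ⊓ U) := hB.locAt hVU
  intro f
  let f' : Γ(X, V ⊓ U) := rs inf_le_left f
  have hW : X.basicOpen f ⊓ U = X.basicOpen f' := by
    rw [basicOpen_rs, inf_right_comm, inf_eq_right.2 (X.basicOpen_le f)]
  obtain ⟨h1, h2⟩ := hB'.fractions f' hW (inf_le_inf_right U (X.basicOpen_le f))
  have h1' : ∀ b : B.ring.obj.obj (op (V ⊓ U)), B.br (inf_le_inf_right U (X.basicOpen_le f)) b = 0 →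
      ∃ k : ℕ, B.br inf_le_left (B.sc V (f ^ k)) * b = 0 := fun b hb => by
    obtain ⟨k, hk⟩ := h1 b hb
    refine ⟨k, ?_⟩
    rw [br_sc, map_pow]
    exact hk
  have h2' : ∀ b' : B.ring.obj.obj (op (X.basicOpen f ⊓ U)), ∃ (k : ℕ)
      (b : B.ring.obj.obj (op (V ⊓ U))), B.br (inf_le_inf_right U (X.basicOpen_le f)) b =
        B.br inf_le_left (B.sc _ (rs (X.basicOpen_le f) (f ^ k))) * b' := fun b' => by
    obtain ⟨k, b, hb⟩ := h2 b'
    refine ⟨k, b, ?_⟩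
    have e : rs (inf_le_inf_right U (X.basicOpen_le f)) (f' ^ k) =
        rs inf_le_left (rs (X.basicOpen_le f) (f ^ k)) := by
      rw [map_pow, rs_rs, rs_rs, map_pow]
    rw [br_sc, ← e]
    exact hb
  constructor
  · intro c hc
    change (I →₀ B.ring.obj.obj (op (V ⊓ U))) at c
    have hc' : ∀ i, B.br (inf_le_inf_right U (X.basicOpen_le f)) (c i) = 0 := fun i =>
      DFunLike.congr_fun (show Finsupp.mapRingHom _ c = 0 from hc) i
    choose k hk using fun i => h1' _ (hc' i)
    refine ⟨c.support.sup k, ?_⟩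
    refine Finsupp.ext fun i => ?_
    change B.br inf_le_left (B.sc V (f ^ _)) * c i = 0
    by_cases hi : i ∈ c.support
    · rw [← Nat.sub_add_cancel (Finset.le_sup (f := k) hi), pow_add, map_mul, map_mul, mul_assoc,
        hk, mul_zero]
    · rw [Finsupp.notMem_support_iff.1 hi, mul_zero]
  · suffices h : ∀ c' : I →₀ B.ring.obj.obj (op (X.basicOpen f ⊓ U)),
        ∃ (k : ℕ) (c : I →₀ B.ring.obj.obj (op (V ⊓ U))),
          Finsupp.mapRingHom (B.br (inf_le_inf_right U (X.basicOpen_le f))) c =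
            B.br inf_le_left (B.sc _ (rs (X.basicOpen_le f) (f ^ k))) • c' by
      intro c'
      obtain ⟨k, c, hc⟩ := h c'
      refine ⟨k, c, ?_⟩
      refine (pres_freeInf (X.basicOpen_le f) c).trans (Eq.trans ?_
        (freeInf_smul (B.sc _ (rs (X.basicOpen_le f) (f ^ k))) c').symm)
      exact hc
    intro c'
    induction c' using Finsupp.induction_linear with
    | zero => exact ⟨0, 0, by rw [map_zero, smul_zero]⟩
    | single i b' =>
      obtain ⟨k, b, hb⟩ := h2' b'
      exact ⟨k, Finsupp.single i b, by
        rw [Finsupp.mapRingHom_single, hb, Finsupp.smul_single, smul_eq_mul]⟩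
    | add x y hx hy =>
      obtain ⟨k, c, hc⟩ := hx
      obtain ⟨l, d, hd⟩ := hy
      refine ⟨k + l, B.br (W := V ⊓ U) inf_le_left (B.sc V (f ^ l)) • c +
        B.br (W := V ⊓ U) inf_le_left (B.sc V (f ^ k)) • d, ?_⟩
      have e : ∀ n, B.br (inf_le_inf_right U (X.basicOpen_le f)) (B.br inf_le_left (B.sc V (f ^ n))) =
          B.br inf_le_left (B.sc _ (rs (X.basicOpen_le f) (f ^ n))) := fun n => by
        rw [← br_sc, br_br, br_br]
      rw [map_add, map_smulₛₗ, map_smulₛₗ, hc, hd, e, e, smul_smul, smul_smul, ← map_mul, ← map_mul,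
        ← map_mul, ← map_mul, ← map_mul, ← map_mul, ← pow_add, ← pow_add, add_comm l k, ← smul_add]

section Coinduced

variable (U : X.Opens) (E : Type u) [AddCommGroup E] [Module (B.ring.obj.obj (op U)) E]

/-- The relations in the tautological presentation of a module. -/
abbrev relations : Type u := LinearMap.ker (Finsupp.linearCombination (B.ring.obj.obj (op U)) (id : E → E))

/-- The matrix of the tautological presentation. -/
def relationsMap : B.freeInf U (relations (B := B) U E) ⟶ B.freeInf U E := freeInfMap Subtype.val

/-- The presheaf `V ↦ B(V ⊓ U) ⊗_{B(U)} E`. -/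
def coindPre : PresheafOfModules.{u} B.ring.obj := cokernel (relationsMap (B := B) U E)

/-- The quotient map. -/
def coindπ (V : X.Opens) : (E →₀ B.ring.obj.obj (op (V ⊓ U))) →+ (coindPre (B := B) U E).obj (op V) :=
  ((cokernel.π (relationsMap U E)).app (op V)).hom.toAddMonoidHom

variable {U E}

lemma coindπ_surjective (V : X.Opens) : Function.Surjective (coindπ (B := B) U E V) :=
  presheaf_cokernel_surjective _ V

lemma coindπ_eq_zero_iff {V : X.Opens} (c : E →₀ B.ring.obj.obj (op (V ⊓ U))) :
    coindπ U E V c = 0 ↔ ∃ d, Finsupp.linearCombination (B.ring.obj.obj (op (V ⊓ U)))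
      (fun j : relations (B := B) U E => Finsupp.mapRingHom (B.br inf_le_right) j.1) d = c :=
  presheaf_cokernel_exact (relationsMap U E) V c

lemma coindπ_smul {V : X.Opens} (b : B.ring.obj.obj (op V)) (c : E →₀ B.ring.obj.obj (op (V ⊓ U))) :
    coindπ U E V (B.br (W := V ⊓ U) inf_le_left b • c) = b • coindπ U E V c :=
  app_smul (cokernel.π (relationsMap U E)) b (show (B.freeInf U E).obj (op V) from c)

lemma coindπ_pres {V W : X.Opens} (h : W ≤ V) (c : E →₀ B.ring.obj.obj (op (V ⊓ U))) :
    coindπ U E W (Finsupp.mapRingHom (B.br (inf_le_inf_right U h)) c) =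
      pres (coindPre U E) h (coindπ U E V c) :=
  app_pres (cokernel.π (relationsMap U E)) h (show (B.freeInf U E).obj (op V) from c)

/-- Coefficients over `V` live on `V ⊓ U`, and those over `V ⊓ U` live on the equal open `(V ⊓ U) ⊓
U`; restriction along `h1` is the inverse. -/
lemma coindPre_bijective (V : X.Opens) :
    Function.Bijective (pres (coindPre (B := B) U E) (inf_le_left : V ⊓ U ≤ V)) := by
  have h1 : V ⊓ U ≤ (V ⊓ U) ⊓ U := le_inf le_rfl inf_le_right
  have hinv : ∀ (I : Type u) (c : I →₀ B.ring.obj.obj (op (V ⊓ U))), Finsupp.mapRingHom (B.br h1)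
      (Finsupp.mapRingHom (B.br (inf_le_inf_right U (inf_le_left : V ⊓ U ≤ V))) c) = c :=
    fun I c => (mapRingHom_br _ _ c).trans (Finsupp.ext fun i => br_self _ _)
  have hinv' : ∀ (I : Type u) (c : I →₀ B.ring.obj.obj (op ((V ⊓ U) ⊓ U))), Finsupp.mapRingHom
      (B.br (inf_le_inf_right U (inf_le_left : V ⊓ U ≤ V))) (Finsupp.mapRingHom (B.br h1) c) = c :=
    fun I c => (mapRingHom_br _ _ c).trans (Finsupp.ext fun i => br_self _ _)
  constructor
  · refine (injective_iff_map_eq_zero _).2 fun t ht => ?_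
    obtain ⟨c, rfl⟩ := coindπ_surjective V t
    rw [← coindπ_pres, coindπ_eq_zero_iff] at ht
    obtain ⟨d, hd⟩ := ht
    rw [coindπ_eq_zero_iff]
    refine ⟨Finsupp.mapRingHom (B.br h1) d, ?_⟩
    rw [← hinv E c, ← hd, Finsupp.mapRingHom_linearCombination]
    simp only [mapRingHom_br]
  · intro t
    obtain ⟨c, rfl⟩ := coindπ_surjective _ t
    exact ⟨coindπ U E V (Finsupp.mapRingHom (B.br h1) c), by rw [← coindπ_pres, hinv']⟩

variable (U E) in
/-- The tautological generators of `coindPre` over `U`. -/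
def coindGen : (E →₀ B.ring.obj.obj (op U)) →ₗ[B.ring.obj.obj (op U)] (coindPre (B := B) U E).obj (op U) where
  toFun c := coindπ U E U (Finsupp.mapRingHom (B.br inf_le_left) c)
  map_add' c c' := by rw [map_add, map_add]
  map_smul' b c := by rw [map_smulₛₗ, coindπ_smul, RingHom.id_apply]

lemma coindGen_surjective : Function.Surjective (coindGen (B := B) U E) := fun t => by
  obtain ⟨c, rfl⟩ := coindπ_surjective _ t
  refine ⟨Finsupp.mapRingHom (B.br (le_inf le_rfl le_rfl)) c, congrArg (coindπ U E U) ?_⟩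
  exact (mapRingHom_br _ _ c).trans (Finsupp.ext fun i => br_self _ _)

lemma ker_coindGen : LinearMap.ker (coindGen (B := B) U E) =
    LinearMap.ker (Finsupp.linearCombination (B.ring.obj.obj (op U)) (id : E → E)) := by
  have hinv : ∀ (I : Type u) (c : I →₀ B.ring.obj.obj (op U)), Finsupp.mapRingHom
      (B.br (le_inf le_rfl le_rfl)) (Finsupp.mapRingHom (B.br (W := U ⊓ U) inf_le_left) c) = c :=
    fun I c => (mapRingHom_br _ _ c).trans (Finsupp.ext fun i => br_self _ _)
  ext c
  rw [LinearMap.mem_ker]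
  -- Every relation `c` is itself a column of the matrix, so it is the image of a basis vector; the
  -- converse holds as all columns are relations.
  refine (coindπ_eq_zero_iff _).trans ⟨?_, fun hc => ⟨Finsupp.single ⟨c, hc⟩ 1, ?_⟩⟩
  · rintro ⟨d, hd⟩
    have h1 := congrArg (Finsupp.mapRingHom (B.br (le_inf le_rfl le_rfl))) hd
    rw [hinv, Finsupp.mapRingHom_linearCombination] at h1
    rw [← h1]
    have h2 : ∀ (K : Submodule (B.ring.obj.obj (op U)) (E →₀ B.ring.obj.obj (op U))) (d : K →₀ _),
        Finsupp.linearCombination (B.ring.obj.obj (op U)) (fun j : K => Finsupp.mapRingHom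
          (B.br (le_inf le_rfl le_rfl))
            (Finsupp.mapRingHom (B.br (W := U ⊓ U) inf_le_right) j.1)) d ∈ K := fun K d => by
      refine Submodule.sum_mem _ fun j _ => Submodule.smul_mem _ _ ?_
      exact Set.mem_of_eq_of_mem (hinv E j.1) j.2
    exact h2 _ _
  · rw [Finsupp.linearCombination_single, one_smul]

variable (B U E) in
/-- The module of sections of `coindPre` over `U`. -/
def coindEquiv : (coindPre (B := B) U E).obj (op U) ≃ₗ[B.ring.obj.obj (op U)] E :=
  ((coindGen U E).quotKerEquivOfSurjective coindGen_surjective).symm ≪≫ₗ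
    Submodule.quotEquivOfEq _ _ ker_coindGen ≪≫ₗ
    (Finsupp.linearCombination (B.ring.obj.obj (op U)) (id : E → E)).quotKerEquivOfSurjective
      fun e => ⟨Finsupp.single e 1, by simp⟩

variable (U E) in
/-- The sheaf associated with `V ↦ B(V ⊓ U) ⊗_{B(U)} E`. -/
def coind : SheafOfModules.{u} B.ring := sheafif (coindPre U E)

variable [X.IsSeparated]

/-- Separatedness enters here: `V ⊓ U` is affine when `V` and `U` are. -/
lemma locAt_coindPre (hB : B.IsNCScheme) (hU : IsAffineOpen U) {V : X.Opens} (hV : IsAffineOpen V) :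
    B.LocAt (coindPre (B := B) U E) V :=
  locAt_cokernel _ (locAt_freeInf hB (hV.inf hU) _) (locAt_freeInf hB (hV.inf hU) _)

lemma qcoh_coind (hB : B.IsNCScheme) (hU : IsAffineOpen U) : B.qcoh (coind (B := B) U E) :=
  qcoh_iff.2 fun _ hV => (locSurj_toSheafif (coindPre U E)).locAt (locInj_toSheafif _)
    (fun _ _ hW => locAt_coindPre hB hU hW) hV

lemma toSheafif_coind_bijective (hB : B.IsNCScheme) (hU : IsAffineOpen U) {V : X.Opens}
    (hV : IsAffineOpen V) :
    Function.Bijective ((toSheafif (coindPre (B := B) U E)).app (op V)) :=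
  (locSurj_toSheafif (coindPre U E)).bijective (locInj_toSheafif _)
    (fun _ _ hW => locAt_coindPre hB hU hW) hV

/-- Over affine opens the associated sheaf has the sections of `coindPre`, so it inherits the
independence of what lies outside `U`: `coind` behaves as a pushforward from `U`. -/
lemma coind_bijective (hB : B.IsNCScheme) (hU : IsAffineOpen U) {V : X.Opens}
    (hV : IsAffineOpen V) :
    Function.Bijective (res (coind (B := B) U E) (inf_le_left : V ⊓ U ≤ V)) := by
  have h1 := toSheafif_coind_bijective (E := E) hB hU hV
  have h2 := toSheafif_coind_bijective (E := E) hB hU (hV.inf hU)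
  have h3 := coindPre_bijective (U := U) (E := E) (B := B) V
  refine (Function.Bijective.of_comp_iff _ h1).1 ?_
  have h4 : ∀ t, res (coind (B := B) U E) (inf_le_left : V ⊓ U ≤ V)
      ((toSheafif (coindPre (B := B) U E)).app (op V) t) =
      (toSheafif (coindPre (B := B) U E)).app (op (V ⊓ U)) (pres (coindPre U E) inf_le_left t) :=
    fun t => (app_pres (toSheafif (coindPre (B := B) U E)) inf_le_left t).symm
  exact (funext h4 : _ ∘ _ = _ ∘ _) ▸ h2.comp h3

/-- The module of sections of `coind` over `U`. -/
def coindSections (hB : B.IsNCScheme) (hU : IsAffineOpen U) :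
    (coind (B := B) U E).val.obj (op U) ≃ₗ[B.ring.obj.obj (op U)] E :=
  (LinearEquiv.ofBijective ((toSheafif (coindPre (B := B) U E)).app (op U)).hom
    (toSheafif_coind_bijective hB hU hU)).symm ≪≫ₗ coindEquiv B U E

end Coinduced

end AlgebraSheaf

/-! ### The right adjoint of sections over an affine open, and the quasi-coherent coreflection -/

namespace AlgebraSheaf
open NCSheaf
variable {X : Scheme.{u}} {B : AlgebraSheaf X}

section Local

variable {M M' M'' N : SheafOfModules.{u} B.ring}

/-- The map on sections as a linear map. -/
def appLin (f : M ⟶ N) (U : X.Opens) :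
    M.val.obj (op U) →ₗ[B.ring.obj.obj (op U)] N.val.obj (op U) := (f.val.app (op U)).hom

lemma appLin_res (f : M ⟶ N) {U V : X.Opens} (h : V ≤ U) (m : M.val.obj (op U)) :
    appLin f V (res M h m) = res N h (appLin f U m) := app_pres f.val h m

lemma hom_ext_appLin {f g : M ⟶ N} (h : ∀ U, appLin f U = appLin g U) : f = g :=
  SheafOfModules.hom_ext (PresheafOfModules.hom_ext fun U => ModuleCat.hom_ext (h U.unop))

/-- Composition of a local homomorphism with a morphism. -/
def precomp {U : X.Opens} (f : M' ⟶ M) (φ : localHom M N U) : localHom M' N U :=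
  ⟨fun V => (φ.1 V).comp (appLin f V.1), fun V W h m => by
    change φ.1 W (appLin f W.1 (res M' h m)) = res N h (φ.1 V (appLin f V.1 m))
    rw [appLin_res, φ.2 V W h]⟩

lemma zero_precomp {U : X.Opens} (φ : localHom M N U) : precomp (0 : M' ⟶ M) φ = 0 :=
  localHom_ext fun V _ => map_zero (φ.1 V)

/-- The local homomorphism of a morphism. -/
def toLocal (U : X.Opens) (f : M ⟶ N) : localHom M N U :=
  ⟨fun V => appLin f V.1, fun _ _ h m => appLin_res f h m⟩

/-- The morphism of a local homomorphism over the whole space. -/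
def ofLocal (φ : localHom M N ⊤) : M ⟶ N where
  val := PresheafOfModules.homMk
    { app V := AddCommGrpCat.ofHom (φ.1 ⟨V.unop, le_top⟩).toAddMonoidHom
      naturality V W h := by
        refine AddCommGrpCat.hom_ext (AddMonoidHom.ext fun m => ?_)
        exact localHom_res φ le_top h.unop.le m }
    (fun V r m => map_smul (φ.1 ⟨V.unop, le_top⟩) r m)

lemma exists_isAffineOpen_le {V : X.Opens} {x : X} (hx : x ∈ V) :
    ∃ W ≤ V, IsAffineOpen W ∧ x ∈ W := by
  obtain ⟨W, hW, hxW, h⟩ := exists_isAffineOpen_mem_and_subset (x := x) (U := V) hx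
  exact ⟨W, h, hW, hxW⟩

end Local

section Coinduced

variable [X.IsSeparated] {U : X.Opens} {E : Type u} [AddCommGroup E]
  [Module (B.ring.obj.obj (op U)) E] {M : SheafOfModules.{u} B.ring}

lemma coind_injective (hB : B.IsNCScheme) (hU : IsAffineOpen U) (V : X.Opens) :
    Function.Injective (res (coind (B := B) U E) (inf_le_left : V ⊓ U ≤ V)) := fun s t h =>
  eq_of_forall_mem fun x hx => by
    obtain ⟨W, hWV, hW, hxW⟩ := exists_isAffineOpen_le hx
    refine ⟨W, hWV, hxW, (coind_bijective hB hU hW).1 ?_⟩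
    have := congrArg (res (coind (B := B) U E) (inf_le_inf_right U hWV)) h
    rw [res_res, res_res] at this ⊢
    exact this

/-- As `coind` behaves as a pushforward from `U`, a morphism into it amounts to a local homomorphism
over `U`, and over the affine `U` this is a linear map of sections. -/
lemma appLin_coind_bijective (hB : B.IsNCScheme) (hU : IsAffineOpen U) (hM : B.qcoh M) :
    Function.Bijective fun f : M ⟶ coind (B := B) U E => appLin f U := by
  constructor
  · intro f g h
    have hl : toLocal U f = toLocal U g := topHom_injective hU (hM.locAt hU) h
    refine hom_ext_appLin fun V => LinearMap.ext fun m => coind_injective hB hU V ?_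
    rw [← appLin_res, ← appLin_res]
    exact congrArg (fun φ : localHom M (coind U E) U => φ.1 ⟨V ⊓ U, inf_le_right⟩
      (res M inf_le_left m)) hl
  · intro h
    obtain ⟨φ, hφ⟩ := topHom_surjective hB hU (hM.locAt hU) h
    -- The value at `m` is the section whose restriction to `V ⊓ U` is `φ(m|_{V ⊓ U})`; it exists
    -- over affine `V` and is always unique.
    let r : ∀ V : X.Opens, M.val.obj (op V) → (coind (B := B) U E).val.obj (op V) → Prop :=
      fun V m n => res (coind U E) (inf_le_left : V ⊓ U ≤ V) n =
        φ.1 ⟨V ⊓ U, inf_le_right⟩ (res M inf_le_left m)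
    suffices hr : ∃ ψ : localHom M (coind U E) ⊤, ∀ (V : {V : X.Opens // V ≤ ⊤}) (m) (n),
        r V.1 m n → ψ.1 V m = n by
      obtain ⟨ψ, hψ⟩ := hr
      refine ⟨ofLocal ψ, LinearMap.ext fun m => hψ ⟨U, le_top⟩ m (h m) ?_⟩
      change res (coind U E) inf_le_left (h m) = φ.1 ⟨U ⊓ U, inf_le_right⟩ (res M inf_le_left m)
      rw [← hφ]
      exact (localHom_res φ le_rfl inf_le_left m).symm
    have hres : ∀ (V W : X.Opens) (hW : W ≤ V) (m : M.val.obj (op V)) (n), r V m n →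
        r W (res M hW m) (res _ hW n) := fun V W hW m n h => by
      have h1 := congrArg (res (coind (B := B) U E) (inf_le_inf_right U hW)) h
      change res (coind U E) inf_le_left (res (coind U E) hW n) =
        φ.1 ⟨W ⊓ U, inf_le_right⟩ (res M inf_le_left (res M hW m))
      rw [res_res, ← localHom_res, res_res] at h1
      rw [res_res, res_res]
      exact h1
    refine exists_localHom_of_rel ⊤ r (fun V W _ hW m n => hres V W hW m n) ?_ ?_ ?_ ?_
    · intro V _ m n n' h h'
      exact coind_injective hB hU V (h.trans h'.symm)
    · intro V _ m x hx
      obtain ⟨W, hWV, hW, hxW⟩ := exists_isAffineOpen_le hx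
      obtain ⟨n, hn⟩ := (coind_bijective (E := E) hB hU hW).2
        (φ.1 ⟨W ⊓ U, inf_le_right⟩ (res M inf_le_left (res M hWV m)))
      exact ⟨W, hWV, n, hxW, hn⟩
    · intro V _ m m' n n' h h'
      have h1 : res (coind U E) inf_le_left n = φ.1 ⟨V ⊓ U, inf_le_right⟩ (res M inf_le_left m) := h
      have h2 : res (coind U E) inf_le_left n' =
        φ.1 ⟨V ⊓ U, inf_le_right⟩ (res M inf_le_left m') := h'
      change res (coind U E) inf_le_left (n + n') =
        φ.1 ⟨V ⊓ U, inf_le_right⟩ (res M inf_le_left (m + m'))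
      rw [map_add, map_add, map_add, h1, h2]
    · intro V _ b m n h x hx
      refine ⟨V, le_rfl, hx, ?_⟩
      have h' : res (coind U E) inf_le_left n =
        φ.1 ⟨V ⊓ U, inf_le_right⟩ (res M inf_le_left m) := h
      have h1 : r V (b • m) (b • n) := by
        change res (coind U E) inf_le_left (b • n) =
          φ.1 ⟨V ⊓ U, inf_le_right⟩ (res M inf_le_left (b • m))
        rw [res_smul, res_smul, map_smul, h']
      exact (res_self M le_rfl (b • m)).symm ▸ (res_self (coind U E) le_rfl (b • n)).symm ▸ h1

/-- Sections over an affine open have a right adjoint. -/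
lemma exists_coinduced (hB : B.IsNCScheme) (hU : IsAffineOpen U) (E : Type u) [AddCommGroup E]
    [Module (B.ring.obj.obj (op U)) E] :
    ∃ (R : B.Mod) (e : R.obj.val.obj (op U) →ₗ[B.ring.obj.obj (op U)] E), ∀ M : B.Mod,
      Function.Bijective fun f : M ⟶ R => e.comp (appLin f.hom U) := by
  refine ⟨⟨coind U E, qcoh_coind hB hU⟩, (coindSections hB hU).toLinearMap, fun M => ?_⟩
  have h1 := appLin_coind_bijective (E := E) hB hU M.property
  constructor
  · intro f g h
    refine ObjectProperty.hom_ext _ (h1.1 (LinearMap.ext fun m => ?_))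
    exact (coindSections hB hU).injective (LinearMap.congr_fun h m)
  · intro h
    obtain ⟨f, hf⟩ := h1.2 ((coindSections hB hU).symm.toLinearMap.comp h)
    refine ⟨ObjectProperty.homMk f, LinearMap.ext fun m => ?_⟩
    change coindSections hB hU (appLin f U m) = h m
    have := LinearMap.congr_fun hf m
    exact (congrArg (coindSections hB hU) this).trans ((coindSections hB hU).apply_symm_apply _)

/-- Local homomorphisms over an affine open are representable. -/
lemma exists_represents_localHom (hB : B.IsNCScheme) (hU : IsAffineOpen U)
    (S : SheafOfModules.{u} B.ring) :
    ∃ (R : B.Mod) (ε : localHom R.obj S U), ∀ M : B.Mod,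
      Function.Bijective fun f : M ⟶ R => precomp f.hom ε := by
  -- For quasi-coherent `M`, local homomorphisms to the arbitrary sheaf `S` over `U` are linear maps
  -- `M(U) → S(U)`, which coinduction of `S(U)` represents.
  obtain ⟨R, e, h⟩ := exists_coinduced hB hU (S.val.obj (op U))
  obtain ⟨ε, hε⟩ := topHom_surjective hB hU (R.property.locAt hU) e
  refine ⟨R, ε, fun M => ?_⟩
  have h1 : (topHom U ∘ fun f : M ⟶ R => precomp f.hom ε) =
      fun f : M ⟶ R => e.comp (appLin f.hom U) := by
    funext f
    rw [← hε]
    rfl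
  have h2 : Function.Bijective (topHom (M := M.obj) (N := S) U) :=
    ⟨topHom_injective hU (M.property.locAt hU), topHom_surjective hB hU (M.property.locAt hU)⟩
  exact (Function.Bijective.of_comp_iff' h2 _).1 (h1 ▸ h M)

end Coinduced

section Cover

variable {M S : SheafOfModules.{u} B.ring} {ι : Type u} {U : ι → X.Opens}

lemma localHom_ext_of_cover (hc : iSup U = ⊤) {φ ψ : localHom M S ⊤}
    (h : ∀ i, localHomRes M S le_top φ = localHomRes M S (le_top : U i ≤ ⊤) ψ) : φ = ψ := by
  refine localHom_ext fun V m => eq_of_forall_mem fun x hx => ?_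
  obtain ⟨i, hi⟩ := Opens.mem_iSup.1 ((hc.symm ▸ trivial : x ∈ iSup U))
  refine ⟨V.1 ⊓ U i, inf_le_left, ⟨hx, hi⟩, ?_⟩
  rw [← localHom_res φ V.2, ← localHom_res ψ V.2]
  have h1 : (localHomRes M S (le_top : U i ≤ ⊤) φ).1 ⟨V.1 ⊓ U i, inf_le_right⟩ =
    (localHomRes M S (le_top : U i ≤ ⊤) ψ).1 ⟨V.1 ⊓ U i, inf_le_right⟩ := by rw [h i]
  exact LinearMap.congr_fun h1 (res M inf_le_left m)

lemma exists_localHom_of_cover (hc : iSup U = ⊤) (φ : ∀ i, localHom M S (U i))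
    (h : ∀ i j, localHomRes M S (inf_le_left : U i ⊓ U j ≤ U i) (φ i) =
      localHomRes M S (inf_le_right : U i ⊓ U j ≤ U j) (φ j)) :
    ∃ ψ : localHom M S ⊤, ∀ i, localHomRes M S le_top ψ = φ i := by
  obtain ⟨ψ, hψ, -⟩ := localHom_glue U φ h
  exact ⟨localHomRes M S hc.ge ψ, hψ⟩

end Cover

section Coreflection

variable [CompactSpace X]

variable (X) in
lemma exists_finite_affine_cover : ∃ (ι : Type u) (_ : Finite ι) (U : ι → X.Opens),
    (∀ i, IsAffineOpen (U i)) ∧ iSup U = ⊤ := by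
  choose W _ hW hx using fun x : X => exists_isAffineOpen_le (V := ⊤) (x := x) trivial
  obtain ⟨t, -, ht⟩ := isCompact_univ.elim_nhds_subcover (fun x => (W x : Set X))
    fun x _ => (W x).2.mem_nhds (hx x)
  refine ⟨t, inferInstance, fun i => W i, fun i => hW i, eq_top_iff.2 fun x _ => ?_⟩
  obtain ⟨y, hy, hxy⟩ := Set.mem_iUnion₂.1 (ht (Set.mem_univ x))
  exact Opens.mem_iSup.2 ⟨⟨y, hy⟩, hxy⟩

variable [X.IsSeparated]

/-- A morphism `M ⟶ S` is a family of local homomorphisms over an affine cover that agree on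
overlaps. Homomorphisms over `U i` and over the affine `U i ⊓ U j` are represented by `R i` and `R'
(i, j)`, so the equalizer of the two maps from the sum of the `R i` to the sum of the `R'`
represents `Hom(-, S)`. The cover is finite, so these are finite sums in `B.Mod`. -/
lemma exists_coreflection (hB : B.IsNCScheme) (S : SheafOfModules.{u} B.ring) :
    ∃ (K : B.Mod) (ε : K.obj ⟶ S), ∀ M : B.Mod,
      Function.Bijective fun f : M ⟶ K => f.hom ≫ ε := by
  obtain ⟨ι, _, U, hU, hc⟩ := exists_finite_affine_cover X
  have : HasFiniteBiproducts B.Mod := Abelian.hasFiniteBiproducts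
  choose R ε hR using fun i => exists_represents_localHom hB (hU i) S
  choose R' ε' hR' using fun p : ι × ι => exists_represents_localHom hB ((hU p.1).inf (hU p.2)) S
  -- `d p` represents the difference of the two restrictions to the overlap; the equalizer is
  -- written as the kernel of all `d p`.
  choose d hd using fun p : ι × ι => (hR' p (⨁ R)).2
    (localHomRes _ _ inf_le_left (precomp (biproduct.π R p.1).hom (ε p.1)) -
      localHomRes _ _ inf_le_right (precomp (biproduct.π R p.2).hom (ε p.2)))
  let K := kernel (biproduct.lift d)
  let k : K ⟶ ⨁ R := kernel.ι _
  have hk : ∀ p, k ≫ d p = 0 := fun p => by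
    rw [← biproduct.lift_π d p, ← Category.assoc, kernel.condition, zero_comp]
  have key : ∀ {M : B.Mod} (a : M ⟶ ⨁ R) (p : ι × ι), a ≫ d p = 0 ↔
      localHomRes _ _ inf_le_left (precomp (a ≫ biproduct.π R p.1).hom (ε p.1)) =
        localHomRes _ _ inf_le_right (precomp (a ≫ biproduct.π R p.2).hom (ε p.2)) := by
    intro M a p
    have h1 : precomp (a ≫ d p).hom (ε' p) =
        localHomRes _ _ inf_le_left (precomp (a ≫ biproduct.π R p.1).hom (ε p.1)) -
        localHomRes _ _ inf_le_right (precomp (a ≫ biproduct.π R p.2).hom (ε p.2)) :=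
      congrArg (precomp a.hom) (hd p)
    have h2 : precomp (0 : M ⟶ R' p).hom (ε' p) = 0 := zero_precomp _
    rw [← sub_eq_zero (b := localHomRes _ _ _ _), ← h1, ← h2]
    exact (hR' p M).1.eq_iff.symm
  -- On `K` the universal local homomorphisms agree on overlaps by construction, so they glue to the
  -- counit.
  obtain ⟨e, he⟩ := exists_localHom_of_cover hc (fun i => precomp (k ≫ biproduct.π R i).hom (ε i))
    fun i j => (key k (i, j)).1 (hk (i, j))
  refine ⟨K, ofLocal e, fun M => ⟨fun f g h => ?_, fun g => ?_⟩⟩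
  · have h1 : precomp f.hom e = precomp g.hom e := congrArg (toLocal ⊤) h
    rw [← cancel_mono k]
    refine biproduct.hom_ext _ _ fun i => (hR i M).1 ?_
    change precomp f.hom (precomp (k ≫ biproduct.π R i).hom (ε i)) =
      precomp g.hom (precomp (k ≫ biproduct.π R i).hom (ε i))
    rw [← he]
    exact congrArg (localHomRes M.obj S (le_top : U i ≤ ⊤)) h1
  · choose a ha using fun i => (hR i M).2 (toLocal (U i) g)
    have hl : ∀ i, biproduct.lift a ≫ biproduct.π R i = a i := biproduct.lift_π a
    have h0 : biproduct.lift a ≫ biproduct.lift d = 0 := by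
      have h1 : ∀ p, biproduct.lift a ≫ d p = 0 := fun p => by
        refine (key _ p).2 ?_
        have e1 : precomp (biproduct.lift a ≫ biproduct.π R p.1).hom (ε p.1) =
          toLocal (U p.1) g := by rw [hl p.1]; exact ha p.1
        have e2 : precomp (biproduct.lift a ≫ biproduct.π R p.2).hom (ε p.2) =
          toLocal (U p.2) g := by rw [hl p.2]; exact ha p.2
        exact (congrArg (localHomRes M.obj S inf_le_left) e1).trans
          (congrArg (localHomRes M.obj S inf_le_right) e2).symm
      refine biproduct.hom_ext _ _ fun p => ?_
      rw [Category.assoc, biproduct.lift_π, zero_comp, h1]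
    refine ⟨kernel.lift _ (biproduct.lift a) h0, ?_⟩
    have h1 : precomp (kernel.lift _ (biproduct.lift a) h0).hom e = toLocal ⊤ g := by
      refine localHom_ext_of_cover hc fun i => ?_
      refine (congrArg (precomp (kernel.lift _ (biproduct.lift a) h0).hom) (he i)).trans ?_
      change precomp (kernel.lift _ (biproduct.lift a) h0 ≫ k ≫ biproduct.π R i).hom (ε i) = _
      rw [kernel.lift_ι_assoc, hl]
      exact ha i
    exact congrArg ofLocal h1

lemma isLeftAdjoint_ι (hB : B.IsNCScheme) : B.qcoh.ι.IsLeftAdjoint := by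
  have : ∀ S, HasTerminal (CostructuredArrow B.qcoh.ι S) := fun S => by
    obtain ⟨K, ε, h⟩ := exists_coreflection hB S
    refine (IsTerminal.ofUniqueHom (Y := CostructuredArrow.mk (S := B.qcoh.ι) (Y := K) ε)
      (fun c => CostructuredArrow.homMk ((h c.left).2 c.hom).choose
        ((h c.left).2 c.hom).choose_spec) fun c m => ?_).hasTerminal
    refine CostructuredArrow.hom_ext _ _ ((h c.left).1 ?_)
    exact (CostructuredArrow.w m).trans ((h c.left).2 c.hom).choose_spec.symm
  exact isLeftAdjoint_of_costructuredArrowTerminals _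

end Coreflection

end AlgebraSheaf

/-! ### Adjoint triples of abelian categories: orthogonals, Serre quotients, copresentations -/

section Recollement

open Abelian

variable {𝒜 𝒟 : Type*} [Category* 𝒜] [Category* 𝒟] [Abelian 𝒜] [Abelian 𝒟]
  {F : 𝒟 ⥤ 𝒜} {G : 𝒜 ⥤ 𝒟} {H : 𝒟 ⥤ 𝒜}

/-- The extension pushed out along `t` splits when `t` extends to the middle term. -/
lemma extClass_eq_zero_of_retraction [HasExt 𝒜] {S : ShortComplex 𝒜} (hS : S.ShortExact)
    {Y : 𝒜} {t : S.X₁ ⟶ Y} (r : S.X₂ ⟶ Y) (h : S.f ≫ r = t) :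
    hS.extClass.comp (Ext.mk₀ t) (add_zero 1) = 0 := by
  rw [← h, ← Ext.mk₀_comp_mk₀, hS.extClass_comp_assoc]

/-- If `Hom(A, -)` is exact on an injective copresentation of `K`, then `Ext¹(A, K) = 0`. -/
lemma subsingleton_ext_one [HasExt 𝒜] {S : ShortComplex 𝒜} (hS : S.ShortExact) [Injective S.X₂]
    {A : 𝒜} (h : ∀ φ : A ⟶ S.X₃, (Ext.mk₀ φ).comp hS.extClass (zero_add 1) = 0) :
    Subsingleton (Ext A S.X₁ 1) := by
  refine subsingleton_of_forall_eq 0 fun x => ?_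
  obtain ⟨y, rfl⟩ := Ext.covariant_sequence_exact₁ A hS x (Ext.eq_zero_of_injective _) (zero_add 1)
  obtain ⟨φ, rfl⟩ := Ext.addEquiv₀.symm.surjective y
  exact h φ

lemma exists_shortExact_injective [EnoughInjectives 𝒜] (K : 𝒜) :
    ∃ S : ShortComplex 𝒜, ∃ (_ : S.ShortExact) (_ : Injective S.X₂), S.X₁ = K := by
  obtain ⟨p⟩ := EnoughInjectives.presentation K
  exact ⟨.mk p.f (cokernel.π p.f) (cokernel.condition _),
    { exact := ShortComplex.exact_of_g_is_cokernel _ (cokernelIsCokernel p.f)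
      mono_f := p.mono }, p.injective, rfl⟩

section

variable [PreservesFiniteLimits G] [PreservesFiniteColimits G]

lemma isIso_map_g {S : ShortComplex 𝒜} (hS : S.ShortExact) (h : IsZero (G.obj S.X₁)) :
    IsIso (G.map S.g) := by
  have h1 := hS.map_of_exact G
  have : Epi (G.map S.g) := h1.epi_g
  have : Mono (G.map S.g) := h1.exact.mono_g (h.eq_of_src _ _)
  exact isIso_of_mono_of_epi _

lemma isIso_map_f {S : ShortComplex 𝒜} (hS : S.ShortExact) (h : IsZero (G.obj S.X₃)) :
    IsIso (G.map S.f) := by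
  have h1 := hS.map_of_exact G
  have : Mono (G.map S.f) := h1.mono_f
  have : Epi (G.map S.f) := h1.exact.epi_f (h.eq_of_tgt _ _)
  exact isIso_of_mono_of_epi _

/-- Embed `K` into an injective `I`. Since `G` is exact and kills `K`, the map `G I ⟶ G (I/K)` is
invertible. By adjunction every `F N ⟶ I/K` lifts to `I`, so `Ext¹` vanishes without any use of
projectives. -/
lemma leftOrthogonal_obj [EnoughInjectives 𝒜] (adj : F ⊣ G) (N : 𝒟) :
    leftOrthogonal G.kernel (F.obj N) := fun K hK => by
  have hK : IsZero (G.obj K) := hK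
  refine ⟨⟨fun a b => (adj.homEquiv N K).injective (hK.eq_of_tgt _ _)⟩, ?_⟩
  let _ := HasExt.standard 𝒜
  obtain ⟨S, hS, _, rfl⟩ := exists_shortExact_injective K
  refine subsingleton_ext_one hS fun φ => ?_
  have := isIso_map_g hS hK
  have h1 : (adj.homEquiv N S.X₂).symm (adj.homEquiv N S.X₃ φ ≫ inv (G.map S.g)) ≫ S.g = φ := by
    refine (adj.homEquiv N S.X₃).injective ?_
    rw [adj.homEquiv_naturality_right, Equiv.apply_symm_apply, Category.assoc, IsIso.inv_hom_id,
      Category.comp_id]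
  rw [← h1, ← Ext.mk₀_comp_mk₀_assoc, hS.comp_extClass, Ext.comp_zero]

/-- A class in `Ext¹(K, H N)` is an injective copresentation pulled back along some `φ`. In the
pulled-back extension `G` inverts the inclusion, because it kills `K`; by adjunction maps from the
subobject to `H N` extend, and the extension splits. -/
lemma rightOrthogonal_obj [EnoughInjectives 𝒜] (adj : G ⊣ H) (N : 𝒟) :
    rightOrthogonal G.kernel (H.obj N) := fun K hK => by
  have hK : IsZero (G.obj K) := hK
  refine ⟨⟨fun a b => (adj.homEquiv K N).symm.injective (hK.eq_of_src _ _)⟩, ?_⟩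
  let _ := HasExt.standard 𝒜
  obtain ⟨S, hS, _, hN⟩ := exists_shortExact_injective (H.obj N)
  rw [← hN]
  refine subsingleton_ext_one hS fun φ => ?_
  have := hS.epi_g
  have := hS.mono_f
  -- The pullback along `φ`, an extension of `K`; it maps to `S` by `τ`, so its class pushed along
  -- `τ.τ₁` is the class to be killed.
  let T : ShortComplex 𝒜 := .mk (kernel.ι (pullback.snd S.g φ)) (pullback.snd S.g φ)
    (kernel.condition _)
  have hT : T.ShortExact :=
    { exact := ShortComplex.exact_of_f_is_kernel _ (kernelIsKernel _) }
  have w : (kernel.ι (pullback.snd S.g φ) ≫ pullback.fst S.g φ) ≫ S.g = 0 := by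
    rw [Category.assoc, pullback.condition, kernel.condition_assoc, zero_comp]
  let τ : T ⟶ S :=
    { τ₁ := hS.exact.lift _ w
      τ₂ := pullback.fst _ _
      τ₃ := φ
      comm₁₂ := hS.exact.lift_f _ w
      comm₂₃ := pullback.condition }
  rw [← hT.extClass_naturality hS τ]
  have := isIso_map_f (G := G) hT hK
  let t : T.X₁ ⟶ H.obj N := τ.τ₁ ≫ eqToHom hN
  have h1 : T.f ≫ adj.homEquiv _ _ (inv (G.map T.f) ≫ (adj.homEquiv _ _).symm t) = t := by
    refine (adj.homEquiv _ _).symm.injective ?_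
    rw [adj.homEquiv_naturality_left_symm, Equiv.symm_apply_apply, IsIso.hom_inv_id_assoc]
  refine extClass_eq_zero_of_retraction hT
    (adj.homEquiv _ _ (inv (G.map T.f) ≫ (adj.homEquiv _ _).symm t) ≫ eqToHom hN.symm) ?_
  rw [← Category.assoc, h1, Category.assoc, eqToHom_trans, eqToHom_refl, Category.comp_id]

/-- By the triangle identity `G` inverts the counit, so its kernel and cokernel lie in `Ker G`. The
cokernel vanishes since `M` has no nonzero map to it. The extension of `M` by the kernel splits as
`Ext¹` vanishes, but a retraction `F G M ⟶ kernel` corresponds to a map into `G(kernel) = 0`. -/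
lemma isIso_counit_of_leftOrthogonal (adj : F ⊣ G) [IsIso adj.unit] {M : 𝒜}
    (hM : leftOrthogonal G.kernel M) : IsIso (adj.counit.app M) := by
  let _ := HasExt.standard 𝒜
  have : IsIso (G.map (adj.counit.app M)) := by
    have := adj.right_triangle_components M
    exact IsIso.of_isIso_fac_left this
  have : Epi (adj.counit.app M) := by
    refine Preadditive.epi_of_cokernel_zero ?_
    have hC : G.kernel (cokernel (adj.counit.app M)) :=
      CokernelCofork.IsColimit.isZero_of_epi
        (CokernelCofork.mapIsColimit _ (cokernelIsCokernel (adj.counit.app M)) G)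
    exact (hM _ hC).1.elim _ _
  have hK : G.kernel (kernel (adj.counit.app M)) :=
    KernelFork.IsLimit.isZero_of_mono
      (KernelFork.mapIsLimit _ (kernelIsKernel (adj.counit.app M)) G)
  let S : ShortComplex 𝒜 := .mk (kernel.ι (adj.counit.app M)) (adj.counit.app M)
    (kernel.condition _)
  have hS : S.ShortExact :=
    { exact := ShortComplex.exact_of_f_is_kernel _ (kernelIsKernel _) }
  have he : hS.extClass = 0 := (hM _ hK).2.elim _ _
  obtain ⟨y, hy⟩ := Ext.contravariant_sequence_exact₁ hS _ (Ext.mk₀ (𝟙 S.X₁)) (add_zero 1)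
    (by rw [he, Ext.zero_comp])
  obtain ⟨r, rfl⟩ := Ext.addEquiv₀.symm.surjective y
  have hr : r = 0 := (adj.homEquiv _ _).injective (IsZero.eq_of_tgt hK _ _)
  have h0 : kernel.ι (adj.counit.app M) = 0 := by
    have h1 : Ext.mk₀ (S.f ≫ r) = Ext.mk₀ (𝟙 S.X₁) := (Ext.mk₀_comp_mk₀ _ _).symm.trans hy
    have h2 : S.f ≫ r = 𝟙 S.X₁ := Ext.addEquiv₀.symm.injective h1
    have h3 : 𝟙 (kernel (adj.counit.app M)) = 0 := h2.symm.trans (by rw [hr, comp_zero])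
    rw [← Category.id_comp (kernel.ι (adj.counit.app M)), h3, zero_comp]
  have : Mono (adj.counit.app M) := Preadditive.mono_of_kernel_zero h0
  exact isIso_of_mono_of_epi _

/-- Dual to the counit: the kernel of the unit admits no nonzero map to `M`, and a section of the
split extension would be a map from an object of `Ker G` to `H G M`, hence zero. -/
lemma isIso_unit_of_rightOrthogonal (adj : G ⊣ H) [IsIso adj.counit] {M : 𝒜}
    (hM : rightOrthogonal G.kernel M) : IsIso (adj.unit.app M) := by
  let _ := HasExt.standard 𝒜
  have : IsIso (G.map (adj.unit.app M)) := by
    rw [← IsIso.inv_eq_of_inv_hom_id (adj.left_triangle_components M)]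
    infer_instance
  have : Mono (adj.unit.app M) := by
    refine Preadditive.mono_of_kernel_zero ?_
    have hK : G.kernel (kernel (adj.unit.app M)) :=
      KernelFork.IsLimit.isZero_of_mono
        (KernelFork.mapIsLimit _ (kernelIsKernel (adj.unit.app M)) G)
    exact (hM _ hK).1.elim _ _
  have hC : G.kernel (cokernel (adj.unit.app M)) :=
    CokernelCofork.IsColimit.isZero_of_epi
      (CokernelCofork.mapIsColimit _ (cokernelIsCokernel (adj.unit.app M)) G)
  let S : ShortComplex 𝒜 := .mk (adj.unit.app M) (cokernel.π (adj.unit.app M))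
    (cokernel.condition _)
  have hS : S.ShortExact :=
    { exact := ShortComplex.exact_of_g_is_cokernel _ (cokernelIsCokernel _) }
  have he : hS.extClass = 0 := (hM _ hC).2.elim _ _
  obtain ⟨y, hy⟩ := Ext.covariant_sequence_exact₃ S.X₃ hS (Ext.mk₀ (𝟙 S.X₃)) (zero_add 1)
    (by rw [he, Ext.comp_zero])
  obtain ⟨r, rfl⟩ := Ext.addEquiv₀.symm.surjective y
  have hr : r = 0 := (adj.homEquiv _ _).symm.injective (IsZero.eq_of_src hC _ _)
  have h0 : cokernel.π (adj.unit.app M) = 0 := by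
    have h1 : Ext.mk₀ (r ≫ S.g) = Ext.mk₀ (𝟙 S.X₃) := (Ext.mk₀_comp_mk₀ _ _).symm.trans hy
    have h2 : r ≫ S.g = 𝟙 S.X₃ := Ext.addEquiv₀.symm.injective h1
    have h3 : 𝟙 (cokernel (adj.unit.app M)) = 0 := h2.symm.trans (by rw [hr, zero_comp])
    rw [← Category.comp_id (cokernel.π (adj.unit.app M)), h3, comp_zero]
  have : Epi (adj.unit.app M) := Preadditive.epi_of_cokernel_zero h0
  exact isIso_of_mono_of_epi _

lemma essImage_eq_leftOrthogonal [EnoughInjectives 𝒜] (adj : F ⊣ G) [IsIso adj.unit] :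
    F.essImage = leftOrthogonal G.kernel := by
  ext M
  refine ⟨?_, fun hM => ?_⟩
  · rintro ⟨N, ⟨e⟩⟩ K hK
    have h := leftOrthogonal_obj adj N K hK
    refine ⟨⟨fun a b => ?_⟩, ?_⟩
    · rw [← cancel_epi e.hom]
      exact h.1.elim _ _
    · let _ := HasExt.standard 𝒜
      refine ⟨fun a b => ?_⟩
      have h1 : ∀ a : Ext M K 1,
          (Ext.mk₀ e.inv).comp ((Ext.mk₀ e.hom).comp a (zero_add 1)) (zero_add 1) = a := fun a => by
        rw [Ext.mk₀_comp_mk₀_assoc, e.inv_hom_id, Ext.mk₀_id_comp]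
      rw [← h1 a, ← h1 b, h.2.elim ((Ext.mk₀ e.hom).comp a (zero_add 1))]
  · have := isIso_counit_of_leftOrthogonal adj hM
    exact ⟨G.obj M, ⟨asIso (adj.counit.app M)⟩⟩

lemma essImage_eq_rightOrthogonal [EnoughInjectives 𝒜] (adj : G ⊣ H) [IsIso adj.counit] :
    H.essImage = rightOrthogonal G.kernel := by
  ext M
  refine ⟨?_, fun hM => ?_⟩
  · rintro ⟨N, ⟨e⟩⟩ K hK
    have h := rightOrthogonal_obj adj N K hK
    refine ⟨⟨fun a b => ?_⟩, ?_⟩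
    · rw [← cancel_mono e.inv]
      exact h.1.elim _ _
    · let _ := HasExt.standard 𝒜
      refine ⟨fun a b => ?_⟩
      have h1 : ∀ a : Ext K M 1,
          (a.comp (Ext.mk₀ e.inv) (add_zero 1)).comp (Ext.mk₀ e.hom) (add_zero 1) = a := fun a => by
        rw [Ext.comp_assoc_of_third_deg_zero, Ext.mk₀_comp_mk₀, e.inv_hom_id, Ext.comp_mk₀_id]
      rw [← h1 a, ← h1 b, h.2.elim (a.comp (Ext.mk₀ e.inv) (add_zero 1))]
  · have := isIso_unit_of_rightOrthogonal adj hM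
    exact ⟨G.obj M, ⟨(asIso (adj.unit.app M)).symm⟩⟩

end

/-- A full subcategory on which the counit of a coreflective adjunction is invertible. -/
lemma exists_equivalence_of_isIso_unit {𝒜 𝒟 : Type*} [Category* 𝒜] [Category* 𝒟]
    {F : 𝒟 ⥤ 𝒜} {G : 𝒜 ⥤ 𝒟} (adj : F ⊣ G) [IsIso adj.unit] {Q : ObjectProperty 𝒜}
    (hF : ∀ N, Q (F.obj N)) (hQ : ∀ M, Q M → IsIso (adj.counit.app M)) :
    ∃ e : 𝒟 ≌ Q.FullSubcategory,
      Nonempty (e.functor ⋙ Q.ι ≅ F) ∧ Nonempty (e.inverse ≅ Q.ι ⋙ G) := by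
  refine ⟨.mk (Q.lift F hF) (Q.ι ⋙ G) (asIso adj.unit)
    (NatIso.ofComponents (fun M => ?_) fun {M M'} f => ?_), ⟨Iso.refl _⟩, ⟨Iso.refl _⟩⟩
  · have := hQ M.obj M.property
    exact Q.isoMk (asIso (adj.counit.app M.obj))
  · exact ObjectProperty.hom_ext _ (adj.counit.naturality f.hom)

/-- A full subcategory on which the unit of a reflective adjunction is invertible. -/
lemma exists_equivalence_of_isIso_counit {𝒜 𝒟 : Type*} [Category* 𝒜] [Category* 𝒟]
    {G : 𝒜 ⥤ 𝒟} {H : 𝒟 ⥤ 𝒜} (adj : G ⊣ H) [IsIso adj.counit] {Q : ObjectProperty 𝒜}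
    (hH : ∀ N, Q (H.obj N)) (hQ : ∀ M, Q M → IsIso (adj.unit.app M)) :
    ∃ e : 𝒟 ≌ Q.FullSubcategory,
      Nonempty (e.functor ⋙ Q.ι ≅ H) ∧ Nonempty (e.inverse ≅ Q.ι ⋙ G) := by
  let i : 𝟭 Q.FullSubcategory ≅ (Q.ι ⋙ G) ⋙ Q.lift H hH :=
    NatIso.ofComponents (fun M => by
      have := hQ M.obj M.property
      exact Q.isoMk (asIso (adj.unit.app M.obj)))
      fun {M M'} f => by
        have := hQ M'.obj M'.property
        exact ObjectProperty.hom_ext _ (adj.unit.naturality f.hom)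
  exact ⟨.mk (Q.lift H hH) (Q.ι ⋙ G) (asIso adj.counit).symm i.symm,
    ⟨Iso.refl _⟩, ⟨Iso.refl _⟩⟩

/-- An exact functor with a left adjoint and a fully faithful right adjoint is the quotient functor
by its kernel, which is bilocalizing. -/
lemma exists_isBilocalizing_kernel [PreservesFiniteLimits G] [PreservesFiniteColimits G]
    (adj : F ⊣ G) (adj' : G ⊣ H) [IsIso adj'.counit] :
    ∃ _ : G.kernel.IsSerreClass, IsBilocalizing G.kernel ∧
      ∃ e : G.kernel.isoModSerre.Localization ≌ 𝒟,
        Nonempty (G.kernel.isoModSerre.Q ⋙ e.functor ≅ G) := by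
  have hs : G.kernel.IsSerreClass := inferInstance
  have hf := adj'.fullyFaithfulROfIsIsoCounit
  have := hf.full
  have := hf.faithful
  -- An exact functor with fully faithful right adjoint is the localization at the morphisms it
  -- inverts, here those with kernel and cokernel in `Ker G`.
  have := isLocalization_isoModSerre_kernel_of_leftAdjoint adj'
  let e := Localization.equivalenceFromModel G G.kernel.isoModSerre
  let i : G.kernel.isoModSerre.Q ⋙ e.functor ≅ G :=
    Localization.qCompEquivalenceFromModelFunctorIso G _
  have : G.IsLeftAdjoint := adj'.isLeftAdjoint
  have : G.IsRightAdjoint := adj.isRightAdjoint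
  -- The quotient functor is `G` followed by an equivalence, so it inherits both adjoints of `G`.
  let j : G ⋙ e.inverse ≅ G.kernel.isoModSerre.Q := Functor.isoWhiskerRight i.symm e.inverse ≪≫
    Functor.associator _ _ _ ≪≫ Functor.isoWhiskerLeft _ e.unitIso.symm ≪≫ Functor.rightUnitor _
  exact ⟨hs, ⟨Functor.isLeftAdjoint_of_iso j, Functor.isRightAdjoint_of_iso j⟩, e, ⟨i⟩⟩

/-- Objects in the essential image of a fully faithful right adjoint are those that are copresented
by images of injectives. -/
lemma essImage_iff_injective_copresentation [EnoughInjectives 𝒟] [H.Full] [H.Faithful]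
    [PreservesFiniteLimits H] (M : 𝒜) :
    H.essImage M ↔ ∃ (J₀ J₁ : 𝒟) (i : M ⟶ H.obj J₀) (d : H.obj J₀ ⟶ H.obj J₁) (w : i ≫ d = 0),
      Injective J₀ ∧ Injective J₁ ∧ Mono i ∧ (ShortComplex.mk i d w).Exact := by
  constructor
  · rintro ⟨N, ⟨e⟩⟩
    let c := Injective.ι N
    let d : Injective.under N ⟶ Injective.under (cokernel c) := cokernel.π c ≫ Injective.ι _
    have w : c ≫ d = 0 := by rw [cokernel.condition_assoc, zero_comp]
    let φ : ShortComplex.mk c _ (cokernel.condition c) ⟶ ShortComplex.mk c d w :=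
      { τ₁ := 𝟙 _, τ₂ := 𝟙 _, τ₃ := Injective.ι _ }
    have hS : (ShortComplex.mk c d w).Exact :=
      (ShortComplex.exact_iff_of_epi_of_isIso_of_mono φ).1
        (ShortComplex.exact_of_g_is_cokernel _ (cokernelIsCokernel c))
    have hH := hS.map_of_mono_of_preservesKernel H inferInstance inferInstance
    have w' : (e.inv ≫ H.map c) ≫ H.map d = 0 := by
      rw [Category.assoc, ← H.map_comp, w, H.map_zero, comp_zero]
    let ψ : ShortComplex.mk (e.inv ≫ H.map c) (H.map d) w' ⟶ (ShortComplex.mk c d w).map H :=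
      { τ₁ := e.inv
        τ₂ := 𝟙 _
        τ₃ := 𝟙 _
        comm₁₂ := (Category.comp_id _).symm
        comm₂₃ := (Category.id_comp _).trans (Category.comp_id _).symm }
    have : IsIso ψ.τ₁ := inferInstanceAs (IsIso e.inv)
    have : IsIso ψ.τ₂ := inferInstanceAs (IsIso (𝟙 (H.obj _)))
    have : IsIso ψ.τ₃ := inferInstanceAs (IsIso (𝟙 (H.obj _)))
    exact ⟨_, _, e.inv ≫ H.map c, H.map d, w', inferInstance, inferInstance, inferInstance,
      (ShortComplex.exact_iff_of_epi_of_isIso_of_mono ψ).2 hH⟩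
  · rintro ⟨J₀, J₁, i, d, w, -, -, hi, hd⟩
    -- By fullness the differential comes from `𝒟`. As `H` preserves kernels, `M` and `H (kernel d)`
    -- are kernels of the same map.
    obtain ⟨d, rfl⟩ := H.map_surjective d
    have h1 := (hd.fIsKernel)
    have h2 := KernelFork.mapIsLimit _ (kernelIsKernel d) H
    exact ⟨kernel d, ⟨IsLimit.conePointUniqueUpToIso h2 h1⟩⟩

end Recollement

/-! ### Enough injectives among quasi-coherent modules -/

namespace AlgebraSheaf
open NCSheaf
variable {X : Scheme.{u}} {B : AlgebraSheaf X}

section EnoughInjectives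

lemma appLin_injective_of_mono {M N : B.Mod} (f : M ⟶ N) [Mono f] (U : X.Opens) :
    Function.Injective (appLin f.hom U) := by
  have := B.qcoh.preservesMonomorphisms_ι_of_isNormalEpiCategory
  have : Mono f.hom := inferInstanceAs (Mono (B.qcoh.ι.map f))
  exact injective_of_mono f.hom U

variable [X.IsSeparated]

/-- Coinduction of an injective module is injective. -/
lemma exists_injective_coinduced (hB : B.IsNCScheme) {U : X.Opens} (hU : IsAffineOpen U)
    (E : Type u) [AddCommGroup E] [Module (B.ring.obj.obj (op U)) E]
    [Injective (ModuleCat.of (B.ring.obj.obj (op U)) E)] :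
    ∃ (R : B.Mod) (e : R.obj.val.obj (op U) →ₗ[B.ring.obj.obj (op U)] E), Injective R ∧
      ∀ M : B.Mod, Function.Bijective fun f : M ⟶ R => e.comp (appLin f.hom U) := by
  obtain ⟨R, e, h⟩ := exists_coinduced hB hU E
  refine ⟨R, e, ⟨fun {M N} g f _ => ?_⟩, h⟩
  -- Coinduction is right adjoint to sections over `U`, which preserve monomorphisms; so it
  -- preserves injectives.
  have : Mono (ModuleCat.ofHom (appLin f.hom U)) :=
    (ModuleCat.mono_iff_injective _).2 (appLin_injective_of_mono f U)
  obtain ⟨a, ha⟩ := (h N).2 (Injective.factorThru (J := ModuleCat.of _ E)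
    (ModuleCat.ofHom (e.comp (appLin g.hom U))) (ModuleCat.ofHom (appLin f.hom U))).hom
  refine ⟨a, (h M).1 ?_⟩
  have h1 := congrArg ModuleCat.Hom.hom (Injective.comp_factorThru (J := ModuleCat.of _ E)
    (ModuleCat.ofHom (e.comp (appLin g.hom U))) (ModuleCat.ofHom (appLin f.hom U)))
  refine Eq.trans ?_ h1
  exact congrArg (fun b : _ →ₗ[B.ring.obj.obj (op U)] E => b.comp (appLin f.hom U)) ha

/-- Embed each `N(U i)` into an injective module, for a finite affine cover, and coinduce. The
resulting map from `N` to the sum is mono because a morphism to `N` that vanishes on sections over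
every `U i` is zero. -/
lemma enoughInjectives [CompactSpace X] (hB : B.IsNCScheme) : EnoughInjectives B.Mod := by
  refine ⟨fun N => ?_⟩
  obtain ⟨ι, _, U, hU, hc⟩ := exists_finite_affine_cover X
  let I : ∀ i, ModuleCat (B.ring.obj.obj (op (U i))) := fun i =>
    Injective.under (ModuleCat.of _ (N.obj.val.obj (op (U i))))
  have hI : ∀ i, Injective (ModuleCat.of (B.ring.obj.obj (op (U i))) (I i)) := fun i =>
    inferInstanceAs (Injective (Injective.under _))
  have := fun i => exists_injective_coinduced hB (hU i) (I i)
  choose R e hR h using this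
  have : HasFiniteBiproducts B.Mod := Abelian.hasFiniteBiproducts
  choose a ha using fun i => (h i N).2
    (Injective.ι (ModuleCat.of _ (N.obj.val.obj (op (U i))))).hom
  have hm : Mono (biproduct.lift a) := by
    refine Preadditive.mono_of_cancel_zero _ fun {M} g hg => ?_
    have h1 : ∀ i, g ≫ a i = 0 := fun i => by
      rw [← biproduct.lift_π a i, reassoc_of% hg, zero_comp]
    have h2 : ∀ i, appLin g.hom (U i) = 0 := fun i => by
      refine LinearMap.ext fun m => ?_
      refine (ModuleCat.mono_iff_injective
        (Injective.ι (ModuleCat.of _ (N.obj.val.obj (op (U i)))))).1 inferInstance ?_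
      have h3 := LinearMap.congr_fun (ha i) (appLin g.hom (U i) m)
      refine h3.symm.trans ?_
      have h4 : appLin (g ≫ a i).hom (U i) m = 0 := by rw [h1 i]; rfl
      exact (congrArg (e i) h4).trans ((map_zero _).trans (map_zero _).symm)
    refine ObjectProperty.hom_ext _ (congrArg ofLocal (?_ : toLocal ⊤ g.hom = toLocal ⊤ 0))
    refine localHom_ext_of_cover hc fun i => ?_
    exact topHom_injective (hU i) (M.property.locAt (hU i)) (h2 i)
  exact ⟨⟨⨁ R, inferInstance, biproduct.lift a, hm⟩⟩

end EnoughInjectives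

end AlgebraSheaf

/-! ### Trace maps: the bijection `Hom_A(Hom_B(P, M), N) ≃ Hom_B(M, Hom_A(P^∨, N))` -/

namespace AlgebraSheaf
open NCSheaf
variable {X : Scheme.{u}} {B : AlgebraSheaf X}

section Pairing

variable {P M : SheafOfModules.{u} B.ring} {N : SheafOfModules.{u} (B.minor P).ring} {U : X.Opens}

lemma dualMul_add_right (γ : localHom P (SheafOfModules.unit B.ring) U) (m m' : M.val.obj (op U)) :
    dualMul γ (m + m') = dualMul γ m + dualMul γ m' :=
  localHom_ext fun V x => by
    change ev γ V.2 x • res M V.2 (m + m') = ev γ V.2 x • res M V.2 m + ev γ V.2 x • res M V.2 m'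
    rw [map_add, smul_add]

lemma dualMul_add_left (γ γ' : localHom P (SheafOfModules.unit B.ring) U) (m : M.val.obj (op U)) :
    dualMul (γ + γ') m = dualMul γ m + dualMul γ' m :=
  localHom_ext fun V x => add_smul (ev γ V.2 x) (ev γ' V.2 x) (res M V.2 m)

lemma dualMul_smul (γ : localHom P (SheafOfModules.unit B.ring) U) (b : B.ring.obj.obj (op U))
    (m : M.val.obj (op U)) : dualMul γ (b • m) = dualMul (rightMul P U b γ) m :=
  localHom_ext fun V x => by
    change ev γ V.2 x • res M V.2 (b • m) = (ev γ V.2 x * B.ring.obj.map (homOfLE V.2).op b) •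
      res M V.2 m
    rw [res_smul, mul_smul]

lemma dualMul_res (γ : localHom P (SheafOfModules.unit B.ring) U) (m : M.val.obj (op U))
    {V : X.Opens} (h : V ≤ U) :
    localHomRes P M h (dualMul γ m) = dualMul (localHomRes _ _ h γ) (res M h m) :=
  localHom_ext fun W x => by
    change ev γ (W.2.trans h) x • res M (W.2.trans h) m = ev γ (W.2.trans h) x • res M _ (res M h m)
    rw [res_res]

lemma dualMul_comp (a : (localEnd P U)ᵐᵒᵖ) (γ : localHom P (SheafOfModules.unit B.ring) U)
    (m : M.val.obj (op U)) : dualMul (a • γ) m = a • dualMul γ m := rfl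

/-- The dual basis writes every homomorphism from `P` as a sum of products `γ · m`, so additive maps
on `Hom(P, M)` can be compared on such products. -/
lemma DualBasis.sum_dualMul (d : DualBasis P U) (ψ : localHom P M U) :
    ∑ i, dualMul (d.φ i) (ψ.1 ⟨U, le_rfl⟩ (d.p i)) = ψ :=
  localHom_ext fun V x => by
    rw [AddSubgroup.val_finsetSum, Finset.sum_apply, LinearMap.sum_apply]
    exact (d.apply_eq ψ V.2 x).symm

lemma DualBasis.sum_rightMul (d : DualBasis P U) (γ : localHom P (SheafOfModules.unit B.ring) U) :
    ∑ i, rightMul P U (ev γ le_rfl (d.p i)) (d.φ i) = γ := by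
  refine Eq.trans (Finset.sum_congr rfl fun i _ => ?_) (d.sum_dualMul γ)
  exact localHom_ext fun V x => rfl

/-- The pairing of sections attached to a morphism to `Hom(P^∨, N)`. -/
def pairing (h : M ⟶ (B.homDualSheaf P).obj N) (U : X.Opens) (m : M.val.obj (op U))
    (γ : localHom P (SheafOfModules.unit B.ring) U) : N.val.obj (op U) :=
  (show localHom (dual P) N U from h.val.app (op U) m).1 ⟨U, le_rfl⟩ γ

variable (h : M ⟶ (B.homDualSheaf P).obj N)

lemma pairing_add_left (m m' : M.val.obj (op U)) (γ : localHom P (SheafOfModules.unit B.ring) U) :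
    pairing h U (m + m') γ = pairing h U m γ + pairing h U m' γ :=
  congrArg (fun ψ : localHom (dual P) N U => ψ.1 ⟨U, le_rfl⟩ γ) (map_add (h.val.app (op U)).hom m m')

lemma pairing_sum_right {ι : Type*} (s : Finset ι) (m : M.val.obj (op U))
    (γ : ι → localHom P (SheafOfModules.unit B.ring) U) :
    pairing h U m (∑ i ∈ s, γ i) = ∑ i ∈ s, pairing h U m (γ i) :=
  map_sum ((show localHom (dual P) N U from h.val.app (op U) m).1 ⟨U, le_rfl⟩) γ s

lemma pairing_smul_right (m : M.val.obj (op U)) (a : (localEnd P U)ᵐᵒᵖ)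
    (γ : localHom P (SheafOfModules.unit B.ring) U) :
    pairing h U m (a • γ) =
      (show (B.minor P).ring.obj.obj (op U) from a) • pairing h U m γ :=
  ((show localHom (dual P) N U from h.val.app (op U) m).1 ⟨U, le_rfl⟩).map_smul
    (show (endOp P).obj.obj (op U) from a) (show (dual P).val.obj (op U) from γ)

lemma ring_map_self (h : U ≤ U) (b : B.ring.obj.obj (op U)) :
    B.ring.obj.map (homOfLE h).op b = b :=
  congrArg (fun f => f.hom b) (B.ring.obj.map_id (op U))

lemma pairing_smul_left (b : B.ring.obj.obj (op U)) (m : M.val.obj (op U))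
    (γ : localHom P (SheafOfModules.unit B.ring) U) :
    pairing h U (b • m) γ = pairing h U m (rightMul P U b γ) := by
  refine (congrArg (fun ψ : localHom (dual P) N U => ψ.1 ⟨U, le_rfl⟩ γ)
    ((h.val.app (op U)).hom.map_smul b m)).trans ?_
  change pairing h U m (rightMul P U (B.ring.obj.map (homOfLE le_rfl).op b) γ) = _
  rw [ring_map_self]

lemma apply_eq_pairing {V : X.Opens} (hV : V ≤ U) (m : M.val.obj (op U))
    (γ : localHom P (SheafOfModules.unit B.ring) V) :
    (show localHom (dual P) N U from h.val.app (op U) m).1 ⟨V, hV⟩ γ =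
      pairing h V (res M hV m) γ :=
  (congrArg (fun ψ : localHom (dual P) N V => ψ.1 ⟨V, le_rfl⟩ γ) (app_pres h.val hV m)).symm

lemma pairing_res {V : X.Opens} (hV : V ≤ U) (m : M.val.obj (op U))
    (γ : localHom P (SheafOfModules.unit B.ring) U) :
    pairing h V (res M hV m) (localHomRes _ _ hV γ) = res N hV (pairing h U m γ) :=
  (apply_eq_pairing h hV m _).symm.trans
    (localHom_res (B := B.minor P) (show localHom (dual P) N U from h.val.app (op U) m) le_rfl hV γ)

/-- The value at `ψ` of the homomorphism `Hom(P, M) → N` attached to a pairing. -/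
def DualBasis.trace (d : DualBasis P U) (ψ : localHom P M U) : N.val.obj (op U) :=
  ∑ i, pairing h U (ψ.1 ⟨U, le_rfl⟩ (d.p i)) (d.φ i)

lemma DualBasis.trace_add (d : DualBasis P U) (ψ ψ' : localHom P M U) :
    d.trace h (ψ + ψ') = d.trace h ψ + d.trace h ψ' :=
  (Finset.sum_congr rfl fun _ _ => pairing_add_left h _ _ _).trans Finset.sum_add_distrib

lemma DualBasis.trace_sum (d : DualBasis P U) {ι : Type*} (s : Finset ι)
    (ψ : ι → localHom P M U) : d.trace h (∑ i ∈ s, ψ i) = ∑ i ∈ s, d.trace h (ψ i) :=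
  map_sum (AddMonoidHom.mk' (d.trace h) (d.trace_add h)) ψ s

/-- Expand `γ = ∑ φ i · γ(p i)` and move the scalars `γ(p i)` across the pairing. -/
lemma DualBasis.trace_dualMul (d : DualBasis P U)
    (γ : localHom P (SheafOfModules.unit B.ring) U) (m : M.val.obj (op U)) :
    d.trace h (dualMul γ m) = pairing h U m γ := by
  conv_rhs => rw [← d.sum_rightMul γ, pairing_sum_right]
  refine Finset.sum_congr rfl fun i _ => ?_
  rw [← pairing_smul_left]
  change pairing h U (ev γ le_rfl (d.p i) • res M le_rfl m) (d.φ i) = _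
  rw [res_self]

/-- Traces with respect to either basis agree on products `γ · m`, where both are the pairing, and
these products span. -/
lemma DualBasis.trace_eq (d d' : DualBasis P U) (ψ : localHom P M U) :
    d.trace h ψ = d'.trace h ψ := by
  conv_lhs => rw [← d'.sum_dualMul ψ, trace_sum]
  exact Finset.sum_congr rfl fun i _ => d.trace_dualMul h _ _

lemma DualBasis.trace_smul (d : DualBasis P U) (a : (localEnd P U)ᵐᵒᵖ) (ψ : localHom P M U) :
    d.trace h (a • ψ) = (show (B.minor P).ring.obj.obj (op U) from a) • d.trace h ψ := by
  conv_lhs => rw [← d.sum_dualMul ψ, Finset.smul_sum, trace_sum]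
  refine Eq.trans (Finset.sum_congr rfl fun i _ => ?_)
    (Finset.smul_sum (N := N.val.obj (op U))
      (r := (show (B.minor P).ring.obj.obj (op U) from a))).symm
  rw [← dualMul_comp, trace_dualMul, pairing_smul_right]

lemma DualBasis.trace_res_smul {V : X.Opens} (d : DualBasis P V) (hV : V ≤ U)
    (a : (B.minor P).ring.obj.obj (op U)) (ψ : ((B.homSheaf P).obj M).val.obj (op U))
    (n : N.val.obj (op U)) (hn : d.trace h (localHomRes P M hV ψ) = res N hV n) :
    d.trace h (localHomRes P M hV (show localHom P M U from a • ψ)) = res N hV (a • n) := by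
  have h1 := d.trace_smul h ((localEndRes P hV).op (show (localEnd P U)ᵐᵒᵖ from a))
    (localHomRes P M hV ψ)
  have h2 := res_smul N hV a n
  exact (h1.trans (congrArg (fun n' : N.val.obj (op V) =>
    (B.minor P).ring.obj.map (homOfLE hV).op a • n') hn)).trans h2.symm

lemma DualBasis.trace_restrict (d : DualBasis P U) (ψ : localHom P M U) {V : X.Opens} (hV : V ≤ U) :
    (d.restrict hV).trace h (localHomRes P M hV ψ) = res N hV (d.trace h ψ) := by
  refine Eq.trans (Finset.sum_congr rfl fun i _ => ?_) (map_sum (res N hV) _ _).symm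
  rw [← pairing_res, ← localHom_res]
  rfl

end Pairing

section HomDual

variable (P M : SheafOfModules.{u} B.ring) (N : SheafOfModules.{u} (B.minor P).ring)

variable {P M N} in
/-- The local homomorphism `γ ↦ f(γ · m)`. -/
def toHomDualApp (f : (B.homSheaf P).obj M ⟶ N) (U : X.Opens) (m : M.val.obj (op U)) :
    localHom (dual P) N U :=
  ⟨fun V =>
    { toFun (γ : localHom P (SheafOfModules.unit B.ring) V.1) :=
        appLin (B := B.minor P) f V.1 (dualMul γ (res M V.2 m))
      map_add' (γ γ' : localHom P (SheafOfModules.unit B.ring) V.1) :=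
        (congrArg (appLin (B := B.minor P) f V.1) (dualMul_add_left γ γ' (res M V.2 m))).trans
          (map_add (appLin (B := B.minor P) f V.1) _ _)
      map_smul' a (γ : localHom P (SheafOfModules.unit B.ring) V.1) :=
        (appLin (B := B.minor P) f V.1).map_smul a (dualMul γ (res M V.2 m)) },
    fun V W hW (γ : localHom P (SheafOfModules.unit B.ring) V.1) => by
      refine Eq.trans ?_ (appLin_res (B := B.minor P) f hW (dualMul γ (res M V.2 m)))
      refine congrArg (appLin (B := B.minor P) f W.1) ?_
      refine Eq.trans ?_ (dualMul_res γ (res M V.2 m) hW).symm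
      rw [res_res]
      rfl⟩

/-- The morphism `M → Hom(P^∨, N)`, `m ↦ (γ ↦ f(γ · m))`. -/
def toHomDual (f : (B.homSheaf P).obj M ⟶ N) : M ⟶ (B.homDualSheaf P).obj N where
  val := PresheafOfModules.homMk
    { app U := AddCommGrpCat.ofHom (Y := localHom (dual P) N U.unop) <|
        AddMonoidHom.mk' (toHomDualApp f U.unop) fun m m' => localHom_ext fun V γ => by
          refine Eq.trans (congrArg (appLin (B := B.minor P) f V.1) ?_)
            (map_add (appLin (B := B.minor P) f V.1) (dualMul γ (res M V.2 m))
              (dualMul γ (res M V.2 m')))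
          exact (congrArg (dualMul γ) (map_add (res M V.2) m m')).trans (dualMul_add_right γ _ _)
      naturality U U' h := by
        refine AddCommGrpCat.hom_ext (AddMonoidHom.ext fun m => localHom_ext fun V γ => ?_)
        refine congrArg (fun m' => appLin (B := B.minor P) f V.1 (dualMul γ m')) ?_
        exact res_res M h.unop.le V.2 m }
    (fun U b m => localHom_ext fun V γ => by
      refine congrArg (appLin (B := B.minor P) f V.1) ?_
      refine Eq.trans ?_ (dualMul_smul γ (B.ring.obj.map (homOfLE V.2).op b) (res M V.2 m))
      exact congrArg (dualMul γ) (res_smul M V.2 b m))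

lemma pairing_toHomDual (f : (B.homSheaf P).obj M ⟶ N) (U : X.Opens) (m : M.val.obj (op U))
    (γ : localHom P (SheafOfModules.unit B.ring) U) :
    pairing (toHomDual P M N f) U m γ = appLin (B := B.minor P) f U (dualMul γ m) := by
  change appLin (B := B.minor P) f U (dualMul γ (res M le_rfl m)) = _
  rw [res_self]

variable {P M N}

lemma DualBasis.trace_toHomDual {U : X.Opens} (d : DualBasis P U)
    (f : (B.homSheaf P).obj M ⟶ N) (ψ : localHom P M U) :
    d.trace (toHomDual P M N f) ψ = appLin (B := B.minor P) f U ψ := by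
  refine Eq.trans (Finset.sum_congr rfl fun i _ => pairing_toHomDual P M N f U _ _) ?_
  refine (map_sum (appLin (B := B.minor P) f U) _ _).symm.trans ?_
  exact congrArg (appLin (B := B.minor P) f U) (d.sum_dualMul ψ)

/-- The inverse sends a pairing to the trace `ψ ↦ ∑ ⟨ψ(p i), φ i⟩`. It is defined where dual bases
exist and glues because it does not depend on the basis. `M` and `N` are arbitrary sheaves. -/
lemma toHomDual_bijective (hP : ∀ (V : X.Opens), ∀ x ∈ V, ∃ (W : X.Opens) (_ : W ≤ V), x ∈ W ∧
    Nonempty (DualBasis P W)) : Function.Bijective (toHomDual P M N) := by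
  constructor
  · intro f g h
    refine hom_ext_appLin (B := B.minor P) fun V => LinearMap.ext fun (ψ : localHom P M V) =>
      eq_of_forall_mem fun x hx => ?_
    obtain ⟨W, hW, hxW, ⟨d⟩⟩ := hP V x hx
    refine ⟨W, hW, hxW, ?_⟩
    refine (appLin_res (B := B.minor P) f hW ψ).symm.trans ?_
    refine Eq.trans ?_ (appLin_res (B := B.minor P) g hW ψ)
    refine (d.trace_toHomDual f (localHomRes P M hW ψ)).symm.trans ?_
    rw [h]
    exact d.trace_toHomDual g (localHomRes P M hW ψ)
  · intro h
    -- Quantifying over all dual bases on smaller opens makes the relation stable under restriction,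
    -- and it stays meaningful on opens without a dual basis.
    let r : ∀ V : X.Opens, ((B.homSheaf P).obj M).val.obj (op V) → N.val.obj (op V) → Prop :=
      fun V ψ n => ∀ (W : X.Opens) (hW : W ≤ V) (d : DualBasis P W),
        d.trace h (localHomRes P M hW ψ) = res N hW n
    suffices hr : ∃ φ : localHom ((B.homSheaf P).obj M) N ⊤,
        ∀ (V : {V : X.Opens // V ≤ ⊤}) (m) (n), r V.1 m n → φ.1 V m = n by
      obtain ⟨φ, hφ⟩ := hr
      refine ⟨ofLocal (B := B.minor P) φ, hom_ext_appLin fun V => LinearMap.ext fun m =>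
        localHom_ext (M := dual P) (N := N) fun W γ => ?_⟩
      refine (apply_eq_pairing (toHomDual P M N (ofLocal (B := B.minor P) φ)) W.2 m γ).trans ?_
      refine Eq.trans ?_ (apply_eq_pairing h W.2 m γ).symm
      refine (pairing_toHomDual P M N _ W.1 _ _).trans ?_
      refine hφ ⟨W.1, le_top⟩ (dualMul γ (res M W.2 m)) _ fun W' hW' d => ?_
      refine (congrArg (d.trace h) (dualMul_res γ (res M W.2 m) hW')).trans ?_
      exact (d.trace_dualMul h _ _).trans (pairing_res h hW' (res M W.2 m) γ)
    refine exists_localHom_of_rel (B := B.minor P) ⊤ r ?_ ?_ ?_ ?_ ?_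
    · intro V W _ hW ψ n hr W' hW' d
      rw [res_res]
      exact hr W' (hW'.trans hW) d
    · intro V _ ψ n n' hn hn'
      refine eq_of_forall_mem fun x hx => ?_
      obtain ⟨W, hW, hxW, ⟨d⟩⟩ := hP V x hx
      exact ⟨W, hW, hxW, (hn W hW d).symm.trans (hn' W hW d)⟩
    · intro V _ ψ x hx
      obtain ⟨W, hW, hxW, ⟨d⟩⟩ := hP V x hx
      refine ⟨W, hW, d.trace h (localHomRes P M hW ψ), hxW, fun W' hW' d' => ?_⟩
      refine Eq.trans ?_ (d.trace_restrict h (localHomRes P M hW ψ) hW')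
      exact d'.trace_eq h _ _
    · intro V _ ψ ψ' n n' hn hn' W hW d
      refine (d.trace_add h (localHomRes P M hW ψ) (localHomRes P M hW ψ')).trans ?_
      exact (congrArg₂ (· + ·) (hn W hW d) (hn' W hW d)).trans (map_add (res N hW) n n').symm
    · intro V _ a ψ n hn x hx
      refine ⟨V, le_rfl, hx, fun W hW d => ?_⟩
      have h1 := d.trace_res_smul h hW a ψ n (hn W hW d)
      have h2 := res_self N le_rfl (a • n)
      rw [h2]
      exact h1

end HomDual

end AlgebraSheaf

/-! ### The functors on quasi-coherent modules and their adjunctions -/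

namespace AlgebraSheaf
open NCSheaf
variable {X : Scheme.{u}} {B : AlgebraSheaf X}

section Functors

variable {P : SheafOfModules.{u} B.ring}

/-- The adjunction `P ⊗_A - ⊣ Hom_B(P, -)` on quasi-coherent modules. -/
def tensorHomAdjunctionMod
    (hF : ∀ N : (B.minor P).Mod, B.qcoh ((B.tensorSheaf P).obj N.obj))
    (hG : ∀ M : B.Mod, (B.minor P).qcoh ((B.homSheaf P).obj M.obj)) :
    B.tensorMod P hF ⊣ B.homMod P hG where
  unit :=
    { app N := ObjectProperty.homMk ((B.tensorHomAdjunction P).unit.app N.obj)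
      naturality _ _ f := ObjectProperty.hom_ext _ ((B.tensorHomAdjunction P).unit.naturality f.hom) }
  counit :=
    { app M := ObjectProperty.homMk ((B.tensorHomAdjunction P).counit.app M.obj)
      naturality _ _ f :=
        ObjectProperty.hom_ext _ ((B.tensorHomAdjunction P).counit.naturality f.hom) }
  left_triangle_components N :=
    ObjectProperty.hom_ext _ ((B.tensorHomAdjunction P).left_triangle_components N.obj)
  right_triangle_components M :=
    ObjectProperty.hom_ext _ ((B.tensorHomAdjunction P).right_triangle_components M.obj)

lemma isIso_tensorHomAdjunctionMod_unit
    (hF : ∀ N : (B.minor P).Mod, B.qcoh ((B.tensorSheaf P).obj N.obj))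
    (hG : ∀ M : B.Mod, (B.minor P).qcoh ((B.homSheaf P).obj M.obj))
    (h : ∀ (V : X.Opens), ∀ x ∈ V, ∃ (W : X.Opens) (_ : W ≤ V), x ∈ W ∧
      Nonempty (DualBasis P W)) : IsIso (tensorHomAdjunctionMod hF hG).unit := by
  have : ∀ N, IsIso ((tensorHomAdjunctionMod hF hG).unit.app N) := fun N => by
    have : IsIso ((B.minor P).qcoh.ι.map ((tensorHomAdjunctionMod hF hG).unit.app N)) :=
      isIso_unit (N := N.obj) h
    exact isIso_of_reflects_iso _ (B.minor P).qcoh.ι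
  exact NatIso.isIso_of_isIso_app _

/-- The bijection `Hom_A(Hom_B(P, M), N) ≃ Hom_B(M, Hom_A(P^∨, N))`. -/
def toHomDualEquiv (h : ∀ (V : X.Opens), ∀ x ∈ V, ∃ (W : X.Opens) (_ : W ≤ V), x ∈ W ∧
      Nonempty (DualBasis P W))
    (M : SheafOfModules.{u} B.ring) (N : SheafOfModules.{u} (B.minor P).ring) :
    ((B.homSheaf P).obj M ⟶ N) ≃ (M ⟶ (B.homDualSheaf P).obj N) :=
  Equiv.ofBijective (toHomDual P M N) (toHomDual_bijective h)

lemma toHomDual_comp {M M' : SheafOfModules.{u} B.ring} {N : SheafOfModules.{u} (B.minor P).ring}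
    (g : M' ⟶ M) (f : (B.homSheaf P).obj M ⟶ N) :
    toHomDual P M' N ((B.homSheaf P).map g ≫ f) = g ≫ toHomDual P M N f := by
  refine hom_ext_appLin fun U => LinearMap.ext fun m => localHom_ext (M := dual P) (N := N)
    fun V γ => ?_
  refine congrArg (appLin (B := B.minor P) f V.1) (localHom_ext fun W x => ?_)
  change appLin g W.1 (ev γ W.2 x • res M' W.2 (res M' V.2 m)) =
    ev γ W.2 x • res M W.2 (res M V.2 (appLin g U m))
  rw [map_smul, appLin_res, appLin_res]

variable [X.IsSeparated] [CompactSpace X] (hB : B.IsNCScheme)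

/-- The quasi-coherent coreflection of a sheaf of modules. -/
def coreflector : SheafOfModules.{u} B.ring ⥤ B.Mod :=
  have := isLeftAdjoint_ι hB
  B.qcoh.ι.rightAdjoint

/-- The adjunction between the inclusion of quasi-coherent modules and the coreflection. -/
def coreflectorAdjunction : B.qcoh.ι ⊣ coreflector hB :=
  have := isLeftAdjoint_ι hB
  Adjunction.ofIsLeftAdjoint B.qcoh.ι

variable (P) in
/-- The functor `Hom_A(P^∨, -)` in the quasi-coherent sense. -/
def homDualMod : (B.minor P).Mod ⥤ B.Mod :=
  ((B.minor P).qcoh.ι ⋙ B.homDualSheaf P) ⋙ coreflector hB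

variable (P) in
/-- The natural morphism from the quasi-coherent to the sheaf version of `Hom_A(P^∨, N)`. -/
def homDualModHom : homDualMod P hB ⋙ B.qcoh.ι ⟶ (B.minor P).qcoh.ι ⋙ B.homDualSheaf P where
  app N := (coreflectorAdjunction hB).counit.app ((B.homDualSheaf P).obj N.obj)
  naturality _ _ f := (coreflectorAdjunction hB).counit.naturality ((B.homDualSheaf P).map f.hom)

lemma isQuasicoherentHomDual_homDualMod :
    B.IsQuasicoherentHomDual P (homDualMod P hB) (homDualModHom P hB) := fun M N =>
  (congrArg Function.Bijective (funext fun f => (coreflectorAdjunction hB).homEquiv_counit M _ f)).mp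
    ((coreflectorAdjunction hB).homEquiv M ((B.homDualSheaf P).obj N.obj)).symm.bijective

/-- The counit of a coreflection is invertible at objects that already lie in the subcategory. -/
lemma isIso_homDualModHom_app (N : (B.minor P).Mod)
    (hN : B.qcoh ((B.homDualSheaf P).obj N.obj)) : IsIso ((homDualModHom P hB).app N) :=
  ((coreflectorAdjunction hB).isIso_counit_app_iff_mem_essImage).2
    ⟨⟨_, hN⟩, ⟨Iso.refl _⟩⟩

/-- The bijection on morphisms of the adjunction `Hom_B(P, -) ⊣ Hom_A(P^∨, -)`. -/
def homHomDualEquiv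
    (hG : ∀ M : B.Mod, (B.minor P).qcoh ((B.homSheaf P).obj M.obj))
    (h : ∀ (V : X.Opens), ∀ x ∈ V, ∃ (W : X.Opens) (_ : W ≤ V), x ∈ W ∧
      Nonempty (DualBasis P W)) (M : B.Mod) (N : (B.minor P).Mod) :
    ((B.homMod P hG).obj M ⟶ N) ≃ (M ⟶ (homDualMod P hB).obj N) :=
  (((B.minor P).qcoh.fullyFaithfulι.homEquiv (X := (B.homMod P hG).obj M) (Y := N)).trans
    (toHomDualEquiv h M.obj N.obj)).trans
      ((coreflectorAdjunction hB).homEquiv M ((B.homDualSheaf P).obj N.obj))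

/-- The adjunction `Hom_B(P, -) ⊣ Hom_A(P^∨, -)` on quasi-coherent modules. -/
def homHomDualAdjunction
    (hG : ∀ M : B.Mod, (B.minor P).qcoh ((B.homSheaf P).obj M.obj))
    (h : ∀ (V : X.Opens), ∀ x ∈ V, ∃ (W : X.Opens) (_ : W ≤ V), x ∈ W ∧
      Nonempty (DualBasis P W)) :
    B.homMod P hG ⊣ homDualMod P hB :=
  Adjunction.mkOfHomEquiv
    { homEquiv := homHomDualEquiv hB hG h
      homEquiv_naturality_left_symm {M M' N} g f := by
        refine (Equiv.symm_apply_eq _).2 ?_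
        obtain ⟨k, rfl⟩ := (homHomDualEquiv hB hG h M' N).surjective f
        rw [Equiv.symm_apply_apply]
        refine ((coreflectorAdjunction hB).homEquiv_naturality_left g _).symm.trans ?_
        exact congrArg ((coreflectorAdjunction hB).homEquiv _ _) (toHomDual_comp g.hom k.hom).symm
      homEquiv_naturality_right {M N N'} k g :=
        ((coreflectorAdjunction hB).homEquiv_naturality_right
          (toHomDual P M.obj N.obj k.hom) ((B.homDualSheaf P).map g.hom)) }

end Functors

end AlgebraSheaf

/-! ### Quasi-coherence of `Hom_A(P^∨, N)` in the noetherian case -/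

namespace AlgebraSheaf
open NCSheaf
variable {X : Scheme.{u}} {B : AlgebraSheaf X}

variable (B) in
/-- The action of sections of the structure sheaf on a module over sections of `B`. -/
abbrev scModule (U : X.Opens) (T : Type*) [AddCommGroup T] [Module (B.ring.obj.obj (op U)) T] :
    Module Γ(X, U) T := Module.compHom T (B.sc U)

section FinitelyGenerated

variable {Q N : SheafOfModules.{u} B.ring} {U : X.Opens}

/-- Finitely many generators over `Γ(X, U)` allow one exponent for all sections. -/
lemma exists_smul_topHom_eq_zero (hN : B.LocAt N.val U)
    (hQ : letI := B.scModule U (Q.val.obj (op U)); Module.Finite Γ(X, U) (Q.val.obj (op U)))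
    (f : Γ(X, U)) (ψ : localHom Q N U) (hψ : localHomRes Q N (X.basicOpen_le f) ψ = 0) :
    ∃ k : ℕ, ∀ m, B.sc U (f ^ k) • topHom U ψ m = 0 := by
  let := B.scModule U (Q.val.obj (op U))
  let := B.scModule U (N.val.obj (op U))
  obtain ⟨n, s, hs⟩ := Module.Finite.exists_fin (R := Γ(X, U)) (M := Q.val.obj (op U))
  obtain ⟨k, hk⟩ := hN.exists_forall_smul_eq_zero f (fun i => topHom U ψ (s i)) fun i => by
    refine (localHom_res ψ le_rfl (X.basicOpen_le f) (s i)).symm.trans ?_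
    exact congrArg (fun ψ : localHom Q N (X.basicOpen f) => ψ.1 ⟨_, le_rfl⟩
      (res Q (X.basicOpen_le f) (s i))) hψ
  let g : Q.val.obj (op U) →ₗ[Γ(X, U)] N.val.obj (op U) :=
    ⟨⟨topHom U ψ, map_add _⟩, fun r m => map_smul (topHom U ψ) (B.sc U r) m⟩
  have h0 : f ^ k • g = 0 := LinearMap.ext_on_range hs hk
  exact ⟨k, fun m => LinearMap.congr_fun h0 m⟩

/-- Over a noetherian ring `Q(U)` is finitely presented, so `f ^ k` times the given map extends to a
`Γ(X, U)`-linear map `g` on `U`. Its failure to be `B`-linear is controlled by finitely many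
sections that vanish on `D(f)`, and a further power of `f` removes it. -/
lemma exists_localHom_extension (hB : B.IsNCScheme) (hU : IsAffineOpen U)
    [IsNoetherianRing Γ(X, U)] (hQU : B.LocAt Q.val U) (hN : B.LocAt N.val U)
    (hBU : letI := B.scModule U (B.ring.obj.obj (op U));
      Module.Finite Γ(X, U) (B.ring.obj.obj (op U)))
    (hQ : letI := B.scModule U (Q.val.obj (op U)); Module.Finite Γ(X, U) (Q.val.obj (op U)))
    (f : Γ(X, U)) (ψ' : localHom Q N (X.basicOpen f)) :
    ∃ (k : ℕ) (ψ : localHom Q N U), ∀ m, res N (X.basicOpen_le f) (topHom U ψ m) =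
      B.sc _ (rs (X.basicOpen_le f) (f ^ k)) • topHom _ ψ' (res Q (X.basicOpen_le f) m) := by
  let := B.scModule U (Q.val.obj (op U))
  let := B.scModule U (N.val.obj (op U))
  let := B.scModule U (B.ring.obj.obj (op U))
  let : Module Γ(X, U) (N.val.obj (op (X.basicOpen f))) :=
    Module.compHom _ ((B.sc _).comp (rs (X.basicOpen_le f)))
  obtain ⟨ρ, hρ, _⟩ := hN.isLocalizedModule f
  let g₀ : Q.val.obj (op U) →ₗ[Γ(X, U)] N.val.obj (op (X.basicOpen f)) :=
    ⟨⟨fun m => topHom _ ψ' (res Q (X.basicOpen_le f) m), fun m m' => by rw [map_add, map_add]⟩,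
      fun r m => by
        change topHom _ ψ' (res Q (X.basicOpen_le f) (B.sc U r • m)) =
          B.sc _ (rs (X.basicOpen_le f) r) • topHom _ ψ' (res Q (X.basicOpen_le f) m)
        rw [res_sc, map_smul]⟩
  have : Module.FinitePresentation Γ(X, U) (Q.val.obj (op U)) :=
    Module.finitePresentation_of_finite _ _
  obtain ⟨g, ⟨_, k, rfl⟩, hg⟩ := Module.FinitePresentation.exists_lift_of_isLocalizedModule
    (Submonoid.powers f) ρ g₀
  have hg' : ∀ m, res N (X.basicOpen_le f) (g m) =
      B.sc _ (rs (X.basicOpen_le f) (f ^ k)) • topHom _ ψ' (res Q (X.basicOpen_le f) m) :=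
    fun m => (hρ (g m)).symm.trans (LinearMap.congr_fun hg m)
  -- The defect of `B`-linearity of `g`. It is bilinear over `Γ(X, U)`, so it is determined on pairs
  -- of generators of `B(U)` and `Q(U)`.
  let δ : B.ring.obj.obj (op U) →ₗ[Γ(X, U)] Q.val.obj (op U) →ₗ[Γ(X, U)] N.val.obj (op U) :=
    LinearMap.mk₂ Γ(X, U) (fun b m => g (b • m) - b • g m)
      (fun b b' m => by rw [add_smul, add_smul, map_add]; abel)
      (fun r b m => by
        change g ((B.sc U r * b) • m) - (B.sc U r * b) • g m = B.sc U r • (g (b • m) - b • g m)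
        rw [mul_smul, mul_smul, smul_sub]
        exact congrArg (· - _) (map_smul g r (b • m)))
      (fun b m m' => by rw [smul_add, map_add, map_add, smul_add]; abel)
      (fun r b m => by
        change g (b • B.sc U r • m) - b • g (r • m) = B.sc U r • (g (b • m) - b • g m)
        rw [g.map_smul, ← sc_smul_comm Q.val, smul_sub]
        exact congrArg₂ (· - ·) (map_smul g r (b • m)) (sc_smul_comm N.val r b (g m)).symm)
  have hδ : ∀ b m, res N (X.basicOpen_le f) (δ b m) = 0 := fun b m => by
    change res N (X.basicOpen_le f) (g (b • m) - b • g m) = 0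
    rw [map_sub, res_smul, hg', hg', res_smul, map_smul, sub_eq_zero]
    exact sc_smul_comm N.val _ _ _
  obtain ⟨n, s, hs⟩ := Module.Finite.exists_fin (R := Γ(X, U)) (M := B.ring.obj.obj (op U))
  obtain ⟨n', s', hs'⟩ := Module.Finite.exists_fin (R := Γ(X, U)) (M := Q.val.obj (op U))
  obtain ⟨l, hl⟩ := hN.exists_forall_smul_eq_zero f (fun i : Fin n × Fin n' => δ (s i.1) (s' i.2))
    fun i => hδ _ _
  have h0 : f ^ l • δ = 0 := LinearMap.ext_on_range hs fun i =>
    LinearMap.ext_on_range hs' fun j => hl (i, j)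
  obtain ⟨ψ, hψ⟩ := topHom_surjective hB hU hQU (N := N)
    { toFun m := B.sc U (f ^ l) • g m
      map_add' m m' := by rw [map_add, smul_add]
      map_smul' b m := by
        have h1 : B.sc U (f ^ l) • (g (b • m) - b • g m) = 0 :=
          LinearMap.congr_fun (LinearMap.congr_fun h0 b) m
        rw [smul_sub, sub_eq_zero] at h1
        exact h1.trans (sc_smul_comm N.val (f ^ l) b (g m)) }
  refine ⟨k + l, ψ, fun m => ?_⟩
  rw [hψ]
  change res N (X.basicOpen_le f) (B.sc U (f ^ l) • g m) = _
  rw [res_sc, hg', ← sc_mul_smul, ← map_mul, ← pow_add, add_comm]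

end FinitelyGenerated

section Noetherian

variable {P : SheafOfModules.{u} B.ring} {N : SheafOfModules.{u} (B.minor P).ring} {U : X.Opens}

/-- The action through `B` multiplies forms on the right by a function. Centrality turns this into
the action of the function through `End P`, which `ψ` carries over to `N`. -/
lemma homDual_sc_apply (f : Γ(X, U)) (ψ : localHom (dual P) N U) {V : X.Opens} (h : V ≤ U)
    (γ : localHom P (SheafOfModules.unit B.ring) V) :
    (show localHom (dual P) N U from B.sc U f •
      (show ((B.homDualSheaf P).obj N).val.obj (op U) from ψ)).1 ⟨V, h⟩ γ =
        (B.minor P).sc V (rs h f) • (show N.val.obj (op V) from ψ.1 ⟨V, h⟩ γ) := by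
  refine Eq.trans ?_ ((ψ.1 ⟨V, h⟩).map_smul ((B.minor P).sc V (rs h f)) γ)
  refine congrArg (ψ.1 ⟨V, h⟩) (localHom_ext fun W x => ?_)
  change ev γ W.2 x * B.ring.obj.map (homOfLE W.2).op (B.ring.obj.map (homOfLE h).op (B.sc U f)) =
    ev γ W.2 (B.sc _ (rs W.2 (rs h f)) • x)
  rw [sc_res, sc_res, ev_smul]
  exact (B.central _ _ _).symm

lemma DualBasis.finite (hBU : letI := B.scModule U (B.ring.obj.obj (op U));
      Module.Finite Γ(X, U) (B.ring.obj.obj (op U))) (d : DualBasis P U) :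
    letI := B.scModule U (P.val.obj (op U)); Module.Finite Γ(X, U) (P.val.obj (op U)) := by
  let := B.scModule U (P.val.obj (op U))
  let := B.scModule U (B.ring.obj.obj (op U))
  let g : (Fin d.n → B.ring.obj.obj (op U)) →ₗ[Γ(X, U)] P.val.obj (op U) :=
    { toFun b := ∑ i, b i • d.p i
      map_add' b b' := by simp only [Pi.add_apply, add_smul, Finset.sum_add_distrib]
      map_smul' r b := by
        rw [RingHom.id_apply, Finset.smul_sum]
        exact Finset.sum_congr rfl fun i _ => mul_smul (B.sc U r) (b i) (d.p i) }
  refine Module.Finite.of_surjective g fun x => ⟨fun i => ev (d.φ i) le_rfl x, ?_⟩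
  change ∑ i, ev (d.φ i) le_rfl x • d.p i = x
  conv_rhs => rw [← d.sum_eq U le_rfl x]
  exact Finset.sum_congr rfl fun i _ => by rw [res_self]

/-- Evaluation on the `p i` embeds `Hom(P, M)` into a finite power of `M(U)`, a noetherian module.
-/
lemma DualBasis.finite_hom [IsNoetherianRing Γ(X, U)] (d : DualBasis P U) {M : SheafOfModules.{u} B.ring}
    (hM : letI := B.scModule U (M.val.obj (op U)); Module.Finite Γ(X, U) (M.val.obj (op U))) :
    letI := (B.minor P).scModule U (((B.homSheaf P).obj M).val.obj (op U))
    Module.Finite Γ(X, U) (((B.homSheaf P).obj M).val.obj (op U)) := by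
  let := B.scModule U (M.val.obj (op U))
  let := (B.minor P).scModule U (((B.homSheaf P).obj M).val.obj (op U))
  let g : ((B.homSheaf P).obj M).val.obj (op U) →ₗ[Γ(X, U)] (Fin d.n → M.val.obj (op U)) :=
    { toFun (ψ : localHom P M U) := fun i => ψ.1 ⟨U, le_rfl⟩ (d.p i)
      map_add' _ _ := rfl
      map_smul' r ψ := funext fun i => (hom_sc_apply P M r ψ le_rfl (d.p i)).trans (by
        rw [rs_self]; rfl) }
  exact Module.Finite.of_injective g fun ψ ψ' h => d.hom_ext (congrFun h)

lemma finite_minor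
    (h : letI := (B.minor P).scModule U (((B.homSheaf P).obj P).val.obj (op U))
      Module.Finite Γ(X, U) (((B.homSheaf P).obj P).val.obj (op U))) :
    letI := (B.minor P).scModule U ((B.minor P).ring.obj.obj (op U))
    Module.Finite Γ(X, U) ((B.minor P).ring.obj.obj (op U)) := by
  let := (B.minor P).scModule U (((B.homSheaf P).obj P).val.obj (op U))
  let := (B.minor P).scModule U ((B.minor P).ring.obj.obj (op U))
  let g : ((B.homSheaf P).obj P).val.obj (op U) →ₗ[Γ(X, U)] (B.minor P).ring.obj.obj (op U) :=
    { toFun (ψ : localHom P P U) := MulOpposite.op (show localEnd P U from ψ)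
      map_add' _ _ := rfl
      map_smul' _ _ := rfl }
  exact Module.Finite.of_surjective g fun (a : (localEnd P U)ᵐᵒᵖ) => ⟨a.unop, rfl⟩

/-- The two finiteness lemmas above, applied to the algebra `A` and to homomorphisms from `P^∨` to
`N`. -/
lemma locAt_homDual (hA : (B.minor P).IsNCScheme) (hU : IsAffineOpen U)
    [IsNoetherianRing Γ(X, U)] (hQ : (B.minor P).qcoh (dual P)) (hN : (B.minor P).LocAt N.val U)
    (hAU : letI := (B.minor P).scModule U ((B.minor P).ring.obj.obj (op U))
      Module.Finite Γ(X, U) ((B.minor P).ring.obj.obj (op U)))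
    (hQU :
      letI := (B.minor P).scModule U
        (((B.homSheaf P).obj (SheafOfModules.unit B.ring)).val.obj (op U))
      Module.Finite Γ(X, U) (((B.homSheaf P).obj (SheafOfModules.unit B.ring)).val.obj (op U))) :
    B.LocAt ((B.homDualSheaf P).obj N).val U := by
  refine fun f => ⟨fun (ψ : localHom (dual P) N U) hψ => ?_,
    fun (ψ' : localHom (dual P) N (X.basicOpen f)) => ?_⟩
  · obtain ⟨k, hk⟩ := exists_smul_topHom_eq_zero (B := B.minor P) hN hQU f ψ hψ
    refine ⟨k, topHom_injective (B := B.minor P) (M := dual P) (N := N) hU (hQ.locAt hU)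
      (LinearMap.ext fun γ => ?_)⟩
    refine (homDual_sc_apply (f ^ k) ψ le_rfl γ).trans ?_
    rw [rs_self]
    exact hk γ
  · obtain ⟨k, ψ, hψ⟩ := exists_localHom_extension (B := B.minor P) hA hU (hQ.locAt hU) hN hAU hQU
      f ψ'
    refine ⟨k, ψ, topHom_injective (B := B.minor P) (M := dual P) (N := N)
      (hU.basicOpen f) (hQ.locAt (hU.basicOpen f)) (LinearMap.ext fun γ' => ?_)⟩
    -- `hψ` speaks only of restrictions of sections over `U`; a general section over `D(f)` is
    -- reached as a fraction with invertible denominator `f ^ l`.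
    obtain ⟨l, γ, hγ⟩ := (hQ.locAt hU f).2 γ'
    have hu : IsUnit (rs (X.basicOpen_le f) (f ^ l)) := by
      rw [map_pow]; exact (isUnit_rs (le_refl (X.basicOpen f))).pow l
    refine Eq.trans ?_ (homDual_sc_apply (rs (X.basicOpen_le f) (f ^ k)) ψ' le_rfl γ').symm
    refine sc_smul_injective N.val hu ?_
    have h1 : topHom _ (localHomRes (dual P) N (X.basicOpen_le f) ψ)
        (res (dual P) (X.basicOpen_le f) γ) = res N (X.basicOpen_le f) (topHom U ψ γ) :=
      localHom_res (B := B.minor P) ψ le_rfl (X.basicOpen_le f) γ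
    have hγ' : res (dual P) (X.basicOpen_le f) γ =
      (B.minor P).sc _ (rs (X.basicOpen_le f) (f ^ l)) • γ' := hγ
    rw [hψ γ, hγ'] at h1
    have h2 := (topHom _ (localHomRes (dual P) N (X.basicOpen_le f) ψ)).map_smul
      ((B.minor P).sc _ (rs (X.basicOpen_le f) (f ^ l))) γ'
    have h3 := (topHom _ ψ').map_smul ((B.minor P).sc _ (rs (X.basicOpen_le f) (f ^ l))) γ'
    have h4 := congrArg (topHom (B := B.minor P) (M := dual P) (N := N) _ ψ') hγ'
    refine h2.symm.trans (h1.trans ?_)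
    refine (congrArg ((B.minor P).sc _ (rs (X.basicOpen_le f) (f ^ k)) • ·)
      (h4.trans h3)).trans ?_
    rw [rs_self]
    exact sc_smul_comm N.val _ _ _

lemma qcoh_homDual (hB : B.IsNoetherian) (hP : B.qcoh P) (h : B.IsLocallyFGProjective P)
    (hN : (B.minor P).qcoh N) : B.qcoh ((B.homDualSheaf P).obj N) := by
  obtain ⟨_, hB', hfin⟩ := hB
  refine qcoh_of_locAt fun x => ?_
  obtain ⟨W, -, hx, hW, ⟨d⟩⟩ := h.exists_dualBasis hB' hP (V := ⊤) (x := x) trivial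
  have : IsNoetherianRing Γ(X, W) := IsLocallyNoetherian.component_noetherian ⟨W, hW⟩
  have h1 : letI := B.scModule W (B.ring.obj.obj (op W))
      Module.Finite Γ(X, W) (B.ring.obj.obj (op W)) := hfin W hW
  exact ⟨W, hx, hW, locAt_homDual (isNCScheme_minor hB' hP h) hW (qcoh_hom hB' hP h hB')
    (hN.locAt hW) (finite_minor (d.finite_hom (d.finite h1)))
    (d.finite_hom (M := SheafOfModules.unit B.ring) h1)⟩

end Noetherian

end AlgebraSheaf

/-! ### Stalks of sheaves of modules -/

namespace NCSheaf

section Stalk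

variable {X : TopCat.{u}} {R : Sheaf (Opens.grothendieckTopology X) RingCat.{u}}
  {M N : SheafOfModules.{u} R} {U V W : Opens X} {x : X}

/-- The germ of a section of a sheaf of modules. -/
def germ (M : SheafOfModules.{u} R) (hx : x ∈ U) : M.val.obj (op U) →+ stalk M x :=
  (TopCat.Presheaf.germ (C := Ab.{u}) M.val.presheaf U x hx).hom

/-- The germ of a section of a sheaf of rings. -/
def ringGerm (R : Sheaf (Opens.grothendieckTopology X) RingCat.{u}) (hx : x ∈ U) :
    R.obj.obj (op U) →+* ringStalk R x :=
  (TopCat.Presheaf.germ (C := RingCat.{u}) R.obj U x hx).hom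

lemma germ_smul (hx : x ∈ U) (r : R.obj.obj (op U)) (m : M.val.obj (op U)) :
    germ M hx (r • m) = ringGerm R hx r • germ M hx m :=
  M.val.germ_ringCat_smul x U hx r m

lemma germ_res (h : V ≤ U) (hx : x ∈ V) (m : M.val.obj (op U)) :
    germ M hx (res M h m) = germ M (h hx) m :=
  TopCat.Presheaf.germ_res_apply (C := Ab.{u}) M.val.presheaf (homOfLE h) x hx m

lemma ringGerm_res (h : V ≤ U) (hx : x ∈ V) (r : R.obj.obj (op U)) :
    ringGerm R hx (R.obj.map (homOfLE h).op r) = ringGerm R (h hx) r :=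
  TopCat.Presheaf.germ_res_apply (C := RingCat.{u}) R.obj (homOfLE h) x hx r

lemma exists_germ_eq (hV : x ∈ V) (s : stalk M x) :
    ∃ (U : Opens X) (_ : U ≤ V) (hx : x ∈ U) (m : M.val.obj (op U)), germ M hx m = s := by
  obtain ⟨U, hx, m, rfl⟩ := TopCat.Presheaf.exists_germ_eq (C := Ab.{u}) M.val.presheaf s
  exact ⟨U ⊓ V, inf_le_right, ⟨hx, hV⟩, res M inf_le_left m, germ_res _ _ _⟩

lemma exists_ringGerm_eq (r : ringStalk R x) :
    ∃ (U : Opens X) (hx : x ∈ U) (b : R.obj.obj (op U)), ringGerm R hx b = r :=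
  TopCat.Presheaf.exists_germ_eq (C := RingCat.{u}) R.obj r

lemma exists_res_eq_of_germ_eq (hU : x ∈ U) (hV : x ∈ V) {m : M.val.obj (op U)}
    {m' : M.val.obj (op V)} (h : germ M hU m = germ M hV m') :
    ∃ (W : Opens X) (_ : x ∈ W) (h : W ≤ U) (h' : W ≤ V), res M h m = res M h' m' := by
  obtain ⟨W, hx, i, i', h⟩ := TopCat.Presheaf.germ_eq (C := Ab.{u}) M.val.presheaf x hU hV m m' h
  exact ⟨W, hx, i.le, i'.le, h⟩

lemma exists_res_eq_zero_of_germ_eq_zero (hU : x ∈ U) {m : M.val.obj (op U)}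
    (h : germ M hU m = 0) : ∃ (W : Opens X) (_ : x ∈ W) (h : W ≤ U), res M h m = 0 := by
  obtain ⟨W, hx, i, i', h⟩ := exists_res_eq_of_germ_eq hU hU (m' := 0) (h.trans (map_zero _).symm)
  exact ⟨W, hx, i, h.trans (map_zero _)⟩

/-- Compatible homomorphisms on the sections over the neighbourhoods of `x` inside `V` induce a
homomorphism on the stalk. -/
lemma exists_stalk_lift (hV : x ∈ V) {T : Type u} [AddCommGroup T] [Module (ringStalk R x) T]
    (f : ∀ (U : Opens X) (_ : U ≤ V) (_ : x ∈ U), M.val.obj (op U) →+ T)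
    (hf : ∀ (U : Opens X) (h : U ≤ V) (hx : x ∈ U) (r : R.obj.obj (op U)) (m : M.val.obj (op U)),
      f U h hx (r • m) = ringGerm R hx r • f U h hx m)
    (hr : ∀ (U W : Opens X) (h : U ≤ V) (h' : W ≤ U) (hx : x ∈ W) (m : M.val.obj (op U)),
      f W (h'.trans h) hx (res M h' m) = f U h (h' hx) m) :
    ∃ g : stalk M x →ₗ[ringStalk R x] T, ∀ (U : Opens X) (h : U ≤ V) (hx : x ∈ U)
      (m : M.val.obj (op U)), g (germ M hx m) = f U h hx m := by
  choose U hU hx m hm using fun s : stalk M x => exists_germ_eq hV s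
  -- Independence of the chosen representative of a germ; additivity and linearity then follow by
  -- taking representatives on a common neighbourhood.
  have key' : ∀ (s : stalk M x) (W : Opens X) (h : W ≤ V) (hxW : x ∈ W) (n : M.val.obj (op W)),
      germ M hxW n = s → f _ (hU s) (hx s) (m s) = f W h hxW n := by
    intro s W h hxW n hn
    obtain ⟨W', hx', i, i', e⟩ := exists_res_eq_of_germ_eq _ _ ((hm s).trans hn.symm)
    rw [← hr _ W' (hU s) i hx', ← hr _ W' h i' hx', e]
  have key (W : Opens X) (h : W ≤ V) (hxW : x ∈ W) (n : M.val.obj (op W)) :=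
    key' _ W h hxW n rfl
  refine ⟨
    { toFun s := f _ (hU s) (hx s) (m s)
      map_add' s t := ?_
      map_smul' r s := ?_ }, key⟩
  · obtain ⟨U₁, h₁, hx₁, m₁, rfl⟩ := exists_germ_eq hV s
    obtain ⟨U₂, h₂, hx₂, m₂, rfl⟩ := exists_germ_eq hx₁ t
    rw [← germ_res h₂ hx₂, ← map_add, key U₂ (h₂.trans h₁), key U₂ (h₂.trans h₁),
      key U₂ (h₂.trans h₁), map_add]
  · obtain ⟨U₁, hx₁, b, rfl⟩ := exists_ringGerm_eq r
    obtain ⟨U₂, h₂, hx₂, m₂, rfl⟩ := exists_germ_eq (show x ∈ U₁ ⊓ V from ⟨hx₁, hV⟩) s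
    rw [← ringGerm_res (h₂.trans inf_le_left) hx₂, ← germ_smul, key U₂ (h₂.trans inf_le_right),
      key U₂ (h₂.trans inf_le_right), hf, RingHom.id_apply]

lemma exists_stalkHom (ψ : localHom M N V) (hV : x ∈ V) :
    ∃ f : stalk M x →ₗ[ringStalk R x] stalk N x, ∀ (U : Opens X) (h : U ≤ V) (hx : x ∈ U)
      (m : M.val.obj (op U)), f (germ M hx m) = germ N hx (ψ.1 ⟨U, h⟩ m) :=
  exists_stalk_lift hV (fun U h hx => (germ N hx).comp (ψ.1 ⟨U, h⟩).toAddMonoidHom)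
    (fun U h hx r m => (congrArg (germ N hx) (map_smul (ψ.1 ⟨U, h⟩) r m)).trans (germ_smul _ _ _))
    (fun U W h h' hx m => (congrArg (germ N hx)
      (ψ.2 ⟨U, h⟩ ⟨W, h'.trans h⟩ h' m)).trans (germ_res _ _ _))

/-- A local homomorphism to the structure sheaf of rings induces a linear form on the stalk. -/
lemma exists_stalkForm (ψ : localHom M (SheafOfModules.unit R) V) (hV : x ∈ V) :
    ∃ f : stalk M x →ₗ[ringStalk R x] ringStalk R x, ∀ (U : Opens X) (h : U ≤ V) (hx : x ∈ U)
      (m : M.val.obj (op U)), f (germ M hx m) = ringGerm R hx (ψ.1 ⟨U, h⟩ m) :=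
  exists_stalk_lift hV (fun U h hx => (ringGerm R hx).toAddMonoidHom.comp
      (ψ.1 ⟨U, h⟩).toAddMonoidHom)
    (fun U h hx r m => (congrArg (ringGerm R hx) (map_smul (ψ.1 ⟨U, h⟩) r m)).trans
      (map_mul (ringGerm R hx) r _))
    (fun U W h h' hx m => (congrArg (ringGerm R hx)
      (ψ.2 ⟨U, h⟩ ⟨W, h'.trans h⟩ h' m)).trans (ringGerm_res _ _ _))

/-- The homomorphism of stalks induced by a local homomorphism. -/
def stalkHom (ψ : localHom M N V) (hV : x ∈ V) : stalk M x →ₗ[ringStalk R x] stalk N x :=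
  (exists_stalkHom ψ hV).choose

lemma stalkHom_germ (ψ : localHom M N V) (hV : x ∈ V) (h : U ≤ V) (hx : x ∈ U)
    (m : M.val.obj (op U)) : stalkHom ψ hV (germ M hx m) = germ N hx (ψ.1 ⟨U, h⟩ m) :=
  (exists_stalkHom ψ hV).choose_spec U h hx m

lemma stalkHom_ext {f g : stalk M x →ₗ[ringStalk R x] stalk N x} (hV : x ∈ V)
    (h : ∀ (U : Opens X) (_ : U ≤ V) (hx : x ∈ U) (m : M.val.obj (op U)),
      f (germ M hx m) = g (germ M hx m)) : f = g :=
  LinearMap.ext fun s => by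
    obtain ⟨U, hU, hx, m, rfl⟩ := exists_germ_eq hV s
    exact h U hU hx m

lemma stalkHom_localHomRes (ψ : localHom M N U) (h : V ≤ U) (hV : x ∈ V) :
    stalkHom (localHomRes M N h ψ) hV = stalkHom ψ (h hV) :=
  stalkHom_ext hV fun W hW hx m => by
    rw [stalkHom_germ _ _ hW, stalkHom_germ _ _ (hW.trans h)]
    rfl

lemma stalkHom_add (ψ ψ' : localHom M N U) (hU : x ∈ U) :
    stalkHom (ψ + ψ') hU = stalkHom ψ hU + stalkHom ψ' hU :=
  stalkHom_ext hU fun W hW hx m => by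
    rw [LinearMap.add_apply, stalkHom_germ _ _ hW, stalkHom_germ _ _ hW, stalkHom_germ _ _ hW,
      ← map_add]
    rfl

end Stalk

end NCSheaf

/-! ### Modules presented by multiples of a projective module -/

namespace NCSheaf

section Presented

variable {S P E M : Type u} [Ring S] [AddCommGroup P] [Module S P] [AddCommGroup E] [Module S E]
  [AddCommGroup M] [Module S M]

/-- A homomorphism to a module presented by multiples of `P` is bijective if it induces a bijection
on homomorphisms from `P` and its source is generated by `P`. -/
lemma IsPresentedByMultiples.bijective [Module.Projective S P] (hM : IsPresentedByMultiples S P M)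
    (c : E →ₗ[S] M) (hi : ∀ u : P →ₗ[S] E, c ∘ₗ u = 0 → u = 0)
    (hs : ∀ v : P →ₗ[S] M, ∃ u : P →ₗ[S] E, c ∘ₗ u = v)
    (hE : ⨆ u : P →ₗ[S] E, LinearMap.range u = ⊤) : Function.Bijective c := by
  obtain ⟨I₁, I₀, f, g, hfg, hg⟩ := hM
  choose u hu using fun i : I₀ => hs (g ∘ₗ Finsupp.lsingle i)
  -- A lift of the presentation map `g` through `c`, built one copy of `P` at a time.
  let τ : (I₀ →₀ P) →ₗ[S] E := Finsupp.lsum ℕ u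
  have hcτ : c ∘ₗ τ = g := Finsupp.lhom_ext' fun i => by
    rw [← hu]
    refine LinearMap.ext fun q => ?_
    simp [τ]
  -- Any `v : P → E` factors through `τ`: lift `c ∘ v` along `g` by projectivity, and the difference
  -- dies by injectivity on maps from `P`. Such `v` generate `E`.
  have hτ : Function.Surjective τ := by
    rw [← LinearMap.range_eq_top, eq_top_iff, ← hE]
    refine iSup_le fun v => ?_
    obtain ⟨w, hw⟩ := Module.projective_lifting_property g (c ∘ₗ v) hg
    have : v - τ ∘ₗ w = 0 := hi _ (by
      rw [LinearMap.comp_sub, ← LinearMap.comp_assoc, hcτ, hw, sub_self])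
    rw [sub_eq_zero.1 this]
    exact LinearMap.range_comp_le_range w τ
  -- So `τ` factors through the cokernel of `f`, which is `M`, and this inverts `c`.
  have hτf : τ ∘ₗ f = 0 := Finsupp.lhom_ext' fun j => by
    rw [LinearMap.zero_comp]
    refine hi _ (LinearMap.ext fun q => ?_)
    exact (LinearMap.congr_fun hcτ _).trans (hfg.apply_apply_eq_zero _)
  refine ⟨(injective_iff_map_eq_zero c).2 fun e he => ?_, fun m => ?_⟩
  · obtain ⟨z, rfl⟩ := hτ e
    obtain ⟨y, rfl⟩ := (hfg z).1 ((LinearMap.congr_fun hcτ z).symm.trans he)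
    exact LinearMap.congr_fun hτf y
  · obtain ⟨z, rfl⟩ := hg m
    exact ⟨τ z, LinearMap.congr_fun hcτ z⟩

variable (S P M) in
/-- The evaluation map from the direct sum of copies of `P` indexed by `Hom(P, M)`. -/
def evaluation : ((P →ₗ[S] M) →₀ P) →ₗ[S] M := Finsupp.lsum ℕ id

lemma evaluation_single (f : P →ₗ[S] M) (q : P) : evaluation S P M (Finsupp.single f q) = f q := by
  simp [evaluation]

variable (S P M) in
/-- The submodule generated by the images of the homomorphisms from `P` to the kernel of the
evaluation map. -/
def evaluationRel : Submodule S ((P →ₗ[S] M) →₀ P) :=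
  ⨆ h : {h : P →ₗ[S] (P →ₗ[S] M) →₀ P // evaluation S P M ∘ₗ h = 0}, LinearMap.range h.1

lemma mem_evaluationRel {h : P →ₗ[S] (P →ₗ[S] M) →₀ P} (w : ∀ q, evaluation S P M (h q) = 0) (q : P) :
    h q ∈ evaluationRel S P M :=
  Submodule.mem_iSup_of_mem ⟨h, LinearMap.ext w⟩ ⟨q, rfl⟩

lemma evaluationRel_le : evaluationRel S P M ≤ LinearMap.ker (evaluation S P M) :=
  iSup_le fun h => LinearMap.range_le_ker_iff.2 h.2

/-- The canonical presentation: `P₀` has one copy of `P` for each map `P → M`, and `P₁` one for each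
map from `P` to the kernel of evaluation. -/
lemma isPresentedByMultiples_of_ker_le (hs : Function.Surjective (evaluation S P M))
    (hk : LinearMap.ker (evaluation S P M) ≤ evaluationRel S P M) : IsPresentedByMultiples S P M := by
  refine ⟨{h : P →ₗ[S] (P →ₗ[S] M) →₀ P // evaluation S P M ∘ₗ h = 0}, P →ₗ[S] M,
    Finsupp.lsum ℕ Subtype.val, evaluation S P M, LinearMap.exact_iff.2 (le_antisymm ?_ ?_), hs⟩
  · refine hk.trans (iSup_le fun h => ?_)
    rintro _ ⟨q, rfl⟩
    exact ⟨Finsupp.single h q, by simp⟩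
  · rw [LinearMap.range_le_ker_iff]
    refine Finsupp.lhom_ext' fun h => ?_
    refine LinearMap.ext fun q => ?_
    simpa using LinearMap.congr_fun h.2 q

end Presented

end NCSheaf

/-! ### Dual bases on stalks -/

namespace AlgebraSheaf

open NCSheaf

variable {X : Scheme.{u}} {B : AlgebraSheaf X} {P M N : SheafOfModules.{u} B.ring} {x : X}

namespace DualBasis

variable {W : X.Opens}

/-- The linear forms on the stalk of a dual basis. -/
def stalkForm (d : DualBasis P W) (hx : x ∈ W) (i : Fin d.n) : stalk P x →ₗ[ringStalk B.ring x] ringStalk B.ring x :=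
  (exists_stalkForm (d.φ i) hx).choose

lemma stalkForm_germ (d : DualBasis P W) (hx : x ∈ W) (i : Fin d.n) {U : X.Opens} (h : U ≤ W) (hU : x ∈ U)
    (p : P.val.obj (op U)) : d.stalkForm hx i (germ P hU p) = ringGerm B.ring hU (ev (d.φ i) h p) :=
  (exists_stalkForm (d.φ i) hx).choose_spec U h hU p

lemma sum_stalkForm (d : DualBasis P W) (hx : x ∈ W) (s : stalk P x) :
    ∑ i, d.stalkForm hx i s • germ P hx (d.p i) = s := by
  obtain ⟨U, hU, hxU, p, rfl⟩ := exists_germ_eq hx s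
  conv_rhs => rw [← d.sum_eq U hU p, map_sum]
  refine Finset.sum_congr rfl fun i _ => ?_
  rw [germ_smul, germ_res, stalkForm_germ _ _ _ hU]

lemma projective_stalk (d : DualBasis P W) (hx : x ∈ W) : Module.Projective (ringStalk B.ring x) (stalk P x) := by
  refine ⟨∑ i, (Finsupp.lsingle (germ P hx (d.p i))) ∘ₗ d.stalkForm hx i, fun s => ?_⟩
  conv_rhs => rw [← d.sum_stalkForm hx s]
  simp

/-- A map from `P_x` is fixed by the finitely many germs `f(p i)`. These lift to sections `m i` on a
common neighbourhood, and `∑ φ i · m i` has the required stalk. -/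
lemma exists_stalkHom_eq (d : DualBasis P W) (hx : x ∈ W) (f : stalk P x →ₗ[ringStalk B.ring x] stalk M x) :
    ∃ (V : X.Opens) (_ : V ≤ W) (hV : x ∈ V) (ψ : localHom P M V), stalkHom ψ hV = f := by
  have h : ∀ (n : ℕ) (t : Fin n → stalk M x), ∃ (V : X.Opens) (_ : V ≤ W) (hV : x ∈ V)
      (m : Fin n → M.val.obj (op V)), ∀ i, germ M hV (m i) = t i := by
    intro n
    induction n with
    | zero => exact fun t => ⟨W, le_rfl, hx, finZeroElim, finZeroElim⟩
    | succ n ih =>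
      intro t
      obtain ⟨V, hVW, hV, m, hm⟩ := ih (Fin.tail t)
      obtain ⟨U, hUV, hU, m₀, hm₀⟩ := exists_germ_eq hV (t 0)
      refine ⟨U, hUV.trans hVW, hU, Fin.cons m₀ fun i => res M hUV (m i), fun i => ?_⟩
      refine Fin.cases hm₀ (fun i => ?_) i
      rw [Fin.cons_succ, germ_res, hm]
      rfl
  obtain ⟨V, hVW, hV, m, hm⟩ := h d.n fun i => f (germ P hx (d.p i))
  refine ⟨V, hVW, hV, ∑ i, dualMul (localHomRes _ _ hVW (d.φ i)) (m i),
    stalkHom_ext hV fun U hU hxU p => ?_⟩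
  conv_rhs => rw [← d.sum_stalkForm hx (germ P hxU p), map_sum]
  rw [stalkHom_germ _ _ hU, AddSubgroup.val_finsetSum, Finset.sum_apply, LinearMap.sum_apply,
    map_sum]
  refine Finset.sum_congr rfl fun i _ => ?_
  rw [map_smul, ← hm, stalkForm_germ _ _ _ (hU.trans hVW), ← germ_res hU hxU]
  exact germ_smul _ _ _

lemma exists_res_eq_zero (d : DualBasis P W) (hx : x ∈ W) (ψ : localHom P M W) (h : stalkHom ψ hx = 0) :
    ∃ (V : X.Opens) (hV : V ≤ W), x ∈ V ∧ localHomRes P M hV ψ = 0 := by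
  have h : ∀ i, ∃ (V : X.Opens) (_ : x ∈ V) (h : V ≤ W), res M h (ψ.1 ⟨W, le_rfl⟩ (d.p i)) = 0 :=
    fun i => exists_res_eq_zero_of_germ_eq_zero hx (by
      rw [← stalkHom_germ ψ hx le_rfl hx, h, LinearMap.zero_apply])
  choose V hxV hV h using h
  let U : X.Opens := W ⊓ ⟨⋂ i, V i, isOpen_iInter_of_finite fun i => (V i).2⟩
  have hUV : ∀ i, U ≤ V i := fun i => inf_le_right.trans (Set.iInter_subset _ i)
  refine ⟨U, inf_le_left, ⟨hx, Set.mem_iInter.2 hxV⟩, localHom_ext fun Y p => ?_⟩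
  refine (d.apply_eq ψ (Y.2.trans inf_le_left) p).trans (Finset.sum_eq_zero fun i _ => ?_)
  rw [← res_res M (hV i) (Y.2.trans (hUV i)), h, map_zero, smul_zero]

end DualBasis

end AlgebraSheaf

/-! ### The evaluation morphism and its stalks -/

namespace AlgebraSheaf

open NCSheaf

variable {X : Scheme.{u}} {B : AlgebraSheaf X}

section Evaluation

variable (P M : SheafOfModules.{u} B.ring)

/-- The sheaf `P ⊗_A Hom_B(P, M)`. -/
abbrev evalSheaf : SheafOfModules.{u} B.ring := (B.tensorSheaf P).obj ((B.homSheaf P).obj M)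

/-- The evaluation morphism `P ⊗_A Hom_B(P, M) ⟶ M`. -/
abbrev evalHom : evalSheaf P M ⟶ M := (B.tensorHomAdjunction P).counit.app M

variable {P M} {V : X.Opens} {x : X}

/-- The local homomorphism `p ↦ p ⊗ ψ`. -/
def tmulLocal (ψ : localHom P M V) : localHom P (evalSheaf P M) V :=
  homApp ((B.tensorHomAdjunction P).unit.app ((B.homSheaf P).obj M)) V ψ

lemma tmulLocal_apply (ψ : localHom P M V) {U : X.Opens} (h : U ≤ V) (p : P.val.obj (op U)) :
    (tmulLocal ψ).1 ⟨U, h⟩ p = (toSheafif (tensorPresheaf P ((B.homSheaf P).obj M))).app (op U)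
      (tmul P ((B.homSheaf P).obj M) (op U) p (localHomRes P M h ψ)) :=
  tensorHomAdjunction_unit P ((B.homSheaf P).obj M) V ψ h p

/-- This is a triangle identity, evaluated at the section `ψ` of `Hom(P, M)`. -/
lemma evalHom_tmulLocal (ψ : localHom P M V) {U : X.Opens} (h : U ≤ V) (p : P.val.obj (op U)) :
    appLin (evalHom P M) U ((tmulLocal ψ).1 ⟨U, h⟩ p) = ψ.1 ⟨U, h⟩ p := by
  have := (B.tensorHomAdjunction P).right_triangle_components M
  exact congrArg (fun f : (B.homSheaf P).obj M ⟶ (B.homSheaf P).obj M =>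
    (homApp f V ψ).1 ⟨U, h⟩ p) this

/-- The map from sections of the presheaf tensor product to sections of `P ⊗_A Hom_B(P, M)`. -/
def tensorSection (P M : SheafOfModules.{u} B.ring) (V : X.Opens) :
    TensorSections P ((B.homSheaf P).obj M) (op V) →+ (evalSheaf P M).val.obj (op V) :=
  ((toSheafif (tensorPresheaf P ((B.homSheaf P).obj M))).app (op V)).hom.toAddMonoidHom

lemma tensorSection_tmul (ψ : localHom P M V) (p : P.val.obj (op V)) :
    tensorSection P M V (tmul P ((B.homSheaf P).obj M) (op V) p ψ) = (tmulLocal ψ).1 ⟨V, le_rfl⟩ p :=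
  (tmulLocal_apply ψ le_rfl p).symm

lemma exists_tensorSection_eq (t : (evalSheaf P M).val.obj (op V)) (hx : x ∈ V) :
    ∃ (W : X.Opens) (h : W ≤ V) (t' : TensorSections P ((B.homSheaf P).obj M) (op W)), x ∈ W ∧
      tensorSection P M W t' = res _ h t :=
  locSurj_toSheafif (tensorPresheaf P ((B.homSheaf P).obj M)) V t x hx

/-- The stalk of the evaluation morphism. -/
def evalStalk (P M : SheafOfModules.{u} B.ring) (x : X) :
    stalk (evalSheaf P M) x →ₗ[ringStalk B.ring x] stalk M x :=
  stalkHom (V := ⊤) (toLocal ⊤ (evalHom P M)) trivial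

lemma evalStalk_germ {U : X.Opens} (hx : x ∈ U) (t : (evalSheaf P M).val.obj (op U)) :
    evalStalk P M x (germ _ hx t) = germ M hx (appLin (evalHom P M) U t) :=
  stalkHom_germ _ _ le_top hx t

lemma evalStalk_comp (ψ : localHom P M V) (hx : x ∈ V) :
    evalStalk P M x ∘ₗ stalkHom (tmulLocal ψ) hx = stalkHom ψ hx :=
  stalkHom_ext hx fun U hU hxU p => by
    rw [LinearMap.comp_apply, stalkHom_germ _ _ hU, stalkHom_germ _ _ hU, evalStalk_germ,
      evalHom_tmulLocal]

/-- A germ of the tensor product is a finite sum of `p ⊗ ψ`, and each of these is the image of the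
germ of `p` under the stalk of `p ↦ p ⊗ ψ`. -/
lemma iSup_range_stalk_evalSheaf :
    ⨆ u : stalk P x →ₗ[ringStalk B.ring x] stalk (evalSheaf P M) x, LinearMap.range u = ⊤ := by
  rw [eq_top_iff]
  rintro s -
  obtain ⟨U, hU, hx, t, rfl⟩ := exists_germ_eq (show x ∈ (⊤ : X.Opens) from trivial) s
  obtain ⟨W, hW, t', hxW, ht⟩ := exists_tensorSection_eq t hx
  rw [← germ_res hW hxW, ← ht]
  clear ht
  induction t' using tensor_induction with
  | h0 =>
    rw [map_zero, map_zero]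
    exact Submodule.zero_mem _
  | h1 p ψ =>
    refine Submodule.mem_iSup_of_mem (stalkHom (tmulLocal (M := M) ψ) hxW) ⟨germ P hxW p, ?_⟩
    rw [stalkHom_germ _ _ le_rfl]
    exact congrArg (germ (evalSheaf P M) hxW) (tensorSection_tmul (M := M) ψ p).symm
  | h2 y z hy hz =>
    rw [map_add, map_add]
    exact Submodule.add_mem _ hy hz

/-- The evaluation morphism is an isomorphism if the stalks are presented by multiples. -/
lemma isIso_evalHom (h : ∀ (V : X.Opens), ∀ x ∈ V, ∃ (W : X.Opens) (_ : W ≤ V), x ∈ W ∧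
      Nonempty (DualBasis P W))
    (hM : ∀ x, IsPresentedByMultiples (ringStalk B.ring x) (stalk P x) (stalk M x)) :
    IsIso (evalHom P M) := by
  have hb : ∀ x, Function.Bijective (evalStalk P M x) := by
    intro x
    obtain ⟨W, -, hx, ⟨d⟩⟩ := h ⊤ x trivial
    have := d.projective_stalk hx
    refine (hM x).bijective _ (fun u hu => ?_) (fun v => ?_) iSup_range_stalk_evalSheaf
    · obtain ⟨V, hVW, hV, ψ, rfl⟩ := d.exists_stalkHom_eq hx u
      have h0 : stalkHom (show localHom P M V from
          (homMap P (evalHom P M)).val.app (op V) ψ) hV = 0 := by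
        rw [← hu]
        refine stalkHom_ext hV fun U hU hxU p => ?_
        rw [LinearMap.comp_apply, stalkHom_germ _ _ hU, stalkHom_germ _ _ hU, evalStalk_germ]
        rfl
      obtain ⟨U, hU, hxU, e⟩ := (d.restrict hVW).exists_res_eq_zero hV _ h0
      -- The unit is invertible, so the triangle identity makes `Hom(P, -)` of the evaluation
      -- invertible. Hence a local `ψ` that evaluation kills near `x` is zero there.
      have : IsIso ((B.homSheaf P).map (evalHom P M)) := by
        have := isIso_unit (N := (B.homSheaf P).obj M) h
        have : IsIso ((B.tensorHomAdjunction P).unit.app ((B.homSheaf P).obj M) ≫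
            (B.homSheaf P).map (evalHom P M)) := by
          rw [(B.tensorHomAdjunction P).right_triangle_components M]
          infer_instance
        exact IsIso.of_isIso_comp_left
          ((B.tensorHomAdjunction P).unit.app ((B.homSheaf P).obj M)) _
      have e' : localHomRes P _ hU ψ = 0 :=
        injective_of_mono (B := B.minor P) ((B.homSheaf P).map (evalHom P M)) U
          (e.trans (map_zero (((B.homSheaf P).map (evalHom P M)).val.app (op U)).hom).symm)
      rw [← stalkHom_localHomRes ψ hU hxU, e']
      exact stalkHom_ext hxU fun Y hY hxY p => by
        rw [stalkHom_germ _ _ hY, LinearMap.zero_apply]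
        exact map_zero (germ _ _)
    · obtain ⟨V, hVW, hV, ψ, rfl⟩ := d.exists_stalkHom_eq hx v
      exact ⟨_, evalStalk_comp ψ hV⟩
  refine isIso_of_locInj_of_locSurj _ (fun V t ht x hx => ?_) (fun V m x hx => ?_)
  · have : germ (evalSheaf P M) hx t = 0 := (hb x).1 (by
      rw [evalStalk_germ, map_zero]
      exact (congrArg (germ M hx) ht).trans (map_zero _))
    obtain ⟨W, hxW, hW, e⟩ := exists_res_eq_zero_of_germ_eq_zero hx this
    exact ⟨W, hW, hxW, e⟩
  · obtain ⟨s, hs⟩ := (hb x).2 (germ M hx m)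
    obtain ⟨U, hU, hxU, t, rfl⟩ := exists_germ_eq hx s
    rw [evalStalk_germ] at hs
    obtain ⟨W, hxW, i, i', e⟩ := exists_res_eq_of_germ_eq _ _ hs
    exact ⟨W, i', res _ i t, hxW, (appLin_res _ i t).trans e⟩

/-- The presentation class of a section of the presheaf tensor product. -/
lemma exists_tensor_presentation (hx : x ∈ V) :
    ∃ g : TensorSections P ((B.homSheaf P).obj M) (op V) →+
        ((stalk P x →ₗ[ringStalk B.ring x] stalk M x) →₀ stalk P x) ⧸
          evaluationRel (ringStalk B.ring x) (stalk P x) (stalk M x),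
      ∀ (p : P.val.obj (op V)) (ψ : localHom P M V),
        g (tmul P ((B.homSheaf P).obj M) (op V) p ψ) =
          Submodule.Quotient.mk (Finsupp.single (stalkHom ψ hx) (germ P hx p)) := by
  let K := evaluationRel (ringStalk B.ring x) (stalk P x) (stalk M x)
  refine exists_tensorLift P ((B.homSheaf P).obj M) (op V)
    (AddMonoidHom.mk' (fun p => AddMonoidHom.mk' (fun ψ : localHom P M V =>
      Submodule.Quotient.mk (Finsupp.single (stalkHom ψ hx) (germ P hx p))) fun ψ ψ' => ?_)
      fun p p' => AddMonoidHom.ext fun (ψ : localHom P M V) => ?_) fun a p (ψ : localHom P M V) => ?_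
  -- Additivity in `ψ`, and balancedness below, are relations `h(q)` with `h : P_x → ⨁ P_x` killed
  -- by evaluation, so they hold modulo `evaluationRel`.
  · have e (φ φ' : localHom P M V) :
        K.mkQ (Finsupp.single (stalkHom (φ + φ') hx) (germ P hx p)) =
        K.mkQ (Finsupp.single (stalkHom φ hx) (germ P hx p)) +
          K.mkQ (Finsupp.single (stalkHom φ' hx) (germ P hx p)) := by
      rw [← map_add, Submodule.mkQ_apply, Submodule.mkQ_apply, Submodule.Quotient.eq, stalkHom_add]
      exact mem_evaluationRel (h := Finsupp.lsingle (stalkHom φ hx + stalkHom φ' hx) -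
        (Finsupp.lsingle (stalkHom φ hx) + Finsupp.lsingle (stalkHom φ' hx)))
        (fun q => by simp [evaluation_single]) (germ P hx p)
    exact e ψ ψ'
  · change K.mkQ (Finsupp.single (stalkHom ψ hx) (germ P hx (p + p'))) =
      K.mkQ (Finsupp.single (stalkHom ψ hx) (germ P hx p)) +
        K.mkQ (Finsupp.single (stalkHom ψ hx) (germ P hx p'))
    rw [map_add, Finsupp.single_add, map_add]
  · let a' : localHom P P V := (show (localEnd P V)ᵐᵒᵖ from a).unop
    let aψ : localHom P M V := (show (localEnd P V)ᵐᵒᵖ from a) • ψ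
    change K.mkQ (Finsupp.single (stalkHom ψ hx) (germ P hx (a'.1 ⟨V, le_rfl⟩ p))) =
      K.mkQ (Finsupp.single (stalkHom aψ hx) (germ P hx p))
    have haψ : stalkHom aψ hx = stalkHom ψ hx ∘ₗ stalkHom a' hx :=
      stalkHom_ext hx fun U hU hxU q => by
        rw [LinearMap.comp_apply, stalkHom_germ _ _ hU, stalkHom_germ _ _ hU, stalkHom_germ _ _ hU]
        rfl
    rw [Submodule.mkQ_apply, Submodule.mkQ_apply, Submodule.Quotient.eq, ← stalkHom_germ a' hx le_rfl hx, haψ]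
    exact mem_evaluationRel (h := Finsupp.lsingle (stalkHom ψ hx) ∘ₗ stalkHom a' hx -
      Finsupp.lsingle (stalkHom ψ hx ∘ₗ stalkHom a' hx))
      (fun q => by simp [evaluation_single]) (germ P hx p)

/-- Let `z` be in the kernel of evaluation on the canonical sum of copies of `P_x`. Represent `z` by
a tensor near `x`; the evaluation morphism is injective, so this tensor vanishes near `x`. The class
of `z` modulo `evaluationRel` depends only on the tensor, hence is zero. -/
lemma isPresentedByMultiples_stalk (h : ∀ (V : X.Opens), ∀ x ∈ V, ∃ (W : X.Opens) (_ : W ≤ V),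
      x ∈ W ∧ Nonempty (DualBasis P W)) [IsIso (evalHom P M)] (x : X) :
    IsPresentedByMultiples (ringStalk B.ring x) (stalk P x) (stalk M x) := by
  obtain ⟨W, -, hx, ⟨d⟩⟩ := h ⊤ x trivial
  refine isPresentedByMultiples_of_ker_le ?_ ?_
  · have hb : Function.Surjective (evalStalk P M x) := fun s => by
      obtain ⟨U, hU, hxU, m, rfl⟩ := exists_germ_eq hx s
      obtain ⟨V, hV, t, hxV, ht⟩ := locSurj_of_epi (evalHom P M) U m x hxU
      refine ⟨germ _ hxV t, ?_⟩
      rw [evalStalk_germ, ← germ_res hV hxV]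
      exact congrArg (germ M hxV) ht
    rw [← LinearMap.range_eq_top, eq_top_iff, ← LinearMap.range_eq_top.2 hb,
      LinearMap.range_eq_map, ← iSup_range_stalk_evalSheaf, Submodule.map_iSup]
    refine iSup_le fun u => ?_
    rintro _ ⟨_, ⟨q, rfl⟩, rfl⟩
    exact ⟨Finsupp.single (evalStalk P M x ∘ₗ u) q, evaluation_single _ _⟩
  · choose g hg using fun (V : X.Opens) (hV : x ∈ V) => exists_tensor_presentation (M := M) (P := P) hV
    have hgr : ∀ (U V : X.Opens) (h : V ≤ U) (hV : x ∈ V)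
        (t : TensorSections P ((B.homSheaf P).obj M) (op U)),
        g V hV (tensorRes P ((B.homSheaf P).obj M) (homOfLE h).op t) = g U (h hV) t := by
      intro U V h hV t
      induction t using tensor_induction with
      | h0 => rw [map_zero, map_zero, map_zero]
      | h1 p ψ =>
        refine (hg V hV (res P h p) (localHomRes P M h ψ)).trans ((hg U (h hV) p ψ).trans ?_).symm
        rw [germ_res]
        exact congrArg (fun f => Submodule.Quotient.mk (Finsupp.single f (germ P (h hV) p)))
          (stalkHom_localHomRes (M := P) (N := M) ψ h hV).symm
      | h2 y z hy hz => rw [map_add, map_add, map_add, hy, hz]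
    -- The class of a tensor and its value under the evaluation morphism are compatible with
    -- evaluation on the sum of copies of `P_x`.
    have hge : ∀ (U : X.Opens) (hU : x ∈ U) (t : TensorSections P ((B.homSheaf P).obj M) (op U)),
        germ M hU (appLin (evalHom P M) U (tensorSection P M U t)) =
          (evaluationRel _ _ _).liftQ (evaluation (ringStalk B.ring x) (stalk P x) (stalk M x))
            evaluationRel_le (g U hU t) := by
      intro U hU t
      induction t using tensor_induction with
      | h0 => simp only [map_zero]
      | h1 p ψ =>
        refine Eq.trans ?_ (congrArg ((evaluationRel _ _ _).liftQ
          (evaluation (ringStalk B.ring x) (stalk P x) (stalk M x)) evaluationRel_le)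
          (hg U hU p ψ).symm)
        refine Eq.trans ?_ (evaluation_single (stalkHom (N := M) ψ hU) (germ P hU p)).symm
        refine Eq.trans ?_ (stalkHom_germ (N := M) ψ hU le_rfl hU p).symm
        exact congrArg (germ M hU) ((congrArg (appLin (evalHom P M) U)
          (tensorSection_tmul (M := M) ψ p)).trans (evalHom_tmulLocal (M := M) ψ le_rfl p))
      | h2 y z hy hz => simp only [map_add, hy, hz]
    -- Every class comes from a tensor, since maps from `P_x` are germs of local homomorphisms.
    have hs : ∀ z : (stalk P x →ₗ[ringStalk B.ring x] stalk M x) →₀ stalk P x,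
        ∃ (U : X.Opens) (hU : x ∈ U) (t : TensorSections P ((B.homSheaf P).obj M) (op U)),
          g U hU t = Submodule.Quotient.mk z := by
      intro z
      induction z using Finsupp.induction_linear with
      | zero => exact ⟨W, hx, 0, map_zero _⟩
      | add y z hy hz =>
        obtain ⟨U, hU, t, ht⟩ := hy
        obtain ⟨V, hV, t', ht'⟩ := hz
        refine ⟨U ⊓ V, ⟨hU, hV⟩, tensorRes P ((B.homSheaf P).obj M) (homOfLE inf_le_left).op t +
          tensorRes P ((B.homSheaf P).obj M) (homOfLE inf_le_right).op t', ?_⟩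
        rw [map_add, hgr _ _ inf_le_left ⟨hU, hV⟩, hgr _ _ inf_le_right ⟨hU, hV⟩, ht, ht']
        rfl
      | single f q =>
        obtain ⟨V, hVW, hV, ψ, rfl⟩ := d.exists_stalkHom_eq hx f
        obtain ⟨U, hU, hxU, p, rfl⟩ := exists_germ_eq hV q
        refine ⟨U, hxU, tmul P ((B.homSheaf P).obj M) (op U) p (localHomRes P M hU ψ), ?_⟩
        refine (hg U hxU p (localHomRes P M hU ψ)).trans ?_
        rw [stalkHom_localHomRes]
    intro z hz
    obtain ⟨U, hU, t, ht⟩ := hs z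
    have h0 : germ M hU (appLin (evalHom P M) U (tensorSection P M U t)) = 0 := by
      rw [hge, ht]
      exact hz
    obtain ⟨V, hxV, hV, e⟩ := exists_res_eq_zero_of_germ_eq_zero hU h0
    have e' : tensorSection P M V (tensorRes P ((B.homSheaf P).obj M) (homOfLE hV).op t) = 0 := by
      refine injective_of_mono (evalHom P M) V (Eq.trans ?_ (map_zero (appLin (evalHom P M) V)).symm)
      refine Eq.trans ?_ e
      refine Eq.trans ?_ (appLin_res (evalHom P M) hV (tensorSection P M U t))
      exact congrArg (appLin (evalHom P M) V)
        (app_pres (toSheafif (tensorPresheaf P ((B.homSheaf P).obj M))) hV t)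
    obtain ⟨Y, hY, hxY, e''⟩ := locInj_toSheafif (tensorPresheaf P ((B.homSheaf P).obj M)) V _ e' x hxV
    have h1 : g V hxV (tensorRes P ((B.homSheaf P).obj M) (homOfLE hV).op t) = 0 := by
      rw [← hgr _ _ hY hxY]
      exact (congrArg (g Y hxY) e'').trans (map_zero _)
    rw [hgr, ht] at h1
    exact (Submodule.Quotient.mk_eq_zero _).1 h1

end Evaluation

end AlgebraSheaf

end

/-! ### The main theorem -/

theorem mainTheorem1 (X : Scheme.{u}) [X.IsSeparated] [CompactSpace X]
    (B : AlgebraSheaf X) (hB : B.IsNCScheme)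
    (P : B.Mod) (hP : B.IsLocallyFGProjective P.obj) :
    -- `A = (End_B P)ᵒᵖ` is again a non-commutative scheme
    (B.minor P.obj).IsNCScheme ∧
    ∃ (_ : IsAbelianSubcategory B.qcoh) (_ : IsAbelianSubcategory (B.minor P.obj).qcoh)
      (hF : ∀ N : (B.minor P.obj).Mod, B.qcoh ((B.tensorSheaf P.obj).obj N.obj))
      (hG : ∀ M : B.Mod, (B.minor P.obj).qcoh ((B.homSheaf P.obj).obj M.obj))
      (F : (B.minor P.obj).Mod ⥤ B.Mod) (G : B.Mod ⥤ (B.minor P.obj).Mod)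
      (H : (B.minor P.obj).Mod ⥤ B.Mod)
      (ε : H ⋙ B.qcoh.ι ⟶ (B.minor P.obj).qcoh.ι ⋙ B.homDualSheaf P.obj)
      (C : ObjectProperty B.Mod),
      -- the functors `F = P ⊗_A -`, `G = Hom_B(P, -)` and the subcategory `C = Ker G`
      F = B.tensorMod P.obj hF ∧ G = B.homMod P.obj hG ∧ C = G.kernel ∧
      -- the functor `H = Hom_A(P^∨, -)`
      B.IsQuasicoherentHomDual P.obj H ε ∧
      (∀ N : (B.minor P.obj).Mod, B.qcoh ((B.homDualSheaf P.obj).obj N.obj) → IsIso (ε.app N)) ∧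
      (B.IsNoetherian → ∀ N : (B.minor P.obj).Mod, IsIso (ε.app N)) ∧
      -- `G` is exact and is the quotient functor by the bilocalizing subcategory `C`
      (PreservesFiniteLimits G ∧ PreservesFiniteColimits G) ∧
      (∃ _ : C.IsSerreClass, IsBilocalizing C ∧
        ∃ e : C.isoModSerre.Localization ≌ (B.minor P.obj).Mod,
          Nonempty (C.isoModSerre.Q ⋙ e.functor ≅ G)) ∧
      -- the unit `1 ⟶ GF` and the counit `GH ⟶ 1` are isomorphisms
      (∃ adj : F ⊣ G, IsIso adj.unit) ∧
      (∃ adj : G ⊣ H, IsIso adj.counit) ∧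
      -- `F` is a full embedding with essential image the left orthogonal of `C`
      (F.Full ∧ F.Faithful ∧ F.essImage = leftOrthogonal C ∧
        ∃ e : (B.minor P.obj).Mod ≌ (leftOrthogonal C).FullSubcategory,
          Nonempty (e.functor ⋙ (leftOrthogonal C).ι ≅ F) ∧
          Nonempty (e.inverse ≅ (leftOrthogonal C).ι ⋙ G)) ∧
      -- `H` is a full embedding with essential image the right orthogonal of `C`
      (H.Full ∧ H.Faithful ∧ H.essImage = rightOrthogonal C ∧
        ∃ e : (B.minor P.obj).Mod ≌ (rightOrthogonal C).FullSubcategory,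
          Nonempty (e.functor ⋙ (rightOrthogonal C).ι ≅ H) ∧
          Nonempty (e.inverse ≅ (rightOrthogonal C).ι ⋙ G)) ∧
      -- the left orthogonal of `C`: modules whose stalks are presented by multiples of `P_x`
      (∀ M : B.Mod, leftOrthogonal C M ↔
        ∀ x : X, NCSheaf.IsPresentedByMultiples (NCSheaf.ringStalk B.ring x)
          (NCSheaf.stalk P.obj x) (NCSheaf.stalk M.obj x)) ∧
      -- the right orthogonal of `C`: modules copresented by images under `H` of injectives
      (∀ M : B.Mod, rightOrthogonal C M ↔
        ∃ (J₀ J₁ : (B.minor P.obj).Mod) (i : M ⟶ H.obj J₀) (d : H.obj J₀ ⟶ H.obj J₁)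
          (w : i ≫ d = 0), Injective J₀ ∧ Injective J₁ ∧ Mono i ∧
            (ShortComplex.mk i d w).Exact) := by
  have hA : (B.minor P.obj).IsNCScheme := AlgebraSheaf.isNCScheme_minor hB P.property hP
  have h : ∀ (V : X.Opens), ∀ x ∈ V, ∃ (W : X.Opens) (_ : W ≤ V), x ∈ W ∧
      Nonempty (AlgebraSheaf.DualBasis P.obj W) := fun V x hx => by
    obtain ⟨W, hW, hxW, -, d⟩ := hP.exists_dualBasis hB P.property hx
    exact ⟨W, hW, hxW, d⟩
  have hF : ∀ N : (B.minor P.obj).Mod, B.qcoh ((B.tensorSheaf P.obj).obj N.obj) :=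
    fun N => AlgebraSheaf.qcoh_tensor P.property hA N.property
  have hG : ∀ M : B.Mod, (B.minor P.obj).qcoh ((B.homSheaf P.obj).obj M.obj) :=
    fun M => AlgebraSheaf.qcoh_hom hB P.property hP M.property
  let F := B.tensorMod P.obj hF
  let G := B.homMod P.obj hG
  let H := AlgebraSheaf.homDualMod P.obj hB
  let adj : F ⊣ G := AlgebraSheaf.tensorHomAdjunctionMod hF hG
  let adj' : G ⊣ H := AlgebraSheaf.homHomDualAdjunction hB hG h
  have hunit : IsIso adj.unit := AlgebraSheaf.isIso_tensorHomAdjunctionMod_unit hF hG h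
  -- In an adjoint triple the left adjoint is fully faithful if and only if the right one is.
  have hcounit : IsIso adj'.counit := (Adjunction.Triple.mk adj adj').isIso_unit_iff_isIso_counit.1 hunit
  have hl : PreservesFiniteLimits G := by
    have := adj.rightAdjoint_preservesLimits
    infer_instance
  have hr : PreservesFiniteColimits G := by
    have := adj'.leftAdjoint_preservesColimits
    infer_instance
  have hl' : PreservesFiniteLimits H := by
    have := adj'.rightAdjoint_preservesLimits
    infer_instance
  have := AlgebraSheaf.enoughInjectives hB
  have := AlgebraSheaf.enoughInjectives hA
  have hFf := adj.fullyFaithfulLOfIsIsoUnit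
  have hHf := adj'.fullyFaithfulROfIsIsoCounit
  have := hHf.full
  have := hHf.faithful
  have hFe : F.essImage = leftOrthogonal G.kernel := essImage_eq_leftOrthogonal adj
  have hHe : H.essImage = rightOrthogonal G.kernel := essImage_eq_rightOrthogonal adj'
  refine ⟨hA, inferInstance, inferInstance, hF, hG, F, G, H, AlgebraSheaf.homDualModHom P.obj hB,
    G.kernel, rfl, rfl, rfl, AlgebraSheaf.isQuasicoherentHomDual_homDualMod hB,
    AlgebraSheaf.isIso_homDualModHom_app hB, fun hN N => AlgebraSheaf.isIso_homDualModHom_app hB N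
      (AlgebraSheaf.qcoh_homDual hN P.property hP N.property), ⟨hl, hr⟩,
    exists_isBilocalizing_kernel adj adj', ⟨adj, hunit⟩, ⟨adj', hcounit⟩,
    ⟨hFf.full, hFf.faithful, hFe, exists_equivalence_of_isIso_unit adj (fun N => ?_)
      fun M hM => isIso_counit_of_leftOrthogonal adj hM⟩,
    ⟨hHf.full, hHf.faithful, hHe, exists_equivalence_of_isIso_counit adj' (fun N => ?_)
      fun M hM => isIso_unit_of_rightOrthogonal adj' hM⟩, fun M => ⟨fun hM x => ?_, fun hM => ?_⟩,
    fun M => ?_⟩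
  · exact hFe ▸ F.obj_mem_essImage N
  · exact hHe ▸ H.obj_mem_essImage N
  · have h1 : IsIso (adj.counit.app M) := isIso_counit_of_leftOrthogonal adj hM
    have : IsIso (AlgebraSheaf.evalHom P.obj M.obj) :=
      inferInstanceAs (IsIso (B.qcoh.ι.map (adj.counit.app M)))
    exact AlgebraSheaf.isPresentedByMultiples_stalk h x
  -- The counit is the evaluation morphism; once it is invertible, `M` lies in the essential image
  -- of `F`, which is the left orthogonal.
  · have h1 : IsIso (B.qcoh.ι.map (adj.counit.app M)) := AlgebraSheaf.isIso_evalHom h hM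
    have : IsIso (adj.counit.app M) := isIso_of_reflects_iso _ B.qcoh.ι
    exact hFe ▸ ⟨_, ⟨asIso (adj.counit.app M)⟩⟩
  · rw [← hHe]
    exact essImage_iff_injective_copresentation M
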